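/- Let $p$ be a prime, let $\mathcal O$ be a complete discrete valuation ring with finite residue field $k$ of characteristic $p$ and fraction field $K$ (for instance the ring of integers of a $p$-adic field), and let $q\ge 1$ be an integer prime to $p$ (for instance the size of the residue field of an $\ell$-adic field, $\ell\neq p$). Let $T_q=\widehat{\mathbf Z}\ltimes\mathbf Z_p$, where the generator $\phi$ of $\widehat{\mathbf Z}$ acts on $\mathbf Z_p$ as multiplication by $q$, and let $\tau$ be a topological generator of $\mathbf Z_p$, so $\phi\tau\phi^{-1}=\tau^q$. Let $n\ge1$, let $G$ be $\mathrm{GL}_n$, $\mathrm{GSp}_n$ ($n$ even) or $\mathrm{GO}_n$ over $\mathcal O$ (similitude groups of the standard alternating, respectively symmetric, pairing), let $\mathfrak g$ be its Lie algebra, and let $G'=\mathrm{SL}_n$, $\mathrm{Sp}_n$, $\mathrm{SO}_n$ respectively, $S=G/G'$ and $\mu:G\to S$ the quotient map. For a coefficient $\mathcal O$-algebra $A$ (a complete local Noetherian $\mathcal O$-algebra with residue field $k$) put $\widehat G(A)=\ker(G(A)\to G(k))$. Let $\bar\rho:T_q\to G(k)$ be a continuous homomorphism, and put $\overline N=\log\bar\rho(\tau)$,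 where $\exp$ and $\log$ are the truncated series $\exp(A)=\sum_{i=0}^{n-1}A^i/i!$ and $\log(B)=\sum_{i=1}^{n-1}(-1)^{i+1}(B-1)^i/i$. Assume: * (A1) $p$ is very good for $G$, i.e. $p\nmid n$ if $G=\mathrm{GL}_n$, and $p\ne2$ otherwise; * (A2) $p>n$; * (A3) $q$ is a square in $\mathcal O^\times$, and $-1$ and $2$ have square roots in $\mathcal O^\times$; * (A4) $N_\sigma\in\mathfrak g$ is a lift of $\overline N$ whose image over $\overline K$ is nilpotent with the same Jordan type $\sigma$ (a partition of $n$) as the image of $\overline N$ over $\overline k$, and the scheme-theoretic centralizer $Z_G(N_\sigma)$ is smooth over $\mathcal O$. A continuous lift $\rho:T_q\to G(A)$ of $\bar\rho$ to an Artinian coefficient $\mathcal O$-algebra $A$ is *minimally ramified* if $\rho(\tau)=\exp(gN_\sigma g^{-1})$ for some $g\in\widehat G(A)$. Let $\nu:T_q\to S(\mathcal O)$ be a continuous homomorphism lifting $\mu\circ\bar\rho$ with $\nu(\tau)=1$, and let $\mathcal D^\square(A)$ be the set of minimally ramified lifts $\rho$ of $\bar\rho$ to $A$ such that $\mu\circ\rho$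 is the image of $\nu$ in $S(A)$. Then: 1. $\mathcal D^\square$ is a lifting condition, so it defines a deformation condition $\mathcal D$: it is a subfunctor of the functor of lifts of $\bar\rho$ on Artinian coefficient $\mathcal O$-algebras, it is closed under conjugation by $\widehat G(A)$, and for every Cartesian diagram $A=A_1\times_{A_0}A_2$ of such algebras, a lift to $A$ is in $\mathcal D^\square(A)$ if and only if its images over $A_1$ and $A_2$ are in $\mathcal D^\square(A_1)$ and $\mathcal D^\square(A_2)$. 2. It is liftable: for every surjection $f:A_1\to A_0$ of Artinian coefficient $\mathcal O$-algebras with $\ker(f)\cdot\mathfrak m_{A_1}=0$, the map $\mathcal D^\square(A_1)\to\mathcal D^\square(A_0)$ is surjective. 3. $\mathcal D^\square$ is pro-represented by a coefficient $\mathcal O$-algebra $R^{\mathrm{m.r.},\nu,\square}_{\bar\rho}$ which is formally smooth over $\mathcal O$ of relative dimension $\dim G_k-1$, i.e. isomorphic to a power series ring over $\mathcal O$ in $\dim G_k-1$ variables. 4. The tangent space $\mathcal D(k[\epsilon]/\epsilon^2)$ of the deformation functor is a $k$-subspace of $H^1(T_q,\mathrm{ad}\,\bar\rho)$ (the class of a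 cocycle $c$ corresponding to the lift $x\mapsto\exp(\epsilon c(x))\bar\rho(x)$) of dimension $\dim_kH^0(T_q,\mathrm{ad}\,\bar\rho)-1$. -/

import Mathlib

open IsLocalRing Matrix

universe u

noncomputable section

namespace MinRam

/-! ## The group `T_q`, the semidirect product of `ℤ̂` and `ℤ_p` -/

section TameGroup

/-- `ℤ̂`, the profinite completion of `ℤ`, written multiplicatively. -/
abbrev ZHat : ProfiniteGrp.{0} :=
  ProfiniteGrp.ProfiniteCompletion.completion (GrpCat.of (Multiplicative ℤ))

/-- The canonical topological generator of `ℤ̂`. -/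
def zhatGen : ZHat :=
  ProfiniteGrp.ProfiniteCompletion.etaFn (GrpCat.of (Multiplicative ℤ)) (Multiplicative.ofAdd (1 : ℤ))

variable (p : ℕ) [Fact p.Prime]

instance : TotallyDisconnectedSpace ℤ_[p]ˣ :=
  have : TotallyDisconnectedSpace ℤ_[p]ᵐᵒᵖ :=
    MulOpposite.opHomeomorph.totallyDisconnectedSpace
  (Units.isEmbedding_embedProduct (M := ℤ_[p])).isTotallyDisconnected_range.mp
    (isTotallyDisconnected_of_totallyDisconnectedSpace _)

variable {p} in
/-- An integer prime to `p`, as a unit of `ℤ_p`. -/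
def qUnit {q : ℕ} (hq : p.Coprime q) : ℤ_[p]ˣ :=
  (PadicInt.isUnit_iff.mpr (PadicInt.norm_natCast_eq_one_iff.mpr hq)).unit

variable {p} in
/-- The continuous homomorphism `ℤ̂ → ℤ_pˣ`, `x ↦ u ^ x`, obtained from the universal property of
the profinite completion. -/
def zhatPow (u : ℤ_[p]ˣ) : ZHat →* ℤ_[p]ˣ :=
  (ProfiniteGrp.ProfiniteCompletion.lift (G := GrpCat.of (Multiplicative ℤ))
    (P := ProfiniteGrp.of ℤ_[p]ˣ) (GrpCat.ofHom (zpowersHom ℤ_[p]ˣ u))).hom.toMonoidHom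

/-- `ℤ_pˣ` acting on `ℤ_p` by multiplication. -/
def unitsAct : ℤ_[p]ˣ →* MulAut (Multiplicative ℤ_[p]) :=
  (MulAutMultiplicative ℤ_[p]).symm.toMonoidHom.comp (DistribMulAction.toAddAut ℤ_[p]ˣ ℤ_[p])

/-- `T_q`: the semidirect product of `ℤ̂` and `ℤ_p` in which the generator `φ` of `ℤ̂` acts on `ℤ_p`
as multiplication by `q`. -/
abbrev Tame (q : ℕ) (hq : p.Coprime q) : Type :=
  Multiplicative ℤ_[p] ⋊[(unitsAct p).comp (zhatPow (qUnit hq))] ZHat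

/-- `T_q` carries the product topology of `ℤ_p × ℤ̂`. -/
instance (q : ℕ) (hq : p.Coprime q) : TopologicalSpace (Tame p q hq) :=
  TopologicalSpace.induced SemidirectProduct.equivProd inferInstance

variable {p} {q : ℕ} (hq : p.Coprime q)

/-- The topological generator `τ` of `ℤ_p ⊂ T_q`. -/
def tau : Tame p q hq := SemidirectProduct.inl (Multiplicative.ofAdd (1 : ℤ_[p]))

/-- The Frobenius `φ ∈ ℤ̂ ⊂ T_q`. -/
def phi : Tame p q hq := SemidirectProduct.inr zhatGen

theorem phi_tau : phi hq * tau hq * (phi hq)⁻¹ = tau hq ^ q := by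
  have h : zhatPow (qUnit hq) zhatGen = qUnit hq := by
    have := CategoryTheory.ConcreteCategory.congr_hom (ProfiniteGrp.ProfiniteCompletion.lift_eta
      (G := GrpCat.of (Multiplicative ℤ)) (P := ProfiniteGrp.of ℤ_[p]ˣ)
      (GrpCat.ofHom (zpowersHom ℤ_[p]ˣ (qUnit hq)))) (Multiplicative.ofAdd (1 : ℤ))
    refine this.trans ?_
    change (zpowersHom ℤ_[p]ˣ (qUnit hq)) (Multiplicative.ofAdd (1 : ℤ)) = _
    simp
  unfold phi tau
  rw [← map_inv, ← SemidirectProduct.inl_aut, ← map_pow]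
  congr 1
  rw [MonoidHom.comp_apply, h]
  change Multiplicative.ofAdd ((qUnit hq : ℤ_[p]) * 1) = _
  rw [← ofAdd_nsmul]
  simp [qUnit]

end TameGroup

/-! ## The groups `GL_n`, `GSp_n`, `GO_n` as functors of points -/

section Groups

/-- The three families of groups. -/
inductive Family
  | GL
  | GSp
  | GO

/-- The matrix `I'_n` of the standard symmetric pairing. -/
def stdSym (n : ℕ) (R : Type*) [CommRing R] : Matrix (Fin n) (Fin n) R :=
  Matrix.of fun i j => if (i : ℕ) + j + 1 = n then 1 else 0

/-- The matrix of the standard alternating pairing (for even `n`), with blocks `0`, `I'_{n/2}`,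
`-I'_{n/2}`, `0`. -/
def stdAlt (n : ℕ) (R : Type*) [CommRing R] : Matrix (Fin n) (Fin n) R :=
  Matrix.of fun i j => if (i : ℕ) + j + 1 = n then (if 2 * (i : ℕ) < n then 1 else -1) else 0

/-- The similitudes of the pairing with matrix `J`. -/
def similitudes {n : ℕ} {R : Type*} [CommRing R] (J : Matrix (Fin n) (Fin n) R) :
    Subgroup (GL (Fin n) R) where
  carrier := {g | ∃ c : Rˣ, (g : Matrix (Fin n) (Fin n) R)ᵀ * J * g = (c : R) • J}
  one_mem' := ⟨1, by simp⟩
  mul_mem' := by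
    rintro a b ⟨c, hc⟩ ⟨d, hd⟩
    refine ⟨c * d, ?_⟩
    have : ((a * b : GL (Fin n) R) : Matrix (Fin n) (Fin n) R)ᵀ * J * (a * b : GL (Fin n) R)
        = (b : Matrix (Fin n) (Fin n) R)ᵀ * ((a : Matrix (Fin n) (Fin n) R)ᵀ * J * a) * b := by
      simp [Matrix.transpose_mul, Matrix.mul_assoc]
    rw [this, hc, Matrix.mul_smul, Matrix.smul_mul, hd, smul_smul, Units.val_mul]
  inv_mem' := by
    rintro a ⟨c, hc⟩
    refine ⟨c⁻¹, ?_⟩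
    have h1 : (a : Matrix (Fin n) (Fin n) R) * (a⁻¹ : GL (Fin n) R) = 1 := by
      rw [← Units.val_mul, mul_inv_cancel, Units.val_one]
    have h2 : ((a⁻¹ : GL (Fin n) R) : Matrix (Fin n) (Fin n) R)ᵀ
        * (a : Matrix (Fin n) (Fin n) R)ᵀ = 1 := by
      rw [← Matrix.transpose_mul, h1, Matrix.transpose_one]
    have h3 : (c : R) • (((a⁻¹ : GL (Fin n) R) : Matrix (Fin n) (Fin n) R)ᵀ * J
        * (a⁻¹ : GL (Fin n) R)) = J := by
      rw [← Matrix.smul_mul, ← Matrix.mul_smul, ← hc]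
      simp only [← Matrix.mul_assoc]
      rw [h2, Matrix.one_mul, Matrix.mul_assoc, h1, Matrix.mul_one]
    conv_rhs => rw [← h3]
    rw [smul_smul, Units.inv_mul, one_smul]

/-- The isometries of the pairing with matrix `J`. -/
def isometries {n : ℕ} {R : Type*} [CommRing R] (J : Matrix (Fin n) (Fin n) R) :
    Subgroup (GL (Fin n) R) where
  carrier := {g | (g : Matrix (Fin n) (Fin n) R)ᵀ * J * g = J}
  one_mem' := by simp
  mul_mem' := by
    intro a b ha hb
    have : ((a * b : GL (Fin n) R) : Matrix (Fin n) (Fin n) R)ᵀ * J * (a * b : GL (Fin n) R)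
        = (b : Matrix (Fin n) (Fin n) R)ᵀ * ((a : Matrix (Fin n) (Fin n) R)ᵀ * J * a) * b := by
      simp [Matrix.transpose_mul, Matrix.mul_assoc]
    rw [Set.mem_ofPred_eq, this, ha, hb]
  inv_mem' := by
    intro a ha
    have h1 : (a : Matrix (Fin n) (Fin n) R) * (a⁻¹ : GL (Fin n) R) = 1 := by
      rw [← Units.val_mul, mul_inv_cancel, Units.val_one]
    have h2 : ((a⁻¹ : GL (Fin n) R) : Matrix (Fin n) (Fin n) R)ᵀ
        * (a : Matrix (Fin n) (Fin n) R)ᵀ = 1 := by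
      rw [← Matrix.transpose_mul, h1, Matrix.transpose_one]
    rw [Set.mem_ofPred_eq] at ha ⊢
    conv_lhs => rw [← ha]
    simp only [← Matrix.mul_assoc]
    rw [h2, Matrix.one_mul, Matrix.mul_assoc, h1, Matrix.mul_one]

/-- The `R`-points `G(R)` of `G = GL_n`, `GSp_n` or `GO_n`. -/
def G : (t : Family) → (n : ℕ) → (R : Type*) → [CommRing R] → Subgroup (GL (Fin n) R)
  | .GL, _, _, _ => ⊤
  | .GSp, n, R, _ => similitudes (stdAlt n R)
  | .GO, n, R, _ => similitudes (stdSym n R)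

/-- The `R`-points, as a subgroup of `G(R)`, of `G' = SL_n`, `Sp_n`, `SO_n`, the derived group of
the identity component of `G` (in the orthogonal case this description of the derived group is
the correct one for `n ≥ 3`; for `n ≤ 2` we still take `SO_n`). -/
def G' (t : Family) (n : ℕ) (R : Type*) [CommRing R] : Subgroup (G t n R) :=
  Subgroup.subgroupOf
    (match t with
      | .GL => (Matrix.GeneralLinearGroup.det (n := Fin n) (R := R)).ker
      | .GSp => isometries (stdAlt n R)
      | .GO => isometries (stdSym n R) ⊓ (Matrix.GeneralLinearGroup.det (n := Fin n) (R := R)).ker)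
    (G t n R)

theorem isometries_conj {n : ℕ} {R : Type*} [CommRing R] {J : Matrix (Fin n) (Fin n) R}
    {a g : GL (Fin n) R} (ha : a ∈ isometries J) (hg : g ∈ similitudes J) :
    g * a * g⁻¹ ∈ isometries J := by
  obtain ⟨c, hc⟩ := hg
  obtain ⟨d, hd⟩ := (similitudes J).inv_mem (⟨c, hc⟩ : g ∈ similitudes J)
  have ha' : (a : Matrix (Fin n) (Fin n) R)ᵀ * J * a = J := ha
  have h1 : (g : Matrix (Fin n) (Fin n) R) * (g⁻¹ : GL (Fin n) R) = 1 := by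
    rw [← Units.val_mul, mul_inv_cancel, Units.val_one]
  have h2 : ((g⁻¹ : GL (Fin n) R) : Matrix (Fin n) (Fin n) R)ᵀ
      * (g : Matrix (Fin n) (Fin n) R)ᵀ = 1 := by
    rw [← Matrix.transpose_mul, h1, Matrix.transpose_one]
  have key : ((g⁻¹ : GL (Fin n) R) : Matrix (Fin n) (Fin n) R)ᵀ *
      ((g : Matrix (Fin n) (Fin n) R)ᵀ * J * g) * (g⁻¹ : GL (Fin n) R) = J := by
    simp only [← Matrix.mul_assoc]
    rw [h2, Matrix.one_mul, Matrix.mul_assoc, h1, Matrix.mul_one]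
  change ((g * a * g⁻¹ : GL (Fin n) R) : Matrix (Fin n) (Fin n) R)ᵀ * J *
    (g * a * g⁻¹ : GL (Fin n) R) = J
  have : ((g * a * g⁻¹ : GL (Fin n) R) : Matrix (Fin n) (Fin n) R)ᵀ * J *
      (g * a * g⁻¹ : GL (Fin n) R) = ((g⁻¹ : GL (Fin n) R) : Matrix (Fin n) (Fin n) R)ᵀ *
      ((a : Matrix (Fin n) (Fin n) R)ᵀ * ((g : Matrix (Fin n) (Fin n) R)ᵀ * J * g) * a) *
      (g⁻¹ : GL (Fin n) R) := by
    simp only [Units.val_mul, Matrix.transpose_mul, Matrix.mul_assoc]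
  rw [this, hc, Matrix.mul_smul, Matrix.smul_mul, ha', ← hc, key]

instance (t : Family) (n : ℕ) (R : Type*) [CommRing R] : (G' t n R).Normal where
  conj_mem := by
    rintro ⟨a, ha⟩ h ⟨g, hg⟩
    cases t
    · rw [G', Subgroup.mem_subgroupOf] at h ⊢
      exact (MonoidHom.normal_ker _).conj_mem a h g
    · rw [G', Subgroup.mem_subgroupOf] at h ⊢
      exact isometries_conj h hg
    · rw [G', Subgroup.mem_subgroupOf] at h ⊢
      exact ⟨isometries_conj h.1 hg, (MonoidHom.normal_ker _).conj_mem a h.2 g⟩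

theorem stdSym_map (n : ℕ) {R S : Type*} [CommRing R] [CommRing S] (f : R →+* S) :
    (stdSym n R).map f = stdSym n S := by
  ext i j
  simp only [stdSym, Matrix.map_apply, Matrix.of_apply]
  split_ifs <;> simp

theorem stdAlt_map (n : ℕ) {R S : Type*} [CommRing R] [CommRing S] (f : R →+* S) :
    (stdAlt n R).map f = stdAlt n S := by
  ext i j
  simp only [stdAlt, Matrix.map_apply, Matrix.of_apply]
  split_ifs <;> simp

theorem map_coe {n : ℕ} {R S : Type*} [CommRing R] [CommRing S] (f : R →+* S) (g : GL (Fin n) R) :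
    (Matrix.GeneralLinearGroup.map f g : Matrix (Fin n) (Fin n) S)
      = (g : Matrix (Fin n) (Fin n) R).map f := rfl

theorem similitudes_map {n : ℕ} {R S : Type*} [CommRing R] [CommRing S] (f : R →+* S)
    {J : Matrix (Fin n) (Fin n) R} {g : GL (Fin n) R} (hg : g ∈ similitudes J) :
    Matrix.GeneralLinearGroup.map f g ∈ similitudes (J.map f) := by
  obtain ⟨c, hc⟩ := hg
  refine ⟨Units.map f c, ?_⟩
  rw [map_coe, ← Matrix.transpose_map, ← Matrix.map_mul, ← Matrix.map_mul, hc]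
  ext i j
  simp

theorem isometries_map {n : ℕ} {R S : Type*} [CommRing R] [CommRing S] (f : R →+* S)
    {J : Matrix (Fin n) (Fin n) R} {g : GL (Fin n) R} (hg : g ∈ isometries J) :
    Matrix.GeneralLinearGroup.map f g ∈ isometries (J.map f) := by
  have hg' : (g : Matrix (Fin n) (Fin n) R)ᵀ * J * g = J := hg
  change (Matrix.GeneralLinearGroup.map f g : Matrix (Fin n) (Fin n) S)ᵀ * J.map f *
    (Matrix.GeneralLinearGroup.map f g : Matrix (Fin n) (Fin n) S) = J.map f
  rw [map_coe, ← Matrix.transpose_map, ← Matrix.map_mul, ← Matrix.map_mul, hg']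

theorem det_map_ker {n : ℕ} {R S : Type*} [CommRing R] [CommRing S] (f : R →+* S)
    {g : GL (Fin n) R} (hg : g ∈ (Matrix.GeneralLinearGroup.det (n := Fin n) (R := R)).ker) :
    Matrix.GeneralLinearGroup.map f g ∈
      (Matrix.GeneralLinearGroup.det (n := Fin n) (R := S)).ker := by
  rw [MonoidHom.mem_ker] at hg ⊢
  rw [Matrix.GeneralLinearGroup.map_det, hg, map_one]

theorem G_map_mem (t : Family) (n : ℕ) {R S : Type*} [CommRing R] [CommRing S] (f : R →+* S)
    {g : GL (Fin n) R} (hg : g ∈ G t n R) : Matrix.GeneralLinearGroup.map f g ∈ G t n S := by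
  cases t
  · exact Subgroup.mem_top _
  · have := similitudes_map f hg
    rwa [stdAlt_map] at this
  · have := similitudes_map f hg
    rwa [stdSym_map] at this

/-- The homomorphism `G(R) → G(S)` induced by a ring homomorphism `R → S`. -/
def Gmap (t : Family) (n : ℕ) {R S : Type*} [CommRing R] [CommRing S] (f : R →+* S) :
    G t n R →* G t n S :=
  ((Matrix.GeneralLinearGroup.map f).comp (G t n R).subtype).codRestrict (G t n S)
    fun g => G_map_mem t n f g.2

/-- The `R`-points of `S = G / G'`, for local rings `R` (for which `G(R) → S(R)` is surjective).
The quotient map `μ : G(R) → S(R)` is `QuotientGroup.mk`. -/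
abbrev S (t : Family) (n : ℕ) (R : Type*) [CommRing R] : Type _ := G t n R ⧸ G' t n R

/-- The homomorphism `S(R) → S(R')` induced by a ring homomorphism `R → R'`. -/
def Smap (t : Family) (n : ℕ) {R R' : Type*} [CommRing R] [CommRing R'] (f : R →+* R') :
    S t n R →* S t n R' :=
  QuotientGroup.map _ _ (Gmap t n f) (by
    rintro ⟨g, hg⟩ h
    rw [Subgroup.mem_comap]
    cases t
    · rw [G', Subgroup.mem_subgroupOf] at h ⊢
      exact det_map_ker f h
    · rw [G', Subgroup.mem_subgroupOf] at h ⊢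
      have := isometries_map f h
      rwa [stdAlt_map] at this
    · rw [G', Subgroup.mem_subgroupOf] at h ⊢
      have := isometries_map f h.1
      rw [stdSym_map] at this
      exact ⟨this, det_map_ker f h.2⟩)

/-- The matrix of an element of `G(R)`. -/
abbrev mat {t : Family} {n : ℕ} {R : Type*} [CommRing R] (g : G t n R) :
    Matrix (Fin n) (Fin n) R := ((g : GL (Fin n) R) : Matrix (Fin n) (Fin n) R)

/-- The infinitesimal similitudes of the pairing with matrix `J`. -/
def lieSimilitudes {n : ℕ} {R : Type*} [CommRing R] (J : Matrix (Fin n) (Fin n) R) :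
    Submodule R (Matrix (Fin n) (Fin n) R) where
  carrier := {X | ∃ a : R, Xᵀ * J + J * X = a • J}
  zero_mem' := ⟨0, by simp⟩
  add_mem' := by
    rintro X Y ⟨a, ha⟩ ⟨b, hb⟩
    refine ⟨a + b, ?_⟩
    rw [add_smul, ← ha, ← hb, Matrix.transpose_add, Matrix.add_mul, Matrix.mul_add]
    abel
  smul_mem' := by
    rintro r X ⟨a, ha⟩
    refine ⟨r * a, ?_⟩
    rw [mul_smul, ← ha, smul_add, Matrix.transpose_smul, Matrix.smul_mul, Matrix.mul_smul]

/-- The Lie algebra `𝔤_R` of `G_R`, inside `𝔤𝔩_n`. -/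
def lie : (t : Family) → (n : ℕ) → (R : Type*) → [CommRing R] →
    Submodule R (Matrix (Fin n) (Fin n) R)
  | .GL, _, _, _ => ⊤
  | .GSp, n, R, _ => lieSimilitudes (stdAlt n R)
  | .GO, n, R, _ => lieSimilitudes (stdSym n R)

/-- The dimension of the smooth group `G` over a field `F`, i.e. the dimension of its tangent space
at the identity. -/
def dimG (t : Family) (n : ℕ) (F : Type*) [Field F] : ℕ := Module.finrank F (lie t n F)

/-- `p` is very good for `G`. -/
def VeryGood : Family → ℕ → ℕ → Prop
  | .GL, n, p => ¬ p ∣ n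
  | .GSp, _, p => p ≠ 2
  | .GO, _, p => p ≠ 2

end Groups

/-! ## Exponential, logarithm and nilpotent orbits -/

section Nilpotent

/-- The truncated exponential `1 + A + A²/2 + ⋯ + A^(n-1)/(n-1)!`. -/
def truncExp {n : ℕ} {R : Type*} [CommRing R] (A : Matrix (Fin n) (Fin n) R) :
    Matrix (Fin n) (Fin n) R :=
  ∑ i ∈ Finset.range n, Ring.inverse ((i.factorial : ℕ) : R) • A ^ i

/-- The truncated logarithm `(B-1) - (B-1)²/2 + ⋯ + (-1)^n (B-1)^(n-1)/(n-1)`. -/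
def truncLog {n : ℕ} {R : Type*} [CommRing R] (B : Matrix (Fin n) (Fin n) R) :
    Matrix (Fin n) (Fin n) R :=
  ∑ i ∈ Finset.Ico 1 n, ((-1) ^ (i + 1) * Ring.inverse (i : R)) • (B - 1) ^ i

/-- The nilpotent matrix in Jordan canonical form with blocks of sizes `c₁, c₂, …` (in order). -/
def jordanMatrix {n : ℕ} (c : Composition n) (R : Type*) [CommRing R] :
    Matrix (Fin n) (Fin n) R :=
  Matrix.of fun i j => if c.index i = c.index j ∧ (i : ℕ) + 1 = j then 1 else 0

/-- The matrix `N` over the (algebraically closed) field `F` lies in the `GL_n(F)`-orbit of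
nilpotent matrices whose Jordan blocks have the parts of the partition `σ` as sizes. For `N` in the
Lie algebra of `G` this says that `N` lies in the nilpotent `G`-orbit with label `σ`. -/
def InOrbit {n : ℕ} (σ : n.Partition) {F : Type*} [Field F] (N : Matrix (Fin n) (Fin n) F) : Prop :=
  ∃ c : Composition n, Nat.Partition.ofComposition n c = σ ∧
    ∃ P : GL (Fin n) F, (P : Matrix (Fin n) (Fin n) F) * N * (P⁻¹ : GL (Fin n) F) = jordanMatrix c F

variable {O : Type u} [CommRing O]

/-- The `R`-points of the scheme-theoretic centralizer `Z_G(N)`, for an `O`-algebra `R`. -/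
def centralizer (t : Family) {n : ℕ} (N : Matrix (Fin n) (Fin n) O) (R : Type u) [CommRing R]
    [Algebra O R] : Set (G t n R) :=
  {g | mat g * N.map (algebraMap O R) = N.map (algebraMap O R) * mat g}

/-- `Z_G(N)` is smooth over `O`: the functor `R ↦ Z_G(N)(R)` on `O`-algebras is represented by a
smooth `O`-algebra. -/
def CentralizerSmooth (t : Family) {n : ℕ} (N : Matrix (Fin n) (Fin n) O) : Prop :=
  ∃ (B : Type u) (_ : CommRing B) (_ : Algebra O B), Algebra.Smooth O B ∧
    ∃ e : ∀ (R : Type u) [CommRing R] [Algebra O R], (B →ₐ[O] R) ≃ centralizer t N R,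
      ∀ (R R' : Type u) [CommRing R] [Algebra O R] [CommRing R'] [Algebra O R'] (f : R →ₐ[O] R')
        (x : B →ₐ[O] R), (e R' (f.comp x) : G t n R') = Gmap t n f.toRingHom (e R x)

end Nilpotent

/-! ## Coefficient algebras, lifts and lifting conditions -/

section Deformations

variable (O : Type u) [CommRing O] [IsLocalRing O]

/-- Complete local Noetherian `O`-algebras with the same residue field as `O`. Morphisms are
`O`-algebra homomorphisms: those are automatically local and the identity on residue fields. -/
structure CoeffAlg where
  carrier : Type u
  [commRing : CommRing carrier]
  [algebra : Algebra O carrier]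
  [isLocalRing : IsLocalRing carrier]
  [isNoetherianRing : IsNoetherianRing carrier]
  [isAdicComplete : IsAdicComplete (maximalIdeal carrier) carrier]
  [isLocalHom : IsLocalHom (algebraMap O carrier)]
  residue_bijective : Function.Bijective (ResidueField.map (algebraMap O carrier))

/-- Artinian coefficient `O`-algebras: Artinian local `O`-algebras with the same residue field as
`O` (these are automatically Noetherian and complete). -/
structure ArtAlg where
  carrier : Type u
  [commRing : CommRing carrier]
  [algebra : Algebra O carrier]
  [isLocalRing : IsLocalRing carrier]
  [isArtinianRing : IsArtinianRing carrier]
  [isLocalHom : IsLocalHom (algebraMap O carrier)]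
  residue_bijective : Function.Bijective (ResidueField.map (algebraMap O carrier))

attribute [instance] CoeffAlg.commRing CoeffAlg.algebra CoeffAlg.isLocalRing
  CoeffAlg.isNoetherianRing CoeffAlg.isAdicComplete CoeffAlg.isLocalHom
  ArtAlg.commRing ArtAlg.algebra ArtAlg.isLocalRing ArtAlg.isArtinianRing ArtAlg.isLocalHom

/-- The dual numbers `k[ε]` over the residue field `k` of `O`. -/
def dualNumbers : ArtAlg O where
  carrier := DualNumber (ResidueField O)
  isArtinianRing := by
    have : Module.Finite (ResidueField O) (DualNumber (ResidueField O)) :=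
      inferInstanceAs (Module.Finite (ResidueField O) (ResidueField O × ResidueField O))
    exact IsArtinianRing.of_finite (ResidueField O) _
  isLocalHom := ⟨fun a ha => by
    have h := TrivSqZeroExt.isUnit_iff_isUnit_fst.mp ha
    exact (isUnit_map_iff (residue O) a).mp h⟩
  residue_bijective := by
    refine ⟨RingHom.injective _, fun y => ?_⟩
    obtain ⟨x, rfl⟩ := residue_surjective y
    obtain ⟨a, ha⟩ := residue_surjective (R := O) x.fst
    refine ⟨residue O a, ?_⟩
    rw [ResidueField.map_residue, ← sub_eq_zero, ← map_sub, residue_eq_zero_iff, mem_maximalIdeal,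
      mem_nonunits_iff, TrivSqZeroExt.isUnit_iff_isUnit_fst, TrivSqZeroExt.fst_sub]
    have : TrivSqZeroExt.fst (algebraMap O (DualNumber (ResidueField O)) a) = residue O a := rfl
    rw [this, ha, sub_self]
    simp

variable {O} {t : Family} {n : ℕ} {T : Type} [Group T] [TopologicalSpace T]

/-- `Ĝ(A)`, the kernel of `G(A) → G(k)`. -/
def Ghat (t : Family) (n : ℕ) (A : ArtAlg O) : Subgroup (G t n A.carrier) :=
  (Gmap t n (residue A.carrier)).ker

/-- `ρ : T → G(A)` is a continuous (`G(A)` being discrete) homomorphism lifting `ρ̄ : T → G(k)`. -/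
def IsLift (ρbar : T →* G t n (ResidueField O)) (A : ArtAlg O) (ρ : T →* G t n A.carrier) : Prop :=
  IsLocallyConstant ρ ∧ ∀ x : T, Gmap t n (residue A.carrier) (ρ x) =
    Gmap t n (ResidueField.map (algebraMap O A.carrier)) (ρbar x)

/-- The push-forward of a homomorphism `T → G(A)` along `f : A → B`. -/
def push {A B : ArtAlg O} (f : A.carrier →ₐ[O] B.carrier) (ρ : T →* G t n A.carrier) :
    T →* G t n B.carrier :=
  (Gmap t n f.toRingHom).comp ρ

/-- A lifting condition: a subfunctor of the functor of lifts of `ρ̄` on Artinian coefficient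
algebras which is closed under strict equivalence (so that it defines a subfunctor of the functor of
deformations) and satisfies the gluing condition for Cartesian diagrams. -/
structure IsLiftingCondition (ρbar : T →* G t n (ResidueField O))
    (D : ∀ A : ArtAlg O, Set (T →* G t n A.carrier)) : Prop where
  isLift : ∀ (A : ArtAlg O), ∀ ρ ∈ D A, IsLift ρbar A ρ
  map : ∀ (A B : ArtAlg O) (f : A.carrier →ₐ[O] B.carrier), ∀ ρ ∈ D A, push f ρ ∈ D B
  strictEquiv : ∀ (A : ArtAlg O), ∀ ρ ∈ D A, ∀ g ∈ Ghat t n A,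
    (MulAut.conj g).toMonoidHom.comp ρ ∈ D A
  cartesian : ∀ (A A₁ A₂ A₀ : ArtAlg O) (π₁ : A.carrier →ₐ[O] A₁.carrier)
    (π₂ : A.carrier →ₐ[O] A₂.carrier) (f₁ : A₁.carrier →ₐ[O] A₀.carrier)
    (f₂ : A₂.carrier →ₐ[O] A₀.carrier),
    f₁.comp π₁ = f₂.comp π₂ →
    (∀ a₁ a₂, f₁ a₁ = f₂ a₂ → ∃! a, π₁ a = a₁ ∧ π₂ a = a₂) →
    ∀ ρ : T →* G t n A.carrier, IsLift ρbar A ρ →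
      (ρ ∈ D A ↔ push π₁ ρ ∈ D A₁ ∧ push π₂ ρ ∈ D A₂)

/-- Liftability along small surjections. This is stated for lifts, and so contains surjectivity
of the maps between sets of deformations (strict equivalence classes of lifts). -/
def IsLiftable (D : ∀ A : ArtAlg O, Set (T →* G t n A.carrier)) : Prop :=
  ∀ (A₁ A₀ : ArtAlg O) (f : A₁.carrier →ₐ[O] A₀.carrier), Function.Surjective f →
    RingHom.ker f * maximalIdeal A₁.carrier = ⊥ → ∀ ρ₀ ∈ D A₀, ∃ ρ₁ ∈ D A₁, push f ρ₁ = ρ₀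

/-- The coefficient algebra `R` pro-represents the functor `D`: there are bijections
`Hom(R, A) ≃ D(A)`, natural in the Artinian coefficient algebra `A`. -/
def ProRepresents (R : CoeffAlg O) (D : ∀ A : ArtAlg O, Set (T →* G t n A.carrier)) : Prop :=
  ∃ e : ∀ A : ArtAlg O, (R.carrier →ₐ[O] A.carrier) ≃ D A,
    ∀ (A B : ArtAlg O) (f : A.carrier →ₐ[O] B.carrier) (x : R.carrier →ₐ[O] A.carrier),
      (e B (f.comp x) : T →* G t n B.carrier) = push f (e A x)

end Deformations

/-! ## Cohomology of `ad ρ̄` -/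

section Cohomology

variable {k : Type u} [Field k] {t : Family} {n : ℕ} {T : Type} [Group T] [TopologicalSpace T]

/-- The action of `x ∈ T` on `n × n` matrices by conjugation with `ρ̄(x)`. -/
def adAct (ρbar : T →* G t n k) (x : T) (X : Matrix (Fin n) (Fin n) k) :
    Matrix (Fin n) (Fin n) k :=
  mat (ρbar x) * X * mat (ρbar x)⁻¹

/-- `H⁰(T, ad ρ̄)`. -/
def H0 (ρbar : T →* G t n k) : Submodule k (Matrix (Fin n) (Fin n) k) where
  carrier := {X | X ∈ lie t n k ∧ ∀ x, adAct ρbar x X = X}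
  zero_mem' := ⟨zero_mem _, by simp [adAct]⟩
  add_mem' := by
    rintro X Y ⟨hX, hX'⟩ ⟨hY, hY'⟩
    refine ⟨add_mem hX hY, fun x => ?_⟩
    have h1 := hX' x
    have h2 := hY' x
    rw [adAct] at h1 h2 ⊢
    rw [Matrix.mul_add, Matrix.add_mul, h1, h2]
  smul_mem' := by
    rintro a X ⟨hX, hX'⟩
    refine ⟨Submodule.smul_mem _ _ hX, fun x => ?_⟩
    have h1 := hX' x
    rw [adAct] at h1 ⊢
    rw [Matrix.mul_smul, Matrix.smul_mul, h1]

/-- The continuous 1-cocycles `Z¹(T, ad ρ̄)`. -/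
def Z1 (ρbar : T →* G t n k) : Submodule k (T → Matrix (Fin n) (Fin n) k) where
  carrier := {c | IsLocallyConstant c ∧ (∀ x, c x ∈ lie t n k) ∧
    ∀ x y, c (x * y) = c x + adAct ρbar x (c y)}
  zero_mem' := ⟨IsLocallyConstant.const 0, fun _ => zero_mem _, by simp [adAct]⟩
  add_mem' := by
    rintro c d ⟨hc, hc', hc''⟩ ⟨hd, hd', hd''⟩
    refine ⟨hc.add hd, fun x => add_mem (hc' x) (hd' x), fun x y => ?_⟩
    simp only [Pi.add_apply, hc'', hd'', adAct, Matrix.mul_add, Matrix.add_mul]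
    abel
  smul_mem' := by
    rintro a c ⟨hc, hc', hc''⟩
    refine ⟨hc.comp (a • ·), fun x => Submodule.smul_mem _ _ (hc' x), fun x y => ?_⟩
    simp only [Pi.smul_apply, hc'', adAct, Matrix.mul_smul, Matrix.smul_mul, smul_add]

/-- The 1-coboundaries `B¹(T, ad ρ̄)`. -/
def B1 (ρbar : T →* G t n k) : Submodule k (T → Matrix (Fin n) (Fin n) k) where
  carrier := {c | ∃ X ∈ lie t n k, ∀ x, c x = adAct ρbar x X - X}
  zero_mem' := ⟨0, zero_mem _, by simp [adAct]⟩
  add_mem' := by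
    rintro c d ⟨X, hX, hc⟩ ⟨Y, hY, hd⟩
    refine ⟨X + Y, add_mem hX hY, fun x => ?_⟩
    simp only [Pi.add_apply, hc, hd, adAct, Matrix.mul_add, Matrix.add_mul]
    abel
  smul_mem' := by
    rintro a c ⟨X, hX, hc⟩
    refine ⟨a • X, Submodule.smul_mem _ _ hX, fun x => ?_⟩
    simp only [Pi.smul_apply, hc, adAct, Matrix.mul_smul, Matrix.smul_mul, smul_sub]

/-- `H¹(T, ad ρ̄)`, continuous cohomology. -/
abbrev H1 (ρbar : T →* G t n k) : Type u :=
  Z1 ρbar ⧸ (B1 ρbar).submoduleOf (Z1 ρbar)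

end Cohomology

section Tangent

variable {O : Type u} [CommRing O] [IsLocalRing O] {t : Family} {n : ℕ} {T : Type} [Group T]
  [TopologicalSpace T]

/-- The matrix `exp(ε X) · g = (1 + ε X) g` over `k[ε]`, for matrices `X`, `g` over `k`. -/
def expEps (X g : Matrix (Fin n) (Fin n) (ResidueField O)) :
    Matrix (Fin n) (Fin n) (dualNumbers O).carrier :=
  ((1 + X.map TrivSqZeroExt.inr) * g.map TrivSqZeroExt.inl :
    Matrix (Fin n) (Fin n) (DualNumber (ResidueField O)))

/-- The subspace `W` of `H¹(T, ad ρ̄)` is the tangent space of the deformation functor attached to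
`D`: the class of a cocycle `c` is in `W` if and only if the lift `x ↦ exp(ε c(x)) ρ̄(x)` of `ρ̄` to
`k[ε]` belongs to `D`. -/
def IsTangentSpace (ρbar : T →* G t n (ResidueField O))
    (D : ∀ A : ArtAlg O, Set (T →* G t n A.carrier)) (W : Submodule (ResidueField O) (H1 ρbar)) :
    Prop :=
  ∀ c : Z1 ρbar, Submodule.Quotient.mk c ∈ W ↔
    ∃ ρ ∈ D (dualNumbers O), ∀ x, mat (ρ x) = expEps (c.1 x) (mat (ρbar x))

end Tangent

/-! ## Minimally ramified lifts -/

section MinimallyRamified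

variable {O : Type u} [CommRing O] [IsLocalRing O] {t : Family} {n : ℕ}

/-- The pure nilpotents over `A`: the `Ĝ(A)`-conjugates of the image of `Nσ`. -/
def Nil (t : Family) {n : ℕ} (Nσ : Matrix (Fin n) (Fin n) O) (A : ArtAlg O) :
    Set (Matrix (Fin n) (Fin n) A.carrier) :=
  {N | ∃ g ∈ Ghat t n A, mat g * Nσ.map (algebraMap O A.carrier) * mat g⁻¹ = N}

variable {p : ℕ} [Fact p.Prime] {q : ℕ} {hq : p.Coprime q}

/-- The minimally ramified lifts `ρ` of `ρ̄` to `A` with `μ ∘ ρ = ν`. -/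
def minRamLifts (ρbar : Tame p q hq →* G t n (ResidueField O)) (Nσ : Matrix (Fin n) (Fin n) O)
    (ν : Tame p q hq →* S t n O) (A : ArtAlg O) : Set (Tame p q hq →* G t n A.carrier) :=
  {ρ | IsLift ρbar A ρ ∧ (∃ N ∈ Nil t Nσ A, mat (ρ (tau hq)) = truncExp N) ∧
    ∀ x, (QuotientGroup.mk (ρ x) : S t n A.carrier) = Smap t n (algebraMap O A.carrier) (ν x)}

end MinimallyRamified

end MinRam

end

open MinRam

/-! A continuous homomorphism from `T_q` to the finite group `G(A)` is the same thing as a pair `(u,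
f)` in which `u` has `p`-power order and `f u f⁻¹ = u ^ q`. Write `N` for `Nσ`. Since `p > n`,
truncated `exp` and `log` are inverse to each other between nilpotent and unipotent matrices, so for
`u = exp M` with `M` nilpotent the relation becomes the linear condition `f M = q M f`. Fix `u = exp
N` in `G'(O)` and a lift `Φ` in `G(O)` of `ρ̄(φ)` with `Φ N = q N Φ` and class `ν(φ)` in `S(O)`. A
minimally ramified lift then has `ρ(τ) = x u x⁻¹` and `ρ(φ) = x Φ z x⁻¹`, where `x` matters only
modulo the centralizer of `N`, and `z` is an element of that centralizer which lies in `G'(A)` and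
reduces to the identity. Together the two carry `dim G' = dim G - 1` parameters.

Everything linear rests on constant rank: `N` has the same Jordan type on both fibres, so the
operators `X ↦ X N - q N X` and `X ↦ X N - N X` have the same rank over the fraction field and over
the residue field, and therefore have pseudo-inverses over `O` (`exists_pseudoInverse_twistedAd`).
The first produces `Φ` (`exists_frobenius_lift`); the second gives a projection `E` of `Lie G'` onto
a complement of the centralizer of `N` (`exists_adSplitting`).

The passage from Lie algebra to group uses a chart (the Cayley transform, or `1 + X` normalized to
determinant one) for which `X` commutes with `N` exactly when its image does. One parameter `Y` in
`Lie G'` with entries in the maximal ideal yields both `x = chart (E Y)` and `z = chart (Y - E Y)`.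
Distinct parameters give distinct lifts by induction on powers of the maximal ideal
(`eq_of_chartG_mul_eq`), and all lifts occur because an injective map between finite sets of equal
size is surjective (`exists_chartG_mul_chartG`). Hence the functor is naturally `A ↦ m_A ^ d` with
`d` the rank of `Lie G'` (`TameDatum.hasCoordinates`). Gluing, liftability and pro-representability
by a power series ring in `d` variables are then formal.

For the tangent space, lifts to `k[ε]` correspond to a space of cocycles which has `|k| ^ d`
elements, hence dimension `d`. It contains the coboundaries, of dimension `(d + 1) - h⁰`, so its
image in `H¹` has dimension `h⁰ - 1`. -/

noncomputable section

namespace MinRam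

/-! ## Truncated exponential and logarithm -/

section ExpLog

open Polynomial

variable {R : Type*} [CommRing R] {n : ℕ}

/-- The truncated exponential series as a polynomial. -/
def expPoly (n : ℕ) (R : Type*) [CommRing R] : R[X] :=
  ∑ i ∈ Finset.range n, C (Ring.inverse ((i.factorial : ℕ) : R)) * X ^ i

/-- The truncated series of `log (1 + X)` as a polynomial. -/
def logPoly (n : ℕ) (R : Type*) [CommRing R] : R[X] :=
  ∑ i ∈ Finset.Ico 1 n, C ((-1) ^ (i + 1) * Ring.inverse (i : R)) * X ^ i

theorem truncExp_eq_aeval (A : Matrix (Fin n) (Fin n) R) : truncExp A = aeval A (expPoly n R) := by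
  simp [truncExp, expPoly, Algebra.smul_def]

theorem truncLog_eq_aeval (B : Matrix (Fin n) (Fin n) R) :
    truncLog B = aeval (B - 1) (logPoly n R) := by
  simp only [truncLog, logPoly, map_sum, map_mul, aeval_C, aeval_X_pow, Algebra.smul_def]

theorem coeff_expPoly (i : ℕ) :
    (expPoly n R).coeff i = if i < n then Ring.inverse ((i.factorial : ℕ) : R) else 0 := by
  simp [expPoly, coeff_C_mul, coeff_X_pow]

theorem coeff_logPoly (i : ℕ) :
    (logPoly n R).coeff i =
      if 1 ≤ i ∧ i < n then (-1) ^ (i + 1) * Ring.inverse (i : R) else 0 := by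
  simp only [logPoly, finsetSum_coeff, coeff_C_mul, coeff_X_pow]
  simp

/-- The equation `exp' = exp` for the truncated series; one order of precision is lost because
differentiation lowers the degree. -/
theorem X_pow_dvd_derivative_expPoly (h : ∀ i < n, IsUnit ((i.factorial : ℕ) : R)) :
    (X : R[X]) ^ (n - 1) ∣ derivative (expPoly n R) - expPoly n R := by
  rw [X_pow_dvd_iff]
  intro i hi
  have h1 : i + 1 < n := by omega
  rw [coeff_sub, coeff_derivative, coeff_expPoly, coeff_expPoly, if_pos h1, if_pos (by omega),
    sub_eq_zero]
  have h2 := h _ h1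
  refine h2.mul_left_cancel ?_
  rw [← mul_assoc, Ring.mul_inverse_cancel _ h2, one_mul, Nat.factorial_succ, Nat.cast_mul,
    mul_assoc, Ring.mul_inverse_cancel _ (h i (by omega))]
  simp

/-- The equation `(1 + X) log'(1 + X) = 1`, to the same precision. -/
theorem X_pow_dvd_derivative_logPoly (h : ∀ i < n, 1 ≤ i → IsUnit (i : R)) :
    (X : R[X]) ^ (n - 1) ∣ (1 + X) * derivative (logPoly n R) - 1 := by
  have hd : ∀ i, i + 1 < n → (derivative (logPoly n R)).coeff i = (-1) ^ i := by
    intro i hi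
    rw [coeff_derivative, coeff_logPoly, if_pos ⟨by omega, hi⟩, mul_assoc]
    have := Ring.inverse_mul_cancel _ (h (i + 1) hi (by omega))
    push_cast at this ⊢
    rw [this, pow_add]
    ring
  rw [X_pow_dvd_iff]
  intro i hi
  rw [add_mul, one_mul, coeff_sub, coeff_add, hd i (by omega)]
  cases i with
  | zero => simp
  | succ i =>
    rw [mul_comm X, coeff_mul_X, hd i (by omega), coeff_one, if_neg (by omega)]
    ring

theorem isUnit_natCast_of_factorial (h : ∀ i < n, IsUnit ((i.factorial : ℕ) : R)) :
    ∀ i < n, 1 ≤ i → IsUnit (i : R) := by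
  intro i hi h1
  refine isUnit_of_dvd_unit ?_ (h i hi)
  exact_mod_cast (Nat.cast_dvd_cast (α := R) (Nat.dvd_factorial h1 le_rfl))

/-- Formal integration: coefficient `i + 1` of `f` is coefficient `i` of `f'` divided by `i + 1`,
which is a unit below `n`. -/
theorem eq_mod_of_derivative {f : R[X]} (h : ∀ i < n, 1 ≤ i → IsUnit (i : R))
    (h0 : f.coeff 0 = 0) (hf : (X : R[X]) ^ (n - 1) ∣ derivative f) : (X : R[X]) ^ n ∣ f := by
  rw [X_pow_dvd_iff] at hf ⊢
  intro i hi
  cases i with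
  | zero => exact h0
  | succ i =>
    have := hf i (by omega)
    rw [coeff_derivative] at this
    have hu := h (i + 1) hi (by omega)
    push_cast at hu
    exact (hu.mul_left_eq_zero).mp this

theorem X_dvd_expPoly_sub_one (hn : 0 < n) : (X : R[X]) ∣ expPoly n R - 1 := by
  rw [X_dvd_iff, coeff_sub, coeff_expPoly, if_pos hn]
  simp

theorem X_dvd_logPoly : (X : R[X]) ∣ logPoly n R := by
  rw [X_dvd_iff, coeff_logPoly, if_neg (by omega)]

theorem comp_dvd_comp {f g : R[X]} (h : f ∣ g) (r : R[X]) : f.comp r ∣ g.comp r := by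
  obtain ⟨s, rfl⟩ := h
  exact ⟨s.comp r, mul_comp ..⟩

/-- `log (exp X) ≡ X` modulo `X ^ n`. -/
theorem X_pow_dvd_logPoly_comp (h : ∀ i < n, IsUnit ((i.factorial : ℕ) : R)) (hn : 0 < n) :
    (X : R[X]) ^ n ∣ (logPoly n R).comp (expPoly n R - 1) - X := by
  have h' := isUnit_natCast_of_factorial h
  have hX := X_dvd_expPoly_sub_one (R := R) hn
  refine eq_mod_of_derivative h' ?_ ?_
  · have : (X : R[X]) ∣ (logPoly n R).comp (expPoly n R - 1) - X := by
      refine dvd_sub (hX.trans ?_) dvd_rfl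
      simpa using comp_dvd_comp (X_dvd_logPoly (R := R) (n := n)) (expPoly n R - 1)
    exact X_dvd_iff.mp this
  · have h1 := X_pow_dvd_derivative_expPoly h
    have h2 : (X : R[X]) ^ (n - 1) ∣
        expPoly n R * (derivative (logPoly n R)).comp (expPoly n R - 1) - 1 := by
      have := (pow_dvd_pow_of_dvd hX (n - 1)).trans
        (by simpa using comp_dvd_comp (X_pow_dvd_derivative_logPoly h') (expPoly n R - 1))
      simpa using this
    rw [derivative_sub, derivative_comp, derivative_X, derivative_sub, derivative_one, sub_zero]
    -- By the chain rule the derivative is `exp' · log'(exp) - 1`. Replacing `exp'` by `exp` costs a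
    -- multiple of `X ^ (n - 1)`; what remains is the logarithm's differential equation composed
    -- with `exp - 1`.
    have : derivative (expPoly n R) * (derivative (logPoly n R)).comp (expPoly n R - 1) - 1 =
      (derivative (expPoly n R) - expPoly n R) *
        (derivative (logPoly n R)).comp (expPoly n R - 1) +
      (expPoly n R * (derivative (logPoly n R)).comp (expPoly n R - 1) - 1) := by ring
    rw [this]
    exact dvd_add (h1.mul_right _) h2

/-- `exp (log (1 + X)) ≡ 1 + X` modulo `X ^ n`. -/
theorem X_pow_dvd_expPoly_comp (h : ∀ i < n, IsUnit ((i.factorial : ℕ) : R)) (hn : 0 < n) :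
    (X : R[X]) ^ n ∣ (expPoly n R).comp (logPoly n R) - (1 + X) := by
  have h' := isUnit_natCast_of_factorial h
  set g := (expPoly n R).comp (logPoly n R) with hg
  have h1 : (X : R[X]) ^ (n - 1) ∣ (derivative (expPoly n R)).comp (logPoly n R) - g := by
    have := (pow_dvd_pow_of_dvd (X_dvd_logPoly (R := R) (n := n)) (n - 1)).trans
        (by simpa using comp_dvd_comp (X_pow_dvd_derivative_expPoly h) (logPoly n R))
    simpa using this
  have h2 : (X : R[X]) ^ (n - 1) ∣ (1 + X) * derivative g - g := by
    rw [hg, derivative_comp, ← hg]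
    have : (1 + X) * (derivative (logPoly n R) * (derivative (expPoly n R)).comp (logPoly n R)) - g
      = ((1 + X) * derivative (logPoly n R) - 1) * (derivative (expPoly n R)).comp (logPoly n R) +
        ((derivative (expPoly n R)).comp (logPoly n R) - g) := by ring
    rw [this]
    exact dvd_add ((X_pow_dvd_derivative_logPoly h').mul_right _) h1
  have h0 : g.coeff 0 = 1 := by
    have : (X : R[X]) ∣ g - 1 := by
      refine (X_dvd_logPoly (R := R) (n := n)).trans ?_
      simpa [hg] using comp_dvd_comp (X_dvd_expPoly_sub_one (R := R) hn) (logPoly n R)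
    rw [X_dvd_iff, coeff_sub, coeff_one_zero, sub_eq_zero] at this
    exact this
  -- The equation `(1 + X) g' = g` reads `(i + 1) g_{i+1} = (1 - i) g_i` on coefficients. With `g_0
  -- = 1` this gives `g_1 = 1`, and the factor `1 - i` kills everything from degree two on.
  have hrec : ∀ i, i + 1 < n → g.coeff (i + 1) * (i + 1) = if i = 0 then 1 else 0 := by
    intro i
    induction i with
    | zero =>
      intro hi
      have := X_pow_dvd_iff.mp h2 0 (by omega)
      rw [coeff_sub, mul_coeff_zero, coeff_derivative, h0, sub_eq_zero] at this
      simpa using this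
    | succ i ih =>
      intro hi
      have h3 := X_pow_dvd_iff.mp h2 (i + 1) (by omega)
      rw [add_mul, one_mul, coeff_sub, coeff_add, mul_comm X, coeff_mul_X, coeff_derivative,
        coeff_derivative] at h3
      have h4 := ih (by omega)
      have h5 : g.coeff (i + 1) * i = 0 := by
        by_cases hi0 : i = 0
        · simp [hi0]
        · rw [if_neg hi0] at h4
          have hu := h' (i + 1) (by omega) (by omega)
          push_cast at hu
          rw [hu.mul_left_eq_zero.mp h4, zero_mul]
      rw [if_neg (by omega)]
      push_cast at h3 ⊢
      linear_combination h3 - h5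
  rw [X_pow_dvd_iff]
  intro i hi
  rw [coeff_sub, coeff_add, coeff_one, coeff_X, sub_eq_zero]
  cases i with
  | zero => simp [h0]
  | succ i =>
    have := hrec i hi
    have hu := h' (i + 1) hi (by omega)
    push_cast at hu
    by_cases hi0 : i = 0
    · subst hi0
      simpa using this
    · rw [if_neg hi0] at this
      rw [hu.mul_left_eq_zero.mp this]
      simp [hi0]

/-- Transfers identities between series modulo `X ^ n` to matrices with vanishing `n`-th power. -/
theorem aeval_eq_zero_of_dvd {f : R[X]} {A : Matrix (Fin n) (Fin n) R} (hA : A ^ n = 0)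
    (h : (X : R[X]) ^ n ∣ f) : aeval A f = 0 := by
  obtain ⟨g, rfl⟩ := h
  simp [hA]

theorem truncLog_truncExp (h : ∀ i < n, IsUnit ((i.factorial : ℕ) : R)) (hn : 0 < n)
    {A : Matrix (Fin n) (Fin n) R} (hA : A ^ n = 0) : truncLog (truncExp A) = A := by
  have := aeval_eq_zero_of_dvd hA (X_pow_dvd_logPoly_comp h hn)
  rw [map_sub, aeval_X, aeval_comp, map_sub, map_one, sub_eq_zero] at this
  rw [truncLog_eq_aeval, truncExp_eq_aeval, this]

theorem truncExp_truncLog (h : ∀ i < n, IsUnit ((i.factorial : ℕ) : R)) (hn : 0 < n)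
    {B : Matrix (Fin n) (Fin n) R} (hB : (B - 1) ^ n = 0) : truncExp (truncLog B) = B := by
  have := aeval_eq_zero_of_dvd hB (X_pow_dvd_expPoly_comp h hn)
  rw [map_sub, aeval_comp, map_add, map_one, aeval_X, sub_eq_zero] at this
  rw [truncLog_eq_aeval, truncExp_eq_aeval, this]
  abel

theorem truncExp_injOn (h : ∀ i < n, IsUnit ((i.factorial : ℕ) : R)) (hn : 0 < n)
    {A B : Matrix (Fin n) (Fin n) R} (hA : A ^ n = 0) (hB : B ^ n = 0)
    (hAB : truncExp A = truncExp B) : A = B := by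
  rw [← truncLog_truncExp h hn hA, hAB, truncLog_truncExp h hn hB]

theorem truncExp_zero (hn : 0 < n) : truncExp (0 : Matrix (Fin n) (Fin n) R) = 1 := by
  rw [truncExp_eq_aeval, ← coeff_zero_eq_aeval_zero', coeff_expPoly, if_pos hn]
  simp

/-- `exp (a A) exp (b A) = exp ((a + b) A)`. -/
theorem truncExp_smul_mul (h : ∀ i < n, IsUnit ((i.factorial : ℕ) : R))
    {A : Matrix (Fin n) (Fin n) R} (hA : A ^ n = 0) (a b : R) :
    truncExp (a • A) * truncExp (b • A) = truncExp ((a + b) • A) := by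
  -- Coefficient by coefficient, after multiplication by the unit `m!`, this is the binomial
  -- theorem.
  have key : (X : R[X]) ^ n ∣ (expPoly n R).comp (C a * X) * (expPoly n R).comp (C b * X) -
      (expPoly n R).comp (C (a + b) * X) := by
    rw [X_pow_dvd_iff]
    intro m hm
    rw [coeff_sub, sub_eq_zero, coeff_mul, comp_C_mul_X_coeff, coeff_expPoly, if_pos hm]
    refine (h m hm).mul_left_cancel ?_
    rw [← mul_assoc, Ring.mul_inverse_cancel _ (h m hm), one_mul, add_pow, Finset.mul_sum,
      Finset.Nat.sum_antidiagonal_eq_sum_range_succ_mk]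
    refine Finset.sum_congr rfl fun i hi => ?_
    have hi' : i ≤ m := by simpa [Nat.lt_succ_iff] using hi
    dsimp only
    rw [comp_C_mul_X_coeff, comp_C_mul_X_coeff, coeff_expPoly, coeff_expPoly, if_pos (by omega),
      if_pos (by omega), ← Nat.choose_mul_factorial_mul_factorial hi']
    push_cast
    have e1 := Ring.mul_inverse_cancel _ (h i (by omega))
    have e2 := Ring.mul_inverse_cancel _ (h (m - i) (by omega))
    linear_combination (m.choose i : R) * a ^ i * b ^ (m - i) *
      ((((m - i).factorial : ℕ) : R) * Ring.inverse (((m - i).factorial : ℕ) : R)) * e1 +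
      (m.choose i : R) * a ^ i * b ^ (m - i) * e2
  have := aeval_eq_zero_of_dvd hA key
  rw [map_sub, map_mul, aeval_comp, aeval_comp, aeval_comp, sub_eq_zero] at this
  simpa [truncExp_eq_aeval, Algebra.smul_def] using this

theorem truncExp_pow (h : ∀ i < n, IsUnit ((i.factorial : ℕ) : R)) (hn : 0 < n)
    {A : Matrix (Fin n) (Fin n) R} (hA : A ^ n = 0) (m : ℕ) :
    truncExp A ^ m = truncExp ((m : R) • A) := by
  induction m with
  | zero => simp [truncExp_zero hn]
  | succ m ih =>
    have := truncExp_smul_mul h hA m 1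
    rw [one_smul] at this
    rw [pow_succ, ih, this]
    push_cast
    rfl

theorem truncExp_mul_neg (h : ∀ i < n, IsUnit ((i.factorial : ℕ) : R)) (hn : 0 < n)
    {A : Matrix (Fin n) (Fin n) R} (hA : A ^ n = 0) : truncExp A * truncExp (-A) = 1 := by
  have := truncExp_smul_mul h hA 1 (-1)
  rwa [one_smul, neg_one_smul, add_neg_cancel, zero_smul, truncExp_zero hn] at this

theorem conj_pow' {P Q A : Matrix (Fin n) (Fin n) R} (hQP : Q * P = 1) (i : ℕ) :
    (P * A * Q) ^ i = P * A ^ i * Q := by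
  have hPQ : P * Q = 1 := mul_eq_one_comm.mp hQP
  induction i with
  | zero => simp [hPQ]
  | succ i ih =>
    rw [pow_succ, ih, pow_succ]
    calc P * A ^ i * Q * (P * A * Q) = P * A ^ i * (Q * P) * A * Q := by
          simp only [Matrix.mul_assoc]
      _ = _ := by rw [hQP, Matrix.mul_one]; simp only [Matrix.mul_assoc]

theorem truncExp_conj {P Q A : Matrix (Fin n) (Fin n) R} (hQP : Q * P = 1) :
    truncExp (P * A * Q) = P * truncExp A * Q := by
  simp only [truncExp, Matrix.mul_sum, Matrix.sum_mul, conj_pow' hQP, Matrix.mul_smul,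
    Matrix.smul_mul]

theorem map_ringInverse_of_isUnit {S : Type*} [CommRing S] (f : R →+* S) {a : R} (ha : IsUnit a) :
    f (Ring.inverse a) = Ring.inverse (f a) := by
  obtain ⟨u, rfl⟩ := ha
  rw [Ring.inverse_unit]
  have : f (u : R) = (Units.map (f : R →* S) u : Sˣ) := rfl
  rw [this, Ring.inverse_unit]
  rfl

/-- The factorials must already be units in the source: `Ring.inverse` is zero on non-units, which
may become units under `f`. -/
theorem truncExp_map {S : Type*} [CommRing S] (f : R →+* S)
    (h : ∀ i < n, IsUnit ((i.factorial : ℕ) : R)) (A : Matrix (Fin n) (Fin n) R) :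
    (truncExp A).map f = truncExp (A.map f) := by
  rw [truncExp, truncExp, ← RingHom.mapMatrix_apply, map_sum]
  refine Finset.sum_congr rfl fun i hi => ?_
  rw [← RingHom.mapMatrix_apply, ← map_pow]
  ext a b
  simp only [RingHom.mapMatrix_apply, Matrix.map_apply, Matrix.smul_apply, smul_eq_mul, map_mul]
  rw [map_ringInverse_of_isUnit f (h i (Finset.mem_range.mp hi)), map_natCast]

theorem truncExp_transpose (A : Matrix (Fin n) (Fin n) R) :
    (truncExp A)ᵀ = truncExp Aᵀ := by
  simp [truncExp, Matrix.transpose_sum, Matrix.transpose_pow]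

end ExpLog

/-! ## The centralizer of a nilpotent matrix in Jordan form -/

section Jordan

variable {F : Type*} [Field F] {n : ℕ}

theorem jordanMatrix_embedding (c : Composition n) (a b : Fin c.length) (i : Fin (c.blocksFun a))
    (j : Fin (c.blocksFun b)) :
    jordanMatrix c F (c.embedding a i) (c.embedding b j) =
      if a = b ∧ (i : ℕ) + 1 = j then 1 else 0 := by
  rw [jordanMatrix, Matrix.of_apply, c.index_embedding, c.index_embedding, c.coe_embedding,
    c.coe_embedding]
  refine if_congr (and_congr_right fun h => ?_) rfl rfl
  subst h
  omega

theorem mul_jordanMatrix_apply (c : Composition n) (X : Matrix (Fin n) (Fin n) F) (s : Fin n)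
    (b : Fin c.length) (j : Fin (c.blocksFun b)) :
    (X * jordanMatrix c F) s (c.embedding b j) =
      if h : 1 ≤ (j : ℕ) then X s (c.embedding b ⟨j - 1, by omega⟩) else 0 := by
  rw [Matrix.mul_apply, ← c.blocksFinEquiv.sum_comp, Fintype.sum_sigma]
  have : ∀ (a : Fin c.length) (i : Fin (c.blocksFun a)),
      X s (c.blocksFinEquiv ⟨a, i⟩) * jordanMatrix c F (c.blocksFinEquiv ⟨a, i⟩) (c.embedding b j)
      = if a = b ∧ (i : ℕ) + 1 = j then X s (c.embedding a i) else 0 := by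
    intro a i
    change X s (c.embedding a i) * jordanMatrix c F (c.embedding a i) (c.embedding b j) = _
    rw [jordanMatrix_embedding, mul_ite, mul_one, mul_zero]
  simp_rw [this]
  rw [Finset.sum_eq_single b]
  · split_ifs with h
    · rw [Finset.sum_eq_single ⟨j - 1, by omega⟩]
      · rw [if_pos ⟨rfl, by simp; omega⟩]
      · intro i _ hi
        rw [if_neg]
        rintro ⟨-, h'⟩
        exact hi (Fin.ext (by simp; omega))
      · simp
    · refine Finset.sum_eq_zero fun i _ => if_neg ?_
      rintro ⟨-, h'⟩
      omega
  · intro a _ ha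
    exact Finset.sum_eq_zero fun i _ => if_neg fun h => ha h.1
  · simp

theorem jordanMatrix_mul_apply (c : Composition n) (X : Matrix (Fin n) (Fin n) F) (s : Fin n)
    (a : Fin c.length) (i : Fin (c.blocksFun a)) :
    (jordanMatrix c F * X) (c.embedding a i) s =
      if h : (i : ℕ) + 1 < c.blocksFun a then X (c.embedding a ⟨i + 1, h⟩) s else 0 := by
  rw [Matrix.mul_apply, ← c.blocksFinEquiv.sum_comp, Fintype.sum_sigma]
  have : ∀ (b : Fin c.length) (j : Fin (c.blocksFun b)),
      jordanMatrix c F (c.embedding a i) (c.blocksFinEquiv ⟨b, j⟩) * X (c.blocksFinEquiv ⟨b, j⟩) s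
      = if a = b ∧ (i : ℕ) + 1 = j then X (c.embedding b j) s else 0 := by
    intro b j
    change jordanMatrix c F (c.embedding a i) (c.embedding b j) * X (c.embedding b j) s = _
    rw [jordanMatrix_embedding, ite_mul, one_mul, zero_mul]
  simp_rw [this]
  rw [Finset.sum_eq_single a]
  · split_ifs with h
    · rw [Finset.sum_eq_single ⟨i + 1, h⟩]
      · rw [if_pos ⟨rfl, rfl⟩]
      · intro j _ hj
        rw [if_neg]
        rintro ⟨-, h'⟩
        exact hj (Fin.ext h'.symm)
      · simp
    · refine Finset.sum_eq_zero fun j _ => if_neg ?_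
      rintro ⟨-, h'⟩
      omega
  · intro b _ hb
    exact Finset.sum_eq_zero fun i _ => if_neg fun h => hb h.1.symm
  · simp

/-- The free parameters of a matrix commuting with a nilpotent matrix in Jordan form. -/
abbrev CentralizerIndex (c : Composition n) : Type :=
  Σ ab : Fin c.length × Fin c.length,
    Finset.Ico (c.blocksFun ab.2 - c.blocksFun ab.1) (c.blocksFun ab.2)

/-- A pair of blocks contributes the minimum of its two sizes. The total depends on the partition
alone and not on the order of the blocks, which is what allows the two fibres to be compared. -/
theorem card_centralizerIndex (c : Composition n) : Fintype.card (CentralizerIndex c) =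
    ((c.blocks : Multiset ℕ).map fun x => ((c.blocks : Multiset ℕ).map fun y => min x y).sum).sum := by
  have h : ∀ f : ℕ → ℕ, ((c.blocks : Multiset ℕ).map f).sum = ∑ a, f (c.blocksFun a) := by
    intro f
    rw [← c.ofFn_blocksFun, Multiset.map_coe, Multiset.sum_coe, List.map_ofFn, List.sum_ofFn]
    rfl
  rw [h, Fintype.card_sigma, Fintype.sum_prod_type]
  refine Finset.sum_congr rfl fun a _ => ?_
  rw [h]
  refine Finset.sum_congr rfl fun b _ => ?_
  simp
  omega

/-- The matrix commuting with the Jordan matrix that has the given parameters. -/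
def centralizerMatrix (c : Composition n) (g : CentralizerIndex c → F) :
    Matrix (Fin n) (Fin n) F :=
  Matrix.of fun u v =>
    let x := c.blocksFinEquiv.symm u
    let y := c.blocksFinEquiv.symm v
    if (x.2 : ℕ) ≤ y.2 then
      if h : (y.2 : ℕ) - x.2 ∈ Finset.Ico (c.blocksFun y.1 - c.blocksFun x.1) (c.blocksFun y.1) then
        g ⟨(x.1, y.1), ⟨(y.2 : ℕ) - x.2, h⟩⟩ else 0
    else 0

theorem centralizerMatrix_embedding (c : Composition n) (g : CentralizerIndex c → F)
    (a b : Fin c.length) (i : Fin (c.blocksFun a)) (j : Fin (c.blocksFun b)) :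
    centralizerMatrix c g (c.embedding a i) (c.embedding b j) =
    if (i : ℕ) ≤ j then
      if h : (j : ℕ) - i ∈ Finset.Ico (c.blocksFun b - c.blocksFun a) (c.blocksFun b) then
        g ⟨(a, b), ⟨(j : ℕ) - i, h⟩⟩ else 0
    else 0 := by
  have h1 : c.blocksFinEquiv.symm (c.embedding a i) = ⟨a, i⟩ :=
    c.blocksFinEquiv.symm_apply_apply ⟨a, i⟩
  have h2 : c.blocksFinEquiv.symm (c.embedding b j) = ⟨b, j⟩ :=
    c.blocksFinEquiv.symm_apply_apply ⟨b, j⟩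
  rw [centralizerMatrix, Matrix.of_apply, h1, h2]

theorem ext_embedding {α : Type*} {n : ℕ} (c : Composition n) {X Y : Matrix (Fin n) (Fin n) α}
    (h : ∀ a b i j, X (c.embedding a i) (c.embedding b j) = Y (c.embedding a i) (c.embedding b j)) :
    X = Y := by
  ext u v
  rw [← c.embedding_comp_inv u, ← c.embedding_comp_inv v]
  exact h _ _ _ _

theorem centralizerMatrix_comm (c : Composition n) (g : CentralizerIndex c → F) :
    centralizerMatrix c g * jordanMatrix c F = jordanMatrix c F * centralizerMatrix c g := by
  refine ext_embedding c fun a b i j => ?_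
  rw [mul_jordanMatrix_apply, jordanMatrix_mul_apply]
  have hi := i.2
  have hj := j.2
  split_ifs with h1 h2 h2
  · rw [centralizerMatrix_embedding, centralizerMatrix_embedding]
    have e : (j : ℕ) - 1 - i = j - (i + 1) := by omega
    simp only [e]
    exact if_congr (by omega) rfl rfl
  · rw [centralizerMatrix_embedding]
    split_ifs with h3 h4
    · rw [Finset.mem_Ico] at h4
      dsimp only at h3 h4
      omega
    · rfl
    · rfl
  · rw [centralizerMatrix_embedding, if_neg (by dsimp only; omega)]
  · rfl

/-- Comparing entries of `X J = J X` moves an entry one step up its diagonal. Each block is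
therefore constant along diagonals and zero below the diagonal that starts in its upper left corner.
-/
theorem eq_of_comm_jordanMatrix (c : Composition n) {X : Matrix (Fin n) (Fin n) F}
    (hX : X * jordanMatrix c F = jordanMatrix c F * X) (a b : Fin c.length) (i : ℕ)
    (hi : i < c.blocksFun a) (j : Fin (c.blocksFun b)) :
    X (c.embedding a ⟨i, hi⟩) (c.embedding b j) =
      if i ≤ j then X (c.embedding a ⟨0, by omega⟩) (c.embedding b ⟨j - i, by omega⟩) else 0 := by
  induction i generalizing j with
  | zero => simp
  | succ i ih =>
    have h := congrFun (congrFun hX (c.embedding a ⟨i, by omega⟩)) (c.embedding b j)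
    rw [mul_jordanMatrix_apply, jordanMatrix_mul_apply, dif_pos hi] at h
    rw [← h]
    split_ifs with h1 h2 h2
    · rw [ih, if_pos (by dsimp only; omega)]
      have e : (j : ℕ) - 1 - i = j - (i + 1) := by omega
      simp only [e]
    · rw [ih, if_neg (by dsimp only; omega)]
    · omega
    · rfl

/-- Follow the entry down its diagonal to the last row of block `a`; one further comparison meets
the zero row of `J` while the column still lies in block `b`. Only the last `min` of the two block
sizes entries of the first row stay free. -/
theorem eq_zero_of_comm_jordanMatrix (c : Composition n) {X : Matrix (Fin n) (Fin n) F}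
    (hX : X * jordanMatrix c F = jordanMatrix c F * X) (a b : Fin c.length)
    (h0 : 0 < c.blocksFun a) (j : ℕ) (hj : j < c.blocksFun b)
    (hj' : j + c.blocksFun a < c.blocksFun b) :
    X (c.embedding a ⟨0, h0⟩) (c.embedding b ⟨j, hj⟩) = 0 := by
  have h1 := eq_of_comm_jordanMatrix c hX a b (c.blocksFun a - 1) (by omega)
    ⟨j + (c.blocksFun a - 1), by omega⟩
  rw [if_pos (by dsimp only; omega)] at h1
  simp only [Nat.add_sub_cancel] at h1
  rw [← h1]
  have h := congrFun (congrFun hX (c.embedding a ⟨c.blocksFun a - 1, by omega⟩))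
    (c.embedding b ⟨j + c.blocksFun a, hj'⟩)
  rw [mul_jordanMatrix_apply, jordanMatrix_mul_apply, dif_pos (by dsimp only; omega),
    dif_neg (by dsimp only; omega)] at h
  rw [← h]
  congr 2
  ext
  simp
  omega

/-- The operator `X ↦ X N - q N X`. -/
def twistedAd {R : Type*} [CommRing R] (q : R) (N : Matrix (Fin n) (Fin n) R) :
    Matrix (Fin n) (Fin n) R →ₗ[R] Matrix (Fin n) (Fin n) R :=
  LinearMap.mulRight R N - q • LinearMap.mulLeft R N

@[simp]
theorem twistedAd_apply {R : Type*} [CommRing R] (q : R) (N X : Matrix (Fin n) (Fin n) R) :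
    twistedAd q N X = X * N - q • (N * X) := rfl

theorem mem_ker_twistedAd_one {R : Type*} [CommRing R] {N X : Matrix (Fin n) (Fin n) R} :
    X ∈ LinearMap.ker (twistedAd 1 N) ↔ X * N = N * X := by
  rw [LinearMap.mem_ker, twistedAd_apply, one_smul, sub_eq_zero]

/-- Matrices commuting with a nilpotent matrix in Jordan form, by their free parameters. -/
def centralizerEquiv (c : Composition n) :
    LinearMap.ker (twistedAd 1 (jordanMatrix c F)) ≃ₗ[F] (CentralizerIndex c → F) where
  toFun X := fun s => X.1 (c.embedding s.1.1 ⟨0, c.one_le_blocksFun _⟩)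
    (c.embedding s.1.2 ⟨s.2, (Finset.mem_Ico.mp s.2.2).2⟩)
  map_add' _ _ := rfl
  map_smul' _ _ := rfl
  invFun g := ⟨centralizerMatrix c g, mem_ker_twistedAd_one.mpr (centralizerMatrix_comm c g)⟩
  left_inv X := by
    have hX := mem_ker_twistedAd_one.mp X.2
    refine Subtype.ext (ext_embedding c fun a b i j => ?_)
    have hi := i.2
    have hj := j.2
    dsimp only
    rw [centralizerMatrix_embedding]
    have h := eq_of_comm_jordanMatrix c hX a b i i.2 j
    rw [h]
    split_ifs with h1 h2
    · rfl
    · rw [Finset.mem_Ico] at h2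
      rw [eq_zero_of_comm_jordanMatrix c hX]
      omega
    · rfl
  right_inv g := by
    funext ⟨⟨a, b⟩, ⟨j, hj⟩⟩
    dsimp only
    rw [centralizerMatrix_embedding, if_pos (Nat.zero_le _)]
    simp only [Nat.sub_zero]
    rw [dif_pos hj]

/-- The diagonal matrix `D` of powers of `q` satisfies `J D = q D J`. Hence `X ↦ D P X P⁻¹` carries
the operator `X ↦ X N - q N X` to `X ↦ X J - J X`, and the dimension depends neither on `q` nor on
the field. -/
theorem finrank_ker_twistedAd {σ : n.Partition} {N : Matrix (Fin n) (Fin n) F} (hN : InOrbit σ N)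
    {q : F} (hq : q ≠ 0) : Module.finrank F (LinearMap.ker (twistedAd q N)) =
      (σ.parts.map fun x => (σ.parts.map fun y => min x y).sum).sum := by
  obtain ⟨c, rfl, P, hP⟩ := hN
  set J := jordanMatrix c F with hJ
  set D : Matrix (Fin n) (Fin n) F := diagonal fun i : Fin n => q ^ (i : ℕ) with hD
  set D' : Matrix (Fin n) (Fin n) F := diagonal fun i : Fin n => (q⁻¹) ^ (i : ℕ) with hD'
  have hDD' : D * D' = 1 := by
    rw [hD, hD', diagonal_mul_diagonal, ← diagonal_one]
    congr 1
    funext i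
    rw [← mul_pow, mul_inv_cancel₀ hq, one_pow]
  have hD'D : D' * D = 1 := mul_eq_one_comm.mp hDD'
  have hDJ : J * D = q • (D * J) := by
    ext i j
    simp only [hD, hJ, Matrix.smul_apply, Matrix.mul_diagonal, Matrix.diagonal_mul, smul_eq_mul,
      jordanMatrix, Matrix.of_apply]
    split_ifs with h
    · rw [← h.2]
      ring
    · simp
  set Q : Matrix (Fin n) (Fin n) F := ((P⁻¹ : GL (Fin n) F) : Matrix (Fin n) (Fin n) F) with hQ
  have hPQ : (P : Matrix (Fin n) (Fin n) F) * Q = 1 := by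
    rw [hQ, ← Units.val_mul, mul_inv_cancel, Units.val_one]
  have hQP : Q * (P : Matrix (Fin n) (Fin n) F) = 1 := mul_eq_one_comm.mp hPQ
  have hN : N = Q * J * P := by
    rw [← hP]
    simp only [← Matrix.mul_assoc]
    rw [hQP, Matrix.one_mul, Matrix.mul_assoc, hQP, Matrix.mul_one]
  let e : Matrix (Fin n) (Fin n) F ≃ₗ[F] Matrix (Fin n) (Fin n) F :=
    { toFun X := D * P * X * Q
      invFun Y := Q * D' * Y * P
      map_add' X Y := by simp [Matrix.mul_add, Matrix.add_mul]
      map_smul' a X := by simp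
      left_inv X := by
        calc Q * D' * (D * P * X * Q) * P = Q * (D' * D) * P * X * (Q * P) := by
              simp only [Matrix.mul_assoc]
          _ = X := by rw [hD'D, hQP, Matrix.mul_one, Matrix.mul_one, hQP, Matrix.one_mul]
      right_inv X := by
        calc D * P * (Q * D' * X * P) * Q = D * (P * Q) * D' * X * (P * Q) := by
              simp only [Matrix.mul_assoc]
          _ = X := by rw [hPQ, Matrix.mul_one, Matrix.mul_one, hDD', Matrix.one_mul] }
  have key : ∀ X, e (twistedAd q N X) = twistedAd 1 J (e X) := by
    intro X
    rw [twistedAd_apply 1, one_smul]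
    change D * P * (X * N - q • (N * X)) * Q = D * P * X * Q * J - J * (D * P * X * Q)
    have h1 : D * P * (X * N) * Q = D * P * X * Q * J := by
      calc D * P * (X * N) * Q = D * P * X * Q * J * (P * Q) := by
            rw [hN]; simp only [Matrix.mul_assoc]
        _ = _ := by rw [hPQ, Matrix.mul_one]
    have h2 : q • (D * P * (N * X) * Q) = J * (D * P * X * Q) := by
      calc q • (D * P * (N * X) * Q) = (q • (D * ((P : Matrix (Fin n) (Fin n) F) * Q) * J)) *
            P * X * Q := by
            rw [hN]; simp only [Matrix.mul_assoc, Matrix.smul_mul]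
        _ = _ := by rw [hPQ, Matrix.mul_one, ← hDJ]; simp only [Matrix.mul_assoc]
    rw [Matrix.mul_sub, Matrix.sub_mul, h1, Matrix.mul_smul, Matrix.smul_mul, h2]
  have hker : LinearMap.ker (twistedAd q N) =
      (LinearMap.ker (twistedAd 1 J)).comap (e : _ →ₗ[F] _) := by
    ext X
    rw [LinearMap.mem_ker, Submodule.mem_comap, LinearMap.mem_ker, ← e.map_eq_zero_iff, key]
    rfl
  rw [hker, (e.ofSubmodule' _).finrank_eq, (centralizerEquiv c).finrank_eq, Module.finrank_pi,
    card_centralizerIndex]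
  rfl

end Jordan

/-! ## Pseudo-inverses over a local domain -/

section PseudoInverse

variable {m : Type*} [Fintype m] [DecidableEq m]

theorem rank_fromBlocks_one {k : Type*} [Field k] (r s : ℕ) :
    (fromBlocks 1 0 0 0 : Matrix (Fin r ⊕ Fin s) (Fin r ⊕ Fin s) k).rank = r := by
  classical
  rw [← diagonal_one, ← diagonal_zero, fromBlocks_diagonal, rank_diagonal]
  have : ∀ i : Fin r ⊕ Fin s,
      (Sum.elim (fun _ => (1 : k)) (fun _ => 0) i ≠ 0) ↔ i ∈ Set.range Sum.inl := by
    rintro (i | i) <;> simp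
  rw [Fintype.card_congr (Equiv.subtypeEquivRight this),
    ← Fintype.card_congr (Equiv.ofInjective _ Sum.inl_injective), Fintype.card_fin]

/-- A rank normal form over `k` is mapped to one over `L`, since invertible factors stay invertible.
-/
theorem rank_map_field {k L : Type*} [Field k] [Field L] (f : k →+* L) (A : Matrix m m k) :
    (A.map f).rank = A.rank := by
  obtain ⟨V, U, e, hV, hU, h⟩ := A.exists_rank_normal_form
  have h' := congrArg f.mapMatrix h
  rw [map_mul, map_mul] at h'
  have hV' : IsUnit (f.mapMatrix V) := hV.map _
  have hU' : IsUnit (f.mapMatrix U) := hU.map _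
  have h1 : (f.mapMatrix ((fromBlocks 1 0 0 0).submatrix e e)) =
      (fromBlocks 1 0 0 0 : Matrix _ _ L).submatrix e e := by
    rw [RingHom.mapMatrix_apply, ← submatrix_map, fromBlocks_map]
    simp
  have h2 := congrArg Matrix.rank h'
  rw [h1, rank_submatrix, rank_fromBlocks_one,
    rank_mul_eq_left_of_isUnit_det _ _ ((isUnit_iff_isUnit_det _).mp hU'),
    rank_mul_eq_right_of_isUnit_det _ _ ((isUnit_iff_isUnit_det _).mp hV')] at h2
  exact h2

theorem isUnit_matrix_of_residue {ι : Type*} [Fintype ι] [DecidableEq ι] {O : Type*} [CommRing O]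
    [IsLocalRing O] {A : Matrix ι ι O} (h : IsUnit (A.map (residue O))) : IsUnit A := by
  rw [isUnit_iff_isUnit_det] at h ⊢
  rw [← RingHom.mapMatrix_apply, ← RingHom.map_det] at h
  exact (isUnit_map_iff (residue O) _).mp h

theorem exists_map_residue_eq {ι κ O : Type*} [CommRing O] [IsLocalRing O]
    (A : Matrix ι κ (ResidueField O)) : ∃ B : Matrix ι κ O, B.map (residue O) = A := by
  choose f hf using residue_surjective (R := O)
  exact ⟨A.map f, by ext; simp [hf]⟩

/-- A matrix over a local domain whose rank does not drop modulo the maximal ideal has a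
pseudo-inverse. -/
theorem exists_pseudoInverse {O F : Type*} [CommRing O] [IsLocalRing O] [Field F] (φ : O →+* F)
    (hφ : Function.Injective φ) (A : Matrix m m O)
    (h : (A.map φ).rank ≤ (A.map (residue O)).rank) : ∃ T : Matrix m m O, A * T * A = A := by
  obtain ⟨r, s, e, hr, V, U, hV, hU, hVU⟩ : ∃ (r s : ℕ) (e : m ≃ Fin r ⊕ Fin s),
      (A.map φ).rank ≤ r ∧ ∃ V U : Matrix m m (ResidueField O), IsUnit V ∧ IsUnit U ∧
        V * A.map (residue O) * U = (fromBlocks 1 0 0 0).submatrix e e := by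
    obtain ⟨V, U, e, h'⟩ := (A.map (residue O)).exists_rank_normal_form
    exact ⟨_, _, e, h, V, U, h'⟩
  obtain ⟨V, rfl⟩ := exists_map_residue_eq V
  obtain ⟨U, rfl⟩ := exists_map_residue_eq U
  -- `V` and `U` bring the reduction of `A` to normal form. The rows of `V` and columns of `U`
  -- belonging to the identity block make `P A Q` reduce to the identity, so it is invertible over
  -- `O`.
  let P : Matrix (Fin r) m O := V.submatrix (fun i => e.symm (Sum.inl i)) id
  let Q : Matrix m (Fin r) O := U.submatrix id (fun i => e.symm (Sum.inl i))
  have hPQ : IsUnit (P * A * Q) := by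
    refine isUnit_matrix_of_residue ?_
    have : (P * A * Q).map (residue O) = 1 := by
      have h1 : (P * A * Q) = (V * A * U).submatrix (fun i => e.symm (Sum.inl i))
          (fun i => e.symm (Sum.inl i)) := by
        ext i j
        simp [P, Q, Matrix.mul_apply]
      rw [h1, ← submatrix_map, Matrix.map_mul, Matrix.map_mul, hVU]
      ext i j
      simp [Matrix.one_apply]
    rw [this]
    exact isUnit_one
  obtain ⟨C, hC⟩ := hPQ
  let C' : Matrix (Fin r) (Fin r) O := ((C⁻¹ : (Matrix (Fin r) (Fin r) O)ˣ) : Matrix _ _ O)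
  have hC'C : C' * (P * A * Q) = 1 := by rw [← hC, ← Units.val_mul, inv_mul_cancel, Units.val_one]
  -- This inverts `A` on the image of `A Q`. The identity is checked over `F`, where that image
  -- turns out to be the whole image of `A`.
  refine ⟨Q * C' * P, ?_⟩
  have hinj : Function.Injective (fun M : Matrix m m O => M.map φ) :=
    fun M M' hMM' => by
      ext i j
      exact hφ (congrFun (congrFun hMM' i) j)
  refine hinj ?_
  have hφ' : C'.map φ * (P.map φ * A.map φ * Q.map φ) = 1 := by
    have := congrArg (fun M => M.map φ) hC'C
    simpa [Matrix.map_mul] using this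
  have hi : Function.Injective (A.map φ * Q.map φ).mulVecLin := by
    refine Function.LeftInverse.injective (g := (C'.map φ * P.map φ).mulVecLin) fun v => ?_
    simp only [mulVecLin_apply, mulVec_mulVec]
    rw [Matrix.mul_assoc, ← Matrix.mul_assoc (P.map φ), hφ', one_mulVec]
  -- `A Q` is injective over `F`, so its image has dimension `r`, which bounds the rank of `A` over
  -- `F`. This is where the rank hypothesis enters.
  have hrange : LinearMap.range (A.map φ * Q.map φ).mulVecLin =
      LinearMap.range (A.map φ).mulVecLin := by
    refine Submodule.eq_of_le_of_finrank_le ?_ ?_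
    · rw [mulVecLin_mul]
      exact LinearMap.range_comp_le_range _ _
    · rw [LinearMap.finrank_range_of_inj hi, Module.finrank_fin_fun]
      exact hr
  simp only [Matrix.map_mul]
  refine (toLin' (R := F)).injective (LinearMap.ext fun v => ?_)
  obtain ⟨w, hw⟩ : (A.map φ) *ᵥ v ∈ LinearMap.range (A.map φ * Q.map φ).mulVecLin := by
    rw [hrange]
    exact ⟨v, rfl⟩
  rw [mulVecLin_apply] at hw
  rw [toLin'_apply, toLin'_apply]
  calc (A.map φ * (Q.map φ * C'.map φ * P.map φ) * A.map φ) *ᵥ v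
      = (A.map φ * Q.map φ * C'.map φ * P.map φ) *ᵥ ((A.map φ) *ᵥ v) := by
        rw [mulVec_mulVec]; simp only [Matrix.mul_assoc]
    _ = (A.map φ * Q.map φ * (C'.map φ * (P.map φ * A.map φ * Q.map φ))) *ᵥ w := by
        rw [← hw, mulVec_mulVec]; simp only [Matrix.mul_assoc]
    _ = _ := by rw [hφ', Matrix.mul_one, hw]

open Kronecker in
/-- The matrix of the operator `X ↦ X N - q N X`. -/
def twistedAdMatrix {n : ℕ} {R : Type*} [CommRing R] (q : R) (N : Matrix (Fin n) (Fin n) R) :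
    Matrix (Fin n × Fin n) (Fin n × Fin n) R :=
  Nᵀ ⊗ₖ (1 : Matrix (Fin n) (Fin n) R) - q • ((1 : Matrix (Fin n) (Fin n) R) ⊗ₖ N)

theorem twistedAdMatrix_mulVec {n : ℕ} {R : Type*} [CommRing R] (q : R)
    (N X : Matrix (Fin n) (Fin n) R) :
    twistedAdMatrix q N *ᵥ vec X = vec (twistedAd q N X) := by
  rw [twistedAdMatrix, sub_mulVec, smul_mulVec, kronecker_mulVec_vec, kronecker_mulVec_vec,
    twistedAd_apply, vec_sub, vec_smul]
  simp

theorem twistedAdMatrix_map {n : ℕ} {R S : Type*} [CommRing R] [CommRing S] (f : R →+* S) (q : R)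
    (N : Matrix (Fin n) (Fin n) R) :
    (twistedAdMatrix q N).map f = twistedAdMatrix (f q) (N.map f) := by
  ext ⟨i, j⟩ ⟨i', j'⟩
  change f (N i' i * (1 : Matrix (Fin n) (Fin n) R) j j' -
      q * ((1 : Matrix (Fin n) (Fin n) R) i i' * N j j')) =
    f (N i' i) * (1 : Matrix (Fin n) (Fin n) S) j j' -
      f q * ((1 : Matrix (Fin n) (Fin n) S) i i' * f (N j j'))
  simp only [one_apply, map_sub, map_mul, apply_ite f, map_one, map_zero]

theorem rank_twistedAdMatrix {n : ℕ} {F : Type*} [Field F] {σ : n.Partition}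
    {N : Matrix (Fin n) (Fin n) F} (hN : InOrbit σ N) {q : F} (hq : q ≠ 0) :
    (twistedAdMatrix q N).rank + (σ.parts.map fun x => (σ.parts.map fun y => min x y).sum).sum =
      n * n := by
  let e : Matrix (Fin n) (Fin n) F ≃ₗ[F] (Fin n × Fin n → F) :=
    { toFun := vec, map_add' := vec_add, map_smul' := fun a X => vec_smul a X,
      invFun v := of fun i j => v (j, i), left_inv _ := rfl, right_inv _ := rfl }
  have hker : LinearMap.ker (twistedAd q N) =
      (LinearMap.ker (twistedAdMatrix q N).mulVecLin).comap (e : _ →ₗ[F] _) := by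
    ext X
    rw [LinearMap.mem_ker, Submodule.mem_comap, LinearMap.mem_ker]
    change _ ↔ twistedAdMatrix q N *ᵥ vec X = 0
    rw [twistedAdMatrix_mulVec, vec_eq_zero_iff]
  rw [← finrank_ker_twistedAd hN hq, hker, (e.ofSubmodule' _).finrank_eq, Matrix.rank,
    LinearMap.finrank_range_add_finrank_ker, Module.finrank_pi, Fintype.card_prod, Fintype.card_fin]

/-- If a nilpotent matrix over a local domain has the same Jordan type over the residue field as
generically, the operator `X ↦ X N - q N X` has a pseudo-inverse. -/
theorem exists_pseudoInverse_twistedAd {n : ℕ} {O K L : Type*} [CommRing O] [IsLocalRing O]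
    [Field K] [Field L] (φ : O →+* K) (hφ : Function.Injective φ) (ψ : ResidueField O →+* L)
    {σ : n.Partition} {N : Matrix (Fin n) (Fin n) O} (hK : InOrbit σ (N.map φ))
    (hL : InOrbit σ ((N.map (residue O)).map ψ)) {q : O} (hq : IsUnit q) :
    ∃ T : Matrix (Fin n) (Fin n) O →ₗ[O] Matrix (Fin n) (Fin n) O,
      ∀ X, twistedAd q N (T (twistedAd q N X)) = twistedAd q N X := by
  -- Both ranks equal `n²` minus the same sum over `σ`; passing from the residue field to `L` leaves
  -- the rank unchanged.
  have h1 := rank_twistedAdMatrix hK (hq.map φ).ne_zero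
  have h2 := rank_twistedAdMatrix hL ((hq.map (residue O)).map ψ).ne_zero
  rw [← twistedAdMatrix_map] at h1 h2
  rw [rank_map_field, ← twistedAdMatrix_map] at h2
  obtain ⟨T, hT⟩ := exists_pseudoInverse φ hφ (twistedAdMatrix q N) (by omega)
  let e : Matrix (Fin n) (Fin n) O ≃ₗ[O] (Fin n × Fin n → O) :=
    { toFun := vec, map_add' := vec_add, map_smul' := fun a X => vec_smul a X,
      invFun v := of fun i j => v (j, i), left_inv _ := rfl, right_inv _ := rfl }
  refine ⟨e.symm.toLinearMap ∘ₗ T.mulVecLin ∘ₗ e.toLinearMap, fun X => vec_inj.mp ?_⟩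
  have h3 : ∀ Y, vec (e.symm Y) = Y := fun Y => e.apply_symm_apply Y
  have h4 : ∀ Y, e Y = vec Y := fun _ => rfl
  simp only [LinearMap.comp_apply, LinearEquiv.coe_coe, mulVecLin_apply]
  rw [← twistedAdMatrix_mulVec, h3, h4, ← twistedAdMatrix_mulVec, mulVec_mulVec, mulVec_mulVec, hT]

end PseudoInverse

/-! ## Homomorphisms out of `T_q` -/

section TameHom

open Topology

variable {p : ℕ} [Fact p.Prime] {q : ℕ} {hq : p.Coprime q} {H : Type*} [Group H]

theorem continuous_tame_inl :
    Continuous (SemidirectProduct.inl : Multiplicative ℤ_[p] →* Tame p q hq) := by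
  refine continuous_induced_rng.mpr ?_
  change Continuous fun x : Multiplicative ℤ_[p] => (x, (1 : ZHat))
  fun_prop

theorem continuous_tame_inr : Continuous (SemidirectProduct.inr : ZHat →* Tame p q hq) := by
  refine continuous_induced_rng.mpr ?_
  change Continuous fun x : ZHat => ((1 : Multiplicative ℤ_[p]), x)
  fun_prop

theorem continuous_tame_left :
    Continuous (SemidirectProduct.left : Tame p q hq → Multiplicative ℤ_[p]) :=
  continuous_fst.comp (continuous_induced_dom (f := SemidirectProduct.equivProd))

theorem continuous_tame_right :
    Continuous (SemidirectProduct.right : Tame p q hq → ZHat) :=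
  continuous_snd.comp (continuous_induced_dom (f := SemidirectProduct.equivProd))

/-- With the discrete topology on `H` locally constant means continuous, and `ℕ` is dense in `ℤ_p`.
-/
theorem padicInt_hom_ext {f g : Multiplicative ℤ_[p] →* H} (hf : IsLocallyConstant f)
    (hg : IsLocallyConstant g)
    (h : f (Multiplicative.ofAdd 1) = g (Multiplicative.ofAdd 1)) : f = g := by
  let _ : TopologicalSpace H := ⊥
  have : DiscreteTopology H := ⟨rfl⟩
  refine DFunLike.coe_injective (DenseRange.equalizer
    (f := fun n : ℕ => (Multiplicative.ofAdd (n : ℤ_[p])))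
    (PadicInt.denseRange_natCast (p := p)) hf.continuous hg.continuous ?_)
  funext n
  have : Multiplicative.ofAdd (n : ℤ_[p]) = Multiplicative.ofAdd (1 : ℤ_[p]) ^ n := by
    rw [← ofAdd_nsmul]
    simp
  simp only [Function.comp_apply, this, map_pow, h]

theorem etaFn_eq_zpow (x : Multiplicative ℤ) :
    ProfiniteGrp.ProfiniteCompletion.etaFn (GrpCat.of (Multiplicative ℤ)) x =
      zhatGen ^ x.toAdd := by
  let η : Multiplicative ℤ →* ZHat :=
    (ProfiniteGrp.ProfiniteCompletion.eta (GrpCat.of (Multiplicative ℤ))).hom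
  change η x = η (Multiplicative.ofAdd 1) ^ x.toAdd
  rw [← map_zpow, ← ofAdd_zsmul]
  simp

theorem closure_zhatGen_subset {s : Set ZHat} (hs : IsClosed s) (h : ∀ n : ℤ, zhatGen ^ n ∈ s) :
    s = Set.univ := by
  refine Set.eq_univ_of_univ_subset ?_
  rw [← (ProfiniteGrp.ProfiniteCompletion.denseRange
    (GrpCat.of (Multiplicative ℤ))).closure_eq]
  refine closure_minimal ?_ hs
  rintro _ ⟨x, rfl⟩
  rw [etaFn_eq_zpow]
  exact h _

theorem zhat_hom_ext {f g : ZHat →* H} (hf : IsLocallyConstant f)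
    (hg : IsLocallyConstant g) (h : f zhatGen = g zhatGen) : f = g := by
  let _ : TopologicalSpace H := ⊥
  have : DiscreteTopology H := ⟨rfl⟩
  have := closure_zhatGen_subset (s := {x | f x = g x})
    (isClosed_eq hf.continuous hg.continuous) fun n => by
      rw [Set.mem_ofPred_eq, map_zpow, map_zpow, h]
  ext x
  exact this.symm.le (Set.mem_univ x)

/-- A continuous homomorphism from `T_q` to a discrete group is determined by its values on `τ` and
`φ`. -/
theorem tame_hom_ext {f g : Tame p q hq →* H} (hf : IsLocallyConstant f)
    (hg : IsLocallyConstant g) (hτ : f (tau hq) = g (tau hq)) (hφ : f (phi hq) = g (phi hq)) :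
    f = g :=
  SemidirectProduct.hom_ext
    (padicInt_hom_ext (hf.comp_continuous continuous_tame_inl)
      (hg.comp_continuous continuous_tame_inl) hτ)
    (zhat_hom_ext (hf.comp_continuous continuous_tame_inr)
      (hg.comp_continuous continuous_tame_inr) hφ)

/-- The powers of `p` tend to `0` in `ℤ_p`, and `f` is constant near the identity. -/
theorem exists_pow_tau_eq_one {f : Tame p q hq →* H} (hf : IsLocallyConstant f) :
    ∃ m : ℕ, f (tau hq) ^ p ^ m = 1 := by
  have h1 := hf.comp_continuous continuous_tame_inl
  have h2 := (IsLocallyConstant.iff_eventually_eq _).mp h1 1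
  have h3 : Filter.Tendsto (fun m : ℕ => Multiplicative.ofAdd ((p : ℤ_[p]) ^ m)) Filter.atTop
      (𝓝 (1 : Multiplicative ℤ_[p])) := by
    have : Filter.Tendsto (fun m : ℕ => (p : ℤ_[p]) ^ m) Filter.atTop (𝓝 0) :=
      tendsto_pow_atTop_nhds_zero_of_norm_lt_one
        (by
          rw [PadicInt.norm_p]
          exact inv_lt_one_of_one_lt₀ (by exact_mod_cast (Fact.out : p.Prime).one_lt))
    exact this
  obtain ⟨m, hm⟩ := (h3.eventually h2).exists
  refine ⟨m, ?_⟩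
  rw [← map_pow, tau, ← map_pow, ← ofAdd_nsmul]
  simpa using hm

theorem exists_padicInt_hom {u : H} {m : ℕ} (hu : u ^ p ^ m = 1) :
    ∃ f : Multiplicative ℤ_[p] →* H, IsLocallyConstant f ∧ f (Multiplicative.ofAdd 1) = u := by
  let F : ZMod (p ^ m) →+ Additive H :=
    ZMod.lift (p ^ m) ⟨(zmultiplesHom (Additive H)) (Additive.ofMul u), by
      rw [zmultiplesHom_apply, natCast_zsmul, ← ofMul_pow, hu, ofMul_one]⟩
  refine ⟨AddMonoidHom.toMultiplicativeLeft (F.comp (PadicInt.toZModPow m).toAddMonoidHom),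
    ?_, ?_⟩
  · rw [IsLocallyConstant.iff_eventually_eq]
    intro x
    have hb : Metric.ball (x.toAdd) ((p : ℝ) ^ (-(m : ℤ))) ∈ 𝓝 (x.toAdd : ℤ_[p]) := by
      refine Metric.ball_mem_nhds _ (zpow_pos ?_ _)
      exact_mod_cast (Fact.out : p.Prime).pos
    have hb' : ∀ᶠ y : Multiplicative ℤ_[p] in 𝓝 x,
        y.toAdd ∈ Metric.ball (x.toAdd) ((p : ℝ) ^ (-(m : ℤ))) := hb
    filter_upwards [hb'] with y hy
    have : PadicInt.toZModPow m y.toAdd = PadicInt.toZModPow m x.toAdd := by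
      rw [← sub_eq_zero, ← map_sub, ← RingHom.mem_ker, PadicInt.ker_toZModPow,
        ← PadicInt.norm_le_pow_iff_mem_span_pow, ← dist_eq_norm]
      exact (Metric.mem_ball.mp hy).le
    change Additive.toMul (F (PadicInt.toZModPow m y.toAdd)) =
      Additive.toMul (F (PadicInt.toZModPow m x.toAdd))
    rw [this]
  · change Additive.toMul (F (PadicInt.toZModPow m (1 : ℤ_[p]))) = u
    have h1 : PadicInt.toZModPow m (1 : ℤ_[p]) = Int.castAddHom (ZMod (p ^ m)) 1 := by simp
    rw [h1, ZMod.lift_castAddHom]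
    simp

/-- The map is factored through the cyclic group of order `orderOf f`. This group lives in the
lowest universe, where the universal property of `ZHat` applies, whatever the universe of `H`. -/
theorem exists_zhat_hom [Finite H] (f : H) :
    ∃ F : ZHat →* H, IsLocallyConstant F ∧ F zhatGen = f := by
  have : NeZero (orderOf f) := ⟨(orderOf_pos f).ne'⟩
  let F₀ : Multiplicative ℤ →* Multiplicative (ZMod (orderOf f)) :=
    AddMonoidHom.toMultiplicative (Int.castAddHom (ZMod (orderOf f)))
  let P : FiniteGrp.{0} := FiniteGrp.of (Multiplicative (ZMod (orderOf f)))
  let F₁ := ProfiniteGrp.ProfiniteCompletion.lift (G := GrpCat.of (Multiplicative ℤ))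
    (P := ProfiniteGrp.ofFiniteGrp P)
    (GrpCat.ofHom F₀)
  let F₂ : ZMod (orderOf f) →+ Additive H :=
    ZMod.lift (orderOf f) ⟨(zmultiplesHom (Additive H)) (Additive.ofMul f), by
      rw [zmultiplesHom_apply, natCast_zsmul, ← ofMul_pow, pow_orderOf_eq_one, ofMul_one]⟩
  let F₃ : Multiplicative (ZMod (orderOf f)) →* H := AddMonoidHom.toMultiplicativeLeft F₂
  let F₄ : ZHat →* Multiplicative (ZMod (orderOf f)) := F₁.hom.toMonoidHom
  refine ⟨F₃.comp F₄, ?_, ?_⟩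
  · have h1 : Continuous F₁.hom := F₁.hom.continuous_toFun
    have : DiscreteTopology (ProfiniteGrp.ofFiniteGrp P) := ⟨rfl⟩
    have h2 : IsLocallyConstant F₁.hom := (IsLocallyConstant.iff_continuous _).mpr h1
    exact h2.comp F₃
  · have h1 : F₁.hom zhatGen = Multiplicative.ofAdd (Int.castAddHom (ZMod (orderOf f)) 1) :=
      CategoryTheory.ConcreteCategory.congr_hom (ProfiniteGrp.ProfiniteCompletion.lift_eta
        (G := GrpCat.of (Multiplicative ℤ)) (P := ProfiniteGrp.ofFiniteGrp P)
        (GrpCat.ofHom F₀))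
        (Multiplicative.ofAdd (1 : ℤ))
    change F₃ (F₁.hom zhatGen) = f
    rw [h1]
    change Additive.toMul (F₂ (Int.castAddHom (ZMod (orderOf f)) 1)) = f
    rw [ZMod.lift_castAddHom]
    simp

theorem continuous_zhatPow (u : ℤ_[p]ˣ) : Continuous (zhatPow u) :=
  ((ProfiniteGrp.ProfiniteCompletion.lift (G := GrpCat.of (Multiplicative ℤ))
    (P := ProfiniteGrp.of ℤ_[p]ˣ) (GrpCat.ofHom (zpowersHom ℤ_[p]ˣ u))).hom).continuous_toFun

theorem zhatPow_zhatGen (u : ℤ_[p]ˣ) : zhatPow u zhatGen = u := by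
  have := CategoryTheory.ConcreteCategory.congr_hom (ProfiniteGrp.ProfiniteCompletion.lift_eta
    (G := GrpCat.of (Multiplicative ℤ)) (P := ProfiniteGrp.of ℤ_[p]ˣ)
    (GrpCat.ofHom (zpowersHom ℤ_[p]ˣ u))) (Multiplicative.ofAdd (1 : ℤ))
  refine this.trans ?_
  change (zpowersHom ℤ_[p]ˣ u) (Multiplicative.ofAdd (1 : ℤ)) = _
  simp

theorem unitsAct_apply (u : ℤ_[p]ˣ) (x : ℤ_[p]) :
    unitsAct p u (Multiplicative.ofAdd x) = Multiplicative.ofAdd ((u : ℤ_[p]) * x) := rfl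

/-- The homomorphism from `T_q` to a finite group with given values on `τ` and `φ`. -/
theorem exists_tame_hom [Finite H] {u f : H} {m : ℕ} (hu : u ^ p ^ m = 1)
    (huf : f * u * f⁻¹ = u ^ q) :
    ∃ ρ : Tame p q hq →* H, IsLocallyConstant ρ ∧ ρ (tau hq) = u ∧ ρ (phi hq) = f := by
  obtain ⟨F₁, hF₁, h1⟩ := exists_padicInt_hom hu
  obtain ⟨F₂, hF₂, h2⟩ := exists_zhat_hom f
  let _ : TopologicalSpace H := ⊥
  have : DiscreteTopology H := ⟨rfl⟩
  let act := (unitsAct p).comp (zhatPow (qUnit hq))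
  have hact : ∀ x : ℤ_[p], act zhatGen (Multiplicative.ofAdd x) = Multiplicative.ofAdd (q * x) := by
    intro x
    change unitsAct p (zhatPow (qUnit hq) zhatGen) _ = _
    rw [zhatPow_zhatGen, unitsAct_apply]
    simp [qUnit]
  -- The compatibility needed for a semidirect product. The elements `g` satisfying it form a closed
  -- subgroup of `ZHat`; the hypothesis `f u f⁻¹ = u ^ q` puts the topological generator in it.
  have key : ∀ g : ZHat, F₁.comp (act g).toMonoidHom = (MulAut.conj (F₂ g)).toMonoidHom.comp F₁ := by
    let K : Subgroup ZHat :=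
      { carrier := {g | ∀ x, F₁ (act g x) = F₂ g * F₁ x * (F₂ g)⁻¹}
        one_mem' := by simp
        mul_mem' := by
          intro a b ha hb x
          rw [map_mul, MulAut.mul_apply, ha, hb, map_mul]
          group
        inv_mem' := by
          intro a ha x
          have := ha (act a⁻¹ x)
          rw [← MulAut.mul_apply, ← map_mul, mul_inv_cancel, map_one, MulAut.one_apply] at this
          rw [this, map_inv]
          simp [mul_assoc] }
    have hgen : zhatGen ∈ K := by
      let f' : Multiplicative ℤ_[p] →* H := F₁.comp (act zhatGen).toMonoidHom
      let g' : Multiplicative ℤ_[p] →* H := (MulAut.conj (F₂ zhatGen)).toMonoidHom.comp F₁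
      have : f' = g' := by
        refine padicInt_hom_ext ?_ ?_ ?_
        · refine hF₁.comp_continuous (f := act zhatGen) ?_
          have : (act zhatGen : Multiplicative ℤ_[p] → Multiplicative ℤ_[p]) =
              fun x => Multiplicative.ofAdd ((q : ℤ_[p]) * x.toAdd) := funext fun x => hact x.toAdd
          rw [this]
          exact continuous_ofAdd.comp (continuous_const.mul continuous_toAdd)
        · exact hF₁.comp (MulAut.conj (F₂ zhatGen))
        · change F₁ (act zhatGen (Multiplicative.ofAdd 1)) =
            F₂ zhatGen * F₁ (Multiplicative.ofAdd 1) * (F₂ zhatGen)⁻¹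
          have e : Multiplicative.ofAdd ((q : ℤ_[p]) * 1) =
              Multiplicative.ofAdd (1 : ℤ_[p]) ^ q := by
            rw [← ofAdd_nsmul]
            simp
          rw [hact, h1, h2, e, map_pow, h1, huf]
      intro x
      exact DFunLike.congr_fun this x
    have hcl : IsClosed (K : Set ZHat) := by
      have : (K : Set ZHat) = ⋂ x, {g | F₁ (act g x) = F₂ g * F₁ x * (F₂ g)⁻¹} := by
        ext g
        simp only [Set.mem_iInter]
        rfl
      rw [this]
      refine isClosed_iInter fun x => isClosed_eq ?_ ?_
      · refine hF₁.continuous.comp ?_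
        have : (fun g => act g x) =
            fun g => Multiplicative.ofAdd ((zhatPow (qUnit hq) g : ℤ_[p]) * x.toAdd) := by
          funext g
          exact unitsAct_apply _ _
        rw [this]
        exact continuous_ofAdd.comp
          ((Units.continuous_val.comp (continuous_zhatPow _)).mul continuous_const)
      · have hc := hF₂.continuous
        exact (hF₂.comp fun h => h * F₁ x * h⁻¹).continuous
    have huniv := closure_zhatGen_subset hcl fun n => K.zpow_mem hgen n
    intro g
    ext x
    have : g ∈ (K : Set ZHat) := huniv.symm.le (Set.mem_univ g)
    exact this x
  refine ⟨SemidirectProduct.lift F₁ F₂ key, ?_, ?_, ?_⟩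
  · have : (SemidirectProduct.lift F₁ F₂ key : Tame p q hq → H) =
        fun x => F₁ x.left * F₂ x.right := rfl
    rw [this]
    exact IsLocallyConstant.mul (hF₁.comp_continuous continuous_tame_left)
      (hF₂.comp_continuous continuous_tame_right)
  · rw [tau, SemidirectProduct.lift_inl, h1]
  · rw [phi, SemidirectProduct.lift_inr, h2]

end TameHom

/-! ## Power series rings as coefficient algebras -/

section PowerSeriesRing

open Finsupp

variable {d : ℕ} {R : Type*} [CommRing R] [IsLocalRing R]

theorem mvPowerSeries_mem_maximalIdeal {f : MvPowerSeries (Fin d) R} :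
    f ∈ maximalIdeal (MvPowerSeries (Fin d) R) ↔
      MvPowerSeries.constantCoeff f ∈ maximalIdeal R := by
  rw [mem_maximalIdeal, mem_nonunits_iff, MvPowerSeries.isUnit_iff_constantCoeff,
    mem_maximalIdeal, mem_nonunits_iff]

theorem idealOfVars_pow_le_comap (N : ℕ) : MvPolynomial.idealOfVars (Fin d) R ^ N ≤
    (maximalIdeal (MvPowerSeries (Fin d) R) ^ N).comap
      (algebraMap (MvPolynomial (Fin d) R) (MvPowerSeries (Fin d) R)) := by
  rw [← Ideal.map_le_iff_le_comap, Ideal.map_pow]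
  refine Ideal.pow_right_mono ?_ N
  rw [Ideal.map_span, Ideal.span_le]
  rintro _ ⟨_, ⟨i, rfl⟩, rfl⟩
  rw [SetLike.mem_coe, mvPowerSeries_mem_maximalIdeal]
  have : algebraMap (MvPolynomial (Fin d) R) (MvPowerSeries (Fin d) R) (MvPolynomial.X i) =
    MvPowerSeries.X i := MvPolynomial.coe_X i
  rw [this, MvPowerSeries.constantCoeff_X]
  exact zero_mem _

/-- The power series ring is the completion of the polynomial ring at the ideal of the variables.
That ideal is finitely generated, so the series vanishing modulo its `N`-th power form exactly the
`N`-th power times the completion. -/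
theorem mem_maximalIdeal_pow_of_truncTotal_eq_zero {f : MvPowerSeries (Fin d) R} {N : ℕ}
    (hf : MvPowerSeries.truncTotal N f = 0) :
    f ∈ maximalIdeal (MvPowerSeries (Fin d) R) ^ N := by
  set I := MvPolynomial.idealOfVars (Fin d) R with hI
  let e := (MvPowerSeries.toAdicCompletionAlgEquiv (Fin d) R).toLinearEquiv
  have h1 : e f ∈ I ^ N • (⊤ : Submodule (MvPolynomial (Fin d) R)
      (AdicCompletion I (MvPolynomial (Fin d) R))) := by
    rw [AdicCompletion.pow_smul_top_eq_ker_eval (MvPolynomial.idealOfVars_fg (Fin d) R),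
      LinearMap.mem_ker]
    change ((MvPowerSeries.toAdicCompletion (Fin d) R) f).val N = 0
    rw [MvPowerSeries.toAdicCompletion_apply_eq_mk_truncTotal, hf]
    rfl
  have h2 : f ∈ I ^ N • (⊤ : Submodule (MvPolynomial (Fin d) R) (MvPowerSeries (Fin d) R)) := by
    have := Submodule.mem_map_of_mem (f := e.symm.toLinearMap) h1
    rw [Submodule.map_smul''] at this
    have h3 := Submodule.smul_mono (le_refl (I ^ N)) (le_top (a := Submodule.map
      e.symm.toLinearMap ⊤)) this
    simpa using h3
  refine Submodule.smul_induction_on h2 (fun a ha g _ => ?_) fun x y hx hy => add_mem hx hy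
  rw [Algebra.smul_def]
  exact Ideal.mul_mem_right _ _ (idealOfVars_pow_le_comap N ha)

theorem sub_truncTotal_mem (f : MvPowerSeries (Fin d) R) (N : ℕ) :
    f - (MvPowerSeries.truncTotal N f : MvPolynomial (Fin d) R) ∈
      maximalIdeal (MvPowerSeries (Fin d) R) ^ N := by
  refine mem_maximalIdeal_pow_of_truncTotal_eq_zero ?_
  ext e
  rw [MvPolynomial.coeff_zero]
  by_cases he : degree e < N
  · rw [MvPowerSeries.coeff_truncTotal _ he, map_sub, MvPolynomial.coeff_coe,
      MvPowerSeries.coeff_truncTotal _ he, sub_self]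
  · rw [MvPowerSeries.coeff_truncTotal_eq_zero _ (by omega)]

/-- Membership in powers of the maximal ideal of a power series ring, by coefficients. -/
theorem mem_maximalIdeal_pow_iff {f : MvPowerSeries (Fin d) R} {N : ℕ} :
    f ∈ maximalIdeal (MvPowerSeries (Fin d) R) ^ N ↔
      ∀ e, MvPowerSeries.coeff e f ∈ maximalIdeal R ^ (N - degree e) := by
  constructor
  · induction N generalizing f with
    | zero => simp
    | succ N ih =>
      intro hf
      rw [pow_succ'] at hf
      refine Submodule.mul_induction_on hf (fun a ha b hb e => ?_) fun x y hx hy e => ?_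
      · classical
        rw [MvPowerSeries.coeff_mul]
        refine sum_mem fun x hx => ?_
        have hx' := Finset.HasAntidiagonal.mem_antidiagonal.mp hx
        have hb' := ih hb x.2
        have hdeg : degree x.1 + degree x.2 = degree e := by rw [← hx', map_add]
        -- A factor in the maximal ideal gains one order either through its constant term, which
        -- lies in the maximal ideal of `R`, or through the positive degree of its monomial.
        by_cases h0 : x.1 = 0
        · have ha' : MvPowerSeries.coeff x.1 a ∈ maximalIdeal R := by
            rw [h0]
            exact mvPowerSeries_mem_maximalIdeal.mp ha
          rw [h0, map_zero, zero_add] at hdeg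
          have := Ideal.mul_mem_mul ha' hb'
          rw [← pow_succ'] at this
          exact Ideal.pow_le_pow_right (by omega) this
        · have h1 : 1 ≤ degree x.1 := by
            rw [Nat.one_le_iff_ne_zero, Ne, degree_eq_zero_iff]
            exact h0
          exact Ideal.mul_mem_left _ _ (Ideal.pow_le_pow_right (by omega) hb')
      · rw [map_add]
        exact add_mem (hx e) (hy e)
  · intro h
    -- Discard the terms of degree at least `N`. Each remaining term is a coefficient in the power
    -- `N - degree e` times a monomial in the power `degree e`.
    have h1 := sub_truncTotal_mem f N
    have h2 : ((MvPowerSeries.truncTotal N f : MvPolynomial (Fin d) R) : MvPowerSeries (Fin d) R) ∈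
        maximalIdeal (MvPowerSeries (Fin d) R) ^ N := by
      let φ := algebraMap (MvPolynomial (Fin d) R) (MvPowerSeries (Fin d) R)
      change φ (MvPowerSeries.truncTotal N f) ∈ _
      rw [(MvPowerSeries.truncTotal N f).as_sum, map_sum]
      refine sum_mem fun e _ => ?_
      by_cases he : degree e < N
      · rw [MvPowerSeries.coeff_truncTotal _ he]
        have e1 : MvPolynomial.monomial e (MvPowerSeries.coeff e f) =
          MvPolynomial.C (MvPowerSeries.coeff e f) * MvPolynomial.monomial e 1 := by
          rw [MvPolynomial.C_mul_monomial, mul_one]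
        rw [e1, map_mul]
        have h3 : φ (MvPolynomial.monomial e 1) ∈
            maximalIdeal (MvPowerSeries (Fin d) R) ^ degree e := by
          refine idealOfVars_pow_le_comap _ ?_
          rw [MvPolynomial.mem_pow_idealOfVars_iff']
          intro x hx
          rw [MvPolynomial.coeff_monomial, if_neg]
          rintro rfl
          omega
        have h4 : φ (MvPolynomial.C (MvPowerSeries.coeff e f)) ∈
            maximalIdeal (MvPowerSeries (Fin d) R) ^ (N - degree e) := by
          have : (maximalIdeal R ^ (N - degree e)).map
              (MvPowerSeries.C : R →+* MvPowerSeries (Fin d) R) ≤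
              maximalIdeal (MvPowerSeries (Fin d) R) ^ (N - degree e) := by
            rw [Ideal.map_pow]
            refine Ideal.pow_right_mono (Ideal.map_le_iff_le_comap.mpr fun a ha => ?_) _
            rw [Ideal.mem_comap, mvPowerSeries_mem_maximalIdeal, MvPowerSeries.constantCoeff_C]
            exact ha
          have e2 : φ (MvPolynomial.C (MvPowerSeries.coeff e f)) =
            MvPowerSeries.C (MvPowerSeries.coeff e f) := MvPolynomial.coe_C _
          rw [e2]
          exact this (Ideal.mem_map_of_mem _ (h e))
        have h5 := Ideal.mul_mem_mul h4 h3
        rwa [← pow_add, Nat.sub_add_cancel he.le] at h5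
      · rw [MvPowerSeries.coeff_truncTotal_eq_zero _ (by omega), map_zero, map_zero]
        exact zero_mem _
    have := add_mem h1 h2
    rwa [sub_add_cancel] at this

/-- The coefficientwise description of the powers of the maximal ideal reduces both properties to
`R`: the coefficient at `e` of a Cauchy sequence is Cauchy once the index is shifted by `degree e`.
-/
theorem mvPowerSeries_isAdicComplete [IsAdicComplete (maximalIdeal R) R] :
    IsAdicComplete (maximalIdeal (MvPowerSeries (Fin d) R)) (MvPowerSeries (Fin d) R) where
  haus' f hf := by
    ext e
    rw [MvPowerSeries.coeff_zero]
    refine IsHausdorff.haus' (I := maximalIdeal R) _ fun i => ?_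
    have := hf (i + degree e)
    rw [SModEq.zero, smul_eq_mul, Ideal.mul_top, mem_maximalIdeal_pow_iff] at this
    rw [SModEq.zero, smul_eq_mul, Ideal.mul_top]
    simpa using this e
  prec' f hf := by
    have h1 : ∀ (e : Fin d →₀ ℕ) {a b : ℕ}, a ≤ b →
        MvPowerSeries.coeff e (f (a + degree e)) ≡ MvPowerSeries.coeff e (f (b + degree e))
          [SMOD (maximalIdeal R ^ a • ⊤ : Submodule R R)] := by
      intro e a b hab
      have := hf (Nat.add_le_add_right hab (degree e))
      rw [SModEq.sub_mem, smul_eq_mul, Ideal.mul_top, mem_maximalIdeal_pow_iff] at this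
      rw [SModEq.sub_mem, smul_eq_mul, Ideal.mul_top, ← map_sub]
      simpa using this e
    choose L hL using fun e => IsPrecomplete.prec' (I := maximalIdeal R) _ (fun {_ _} => h1 e)
    let L' : MvPowerSeries (Fin d) R := L
    refine ⟨L', fun i => ?_⟩
    rw [SModEq.sub_mem, smul_eq_mul, Ideal.mul_top, mem_maximalIdeal_pow_iff]
    intro e
    by_cases he : degree e ≤ i
    · have := hL e (i - degree e)
      rw [Nat.sub_add_cancel he, SModEq.sub_mem, smul_eq_mul, Ideal.mul_top] at this
      rw [map_sub]
      exact this
    · rw [Nat.sub_eq_zero_of_le (by omega), pow_zero, Ideal.one_eq_top]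
      trivial

variable (O : Type u) [CommRing O] [IsLocalRing O]

/-- The power series ring over `O` as a coefficient algebra. -/
def powerSeriesCoeffAlg [IsNoetherianRing O] [IsAdicComplete (maximalIdeal O) O] (d : ℕ) :
    CoeffAlg O where
  carrier := MvPowerSeries (Fin d) O
  isAdicComplete := mvPowerSeries_isAdicComplete
  isLocalHom := ⟨fun a ha => by
    have := MvPowerSeries.isUnit_iff_constantCoeff.mp ha
    rwa [MvPowerSeries.algebraMap_apply, MvPowerSeries.constantCoeff_C] at this⟩
  residue_bijective := by
    refine ⟨RingHom.injective _, fun y => ?_⟩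
    obtain ⟨x, rfl⟩ := residue_surjective y
    refine ⟨residue O (MvPowerSeries.constantCoeff x), ?_⟩
    rw [ResidueField.map_residue, ← sub_eq_zero, ← map_sub, residue_eq_zero_iff,
      mvPowerSeries_mem_maximalIdeal, map_sub, MvPowerSeries.algebraMap_apply,
      MvPowerSeries.constantCoeff_C, Algebra.algebraMap_self_apply, sub_self]
    exact zero_mem _

end PowerSeriesRing

/-! ### Artinian coefficient algebras and maps to them from power series rings -/

section ArtAlg

variable {O : Type u} [CommRing O] [IsLocalRing O]

theorem ArtAlg.exists_pow_eq_bot (A : ArtAlg O) : ∃ N, maximalIdeal A.carrier ^ N = ⊥ := by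
  have := IsArtinianRing.isNilpotent_jacobson_bot (R := A.carrier)
  rwa [jacobson_eq_maximalIdeal ⊥ bot_ne_top] at this

theorem ArtAlg.isNilpotent (A : ArtAlg O) {a : A.carrier} (ha : a ∈ maximalIdeal A.carrier) :
    IsNilpotent a := by
  obtain ⟨N, hN⟩ := A.exists_pow_eq_bot
  refine ⟨N, ?_⟩
  have := Ideal.pow_mem_pow ha N
  rwa [hN] at this

/-- Non-units of an Artinian local ring are nilpotent, and a nilpotent element of a nontrivial ring
is not a unit. -/
instance ArtAlg.isLocalHom_algHom {A : ArtAlg O} {B : Type*} [CommRing B] [Nontrivial B]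
    [Algebra O B] (f : A.carrier →ₐ[O] B) : IsLocalHom f.toRingHom := by
  refine ⟨fun a ha => ?_⟩
  by_contra h
  have h1 : IsNilpotent (f a) := (A.isNilpotent ((mem_maximalIdeal a).mpr h)).map f
  exact h1.not_isUnit ha

theorem ArtAlg.map_mem_maximalIdeal {A B : ArtAlg O} (f : A.carrier →ₐ[O] B.carrier)
    {a : A.carrier} (ha : a ∈ maximalIdeal A.carrier) : f a ∈ maximalIdeal B.carrier := by
  rw [mem_maximalIdeal, mem_nonunits_iff]
  intro h
  exact ((mem_maximalIdeal _).mp ha) ((ArtAlg.isLocalHom_algHom f).map_nonunit a h)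

theorem ArtAlg.mem_maximalIdeal_of_map {A B : ArtAlg O} (f : A.carrier →ₐ[O] B.carrier)
    {a : A.carrier} (ha : f a ∈ maximalIdeal B.carrier) : a ∈ maximalIdeal A.carrier := by
  rw [mem_maximalIdeal, mem_nonunits_iff]
  intro h
  exact ((mem_maximalIdeal _).mp ha) (h.map f)

theorem ArtAlg.algebraMap_mem {A : ArtAlg O} {a : O} (ha : a ∈ maximalIdeal O) :
    algebraMap O A.carrier a ∈ maximalIdeal A.carrier := by
  rw [mem_maximalIdeal, mem_nonunits_iff]
  intro h
  exact ((mem_maximalIdeal _).mp ha) ((isUnit_map_iff (algebraMap O A.carrier) a).mp h)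

/-- Every element of an Artinian coefficient algebra is congruent to a constant. -/
theorem ArtAlg.exists_sub_mem (A : ArtAlg O) (a : A.carrier) :
    ∃ c : O, a - algebraMap O A.carrier c ∈ maximalIdeal A.carrier := by
  obtain ⟨y, hy⟩ := A.residue_bijective.2 (residue _ a)
  obtain ⟨c, rfl⟩ := residue_surjective y
  refine ⟨c, ?_⟩
  rw [← residue_eq_zero_iff, map_sub, ← hy, ResidueField.map_residue, sub_self]

instance ArtAlg.finite_residueField (A : ArtAlg O) [Finite (ResidueField O)] :
    Finite (ResidueField A.carrier) :=
  Finite.of_surjective _ A.residue_bijective.2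

theorem finite_of_maximalIdeal_pow {A : Type*} [CommRing A] [IsLocalRing A] [IsNoetherianRing A]
    [Finite (ResidueField A)] {N : ℕ} (hN : maximalIdeal A ^ N = ⊥) : Finite A := by
  have h1 : Finite (A ⧸ maximalIdeal A) := ‹Finite (ResidueField A)›
  have h2 := Ideal.finite_quotient_pow (IsNoetherian.noetherian (maximalIdeal A)) N
  rw [hN] at h2
  exact Finite.of_injective _ (RingEquiv.quotientBot A).symm.injective

/-- Finiteness serves twice: homomorphisms from `ZHat` to `G(A)` can be prescribed on the generator,
and surjectivity of the parametrization follows from injectivity. -/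
instance ArtAlg.finite (A : ArtAlg O) [Finite (ResidueField O)] : Finite A.carrier :=
  finite_of_maximalIdeal_pow A.exists_pow_eq_bot.choose_spec

variable {d : ℕ}

/-- Continuity is automatic. If `f x` is congruent to the constant `c`, then `x - c` cannot be a
unit because its image is not one, so `c` lies in the maximal ideal of `O`. -/
theorem powerSeries_map_mem (A : ArtAlg O) (f : MvPowerSeries (Fin d) O →ₐ[O] A.carrier)
    {x : MvPowerSeries (Fin d) O} (hx : x ∈ maximalIdeal (MvPowerSeries (Fin d) O)) :
    f x ∈ maximalIdeal A.carrier := by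
  obtain ⟨c, hc⟩ := A.exists_sub_mem (f x)
  have h1 : ¬ IsUnit (x - algebraMap O (MvPowerSeries (Fin d) O) c) := by
    intro h
    have := h.map f
    rw [map_sub, AlgHom.commutes] at this
    exact (mem_maximalIdeal _).mp hc this
  have h2 : c ∈ maximalIdeal O := by
    rw [← mem_nonunits_iff, ← mem_maximalIdeal, mvPowerSeries_mem_maximalIdeal, map_sub,
      MvPowerSeries.algebraMap_apply, MvPowerSeries.constantCoeff_C,
      Algebra.algebraMap_self_apply] at h1
    have := sub_mem (mvPowerSeries_mem_maximalIdeal.mp hx) h1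
    rwa [sub_sub_cancel] at this
  have := add_mem hc (ArtAlg.algebraMap_mem (A := A) h2)
  rwa [sub_add_cancel] at this

/-- Any homomorphism to `A` kills a power of the maximal ideal, hence depends only on a polynomial
truncation. -/
theorem powerSeries_algHom_ext {A : ArtAlg O} {f g : MvPowerSeries (Fin d) O →ₐ[O] A.carrier}
    (h : ∀ i, f (MvPowerSeries.X i) = g (MvPowerSeries.X i)) : f = g := by
  obtain ⟨N, hN⟩ := A.exists_pow_eq_bot
  have key : ∀ (f : MvPowerSeries (Fin d) O →ₐ[O] A.carrier) (x : MvPowerSeries (Fin d) O),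
      f x = f ((MvPowerSeries.truncTotal N x : MvPolynomial (Fin d) O) :
        MvPowerSeries (Fin d) O) := by
    intro f x
    have h1 := sub_truncTotal_mem x N
    have h2 : maximalIdeal (MvPowerSeries (Fin d) O) ≤ (maximalIdeal A.carrier).comap f :=
      fun x hx => powerSeries_map_mem A f hx
    have h3 := (Ideal.pow_right_mono h2 N).trans (Ideal.le_comap_pow f N) h1
    rw [Ideal.mem_comap, hN, Ideal.mem_bot, map_sub, sub_eq_zero] at h3
    exact h3
  ext x
  rw [key f, key g]
  have : f.comp (MvPolynomial.coeToMvPowerSeries.algHom O) =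
      g.comp (MvPolynomial.coeToMvPowerSeries.algHom O) := by
    ext i
    simpa using h i
  have h' := DFunLike.congr_fun this (MvPowerSeries.truncTotal N x)
  simpa using h'

theorem exists_powerSeries_algHom (A : ArtAlg O) (x : Fin d → A.carrier)
    (hx : ∀ i, x i ∈ maximalIdeal A.carrier) :
    ∃ f : MvPowerSeries (Fin d) O →ₐ[O] A.carrier, ∀ i, f (MvPowerSeries.X i) = x i := by
  obtain ⟨N, hN⟩ := A.exists_pow_eq_bot
  let ev : MvPolynomial (Fin d) O →ₐ[O] A.carrier := MvPolynomial.aeval x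
  have h1 : MvPolynomial.idealOfVars (Fin d) O ≤ (maximalIdeal A.carrier).comap ev := by
    rw [Ideal.span_le]
    rintro _ ⟨i, rfl⟩
    simpa [ev] using hx i
  have h2 : ∀ M, N ≤ M → ∀ a ∈ MvPolynomial.idealOfVars (Fin d) O ^ M, ev a = 0 := by
    intro M hM a ha
    have := (Ideal.pow_right_mono h1 M).trans (Ideal.le_comap_pow ev M) ha
    rw [Ideal.mem_comap] at this
    have := Ideal.pow_le_pow_right hM this
    rwa [hN, Ideal.mem_bot] at this
  -- Truncating below degree `N + 2` instead of `N` ensures that the variables themselves survive,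
  -- also when `N ≤ 1`.
  have h3 : ∀ a ∈ MvPolynomial.idealOfVars (Fin d) O ^ (N + 2), ev a = 0 := h2 _ (by omega)
  let F := (Ideal.Quotient.liftₐ (MvPolynomial.idealOfVars (Fin d) O ^ (N + 2)) ev h3).comp
    ((MvPowerSeries.truncTotalAlgHom (Fin d) O (N + 2)).restrictScalars O)
  refine ⟨F, fun i => ?_⟩
  have h4 : MvPowerSeries.truncTotal (N + 2) (MvPowerSeries.X i : MvPowerSeries (Fin d) O) =
      MvPolynomial.X i := by
    have := (MvPowerSeries.truncTotal_coe_eq_self_iff (n := N + 2)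
      (MvPolynomial.X i : MvPolynomial (Fin d) O) (by omega)).mpr ?_
    · rwa [MvPolynomial.coe_X] at this
    · rw [MvPolynomial.totalDegree_X]
      omega
  change Ideal.Quotient.liftₐ (MvPolynomial.idealOfVars (Fin d) O ^ (N + 2)) ev h3
    (Ideal.Quotient.mk _ (MvPowerSeries.truncTotal (N + 2) (MvPowerSeries.X i))) = x i
  rw [h4]
  change ev (MvPolynomial.X i) = x i
  simp [ev]

end ArtAlg

/-! ## Matrices with entries in an ideal -/

section MatIn

variable {n : ℕ} {R : Type*} [CommRing R]

/-- The matrix `X` has entries in the ideal `I`. -/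
def MatIn (I : Ideal R) (X : Matrix (Fin n) (Fin n) R) : Prop := ∀ i j, X i j ∈ I

variable {I J : Ideal R} {X Y : Matrix (Fin n) (Fin n) R}

theorem MatIn.zero : MatIn I (0 : Matrix (Fin n) (Fin n) R) := fun _ _ => zero_mem _

theorem MatIn.add (hX : MatIn I X) (hY : MatIn I Y) : MatIn I (X + Y) :=
  fun i j => add_mem (hX i j) (hY i j)

theorem MatIn.sub (hX : MatIn I X) (hY : MatIn I Y) : MatIn I (X - Y) :=
  fun i j => sub_mem (hX i j) (hY i j)

theorem MatIn.neg (hX : MatIn I X) : MatIn I (-X) := fun i j => neg_mem (hX i j)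

theorem MatIn.mono (h : I ≤ J) (hX : MatIn I X) : MatIn J X := fun i j => h (hX i j)

theorem MatIn.smul (a : R) (hX : MatIn I X) : MatIn I (a • X) :=
  fun i j => Ideal.mul_mem_left _ _ (hX i j)

theorem MatIn.smul_of_mem {a : R} (ha : a ∈ I) (X : Matrix (Fin n) (Fin n) R) : MatIn I (a • X) :=
  fun _ _ => Ideal.mul_mem_right _ _ ha

theorem MatIn.mul_right (hX : MatIn I X) (Y : Matrix (Fin n) (Fin n) R) : MatIn I (X * Y) :=
  fun i j => by
    rw [Matrix.mul_apply]
    exact sum_mem fun l _ => Ideal.mul_mem_right _ _ (hX i l)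

theorem MatIn.mul_left (hX : MatIn I X) (Y : Matrix (Fin n) (Fin n) R) : MatIn I (Y * X) :=
  fun i j => by
    rw [Matrix.mul_apply]
    exact sum_mem fun l _ => Ideal.mul_mem_left _ _ (hX l j)

theorem MatIn.mul (hX : MatIn I X) (hY : MatIn J Y) : MatIn (I * J) (X * Y) :=
  fun i j => by
    rw [Matrix.mul_apply]
    exact sum_mem fun l _ => Ideal.mul_mem_mul (hX i l) (hY l j)

theorem MatIn.transpose (hX : MatIn I X) : MatIn I Xᵀ := fun i j => hX j i

theorem MatIn.of_smul {a : R} (ha : IsUnit a) (hX : MatIn I (a • X)) : MatIn I X :=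
  fun i j => by
    obtain ⟨b, hb⟩ := ha.exists_left_inv
    have := Ideal.mul_mem_left I b (hX i j)
    rwa [Matrix.smul_apply, smul_eq_mul, ← mul_assoc, hb, one_mul] at this

theorem MatIn.smul_one_sub_one {a : R} (ha : a - 1 ∈ I) :
    MatIn I (a • (1 : Matrix (Fin n) (Fin n) R) - 1) := by
  have : a • (1 : Matrix (Fin n) (Fin n) R) - 1 = (a - 1) • 1 := by rw [sub_smul, one_smul]
  rw [this]
  exact MatIn.smul_of_mem ha _

theorem MatIn.mul_sub_one (hX : MatIn I (X - 1)) (hY : MatIn I (Y - 1)) : MatIn I (X * Y - 1) := by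
  have : X * Y - 1 = (X - 1) * Y + (Y - 1) := by noncomm_ring
  rw [this]
  exact (hX.mul_right _).add hY

theorem MatIn.pow_sub_one (hX : MatIn I (X - 1)) (k : ℕ) : MatIn I (X ^ k - 1) := by
  induction k with
  | zero => simpa using MatIn.zero
  | succ k ih =>
    rw [pow_succ]
    exact ih.mul_sub_one hX

theorem MatIn.map {S : Type*} [CommRing S] (f : R →+* S) {J : Ideal S} (h : ∀ a ∈ I, f a ∈ J)
    (hX : MatIn I X) : MatIn J (X.map f) := fun i j => h _ (hX i j)

theorem MatIn.trace_mem (hX : MatIn I X) : X.trace ∈ I := sum_mem fun i _ => hX i i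

theorem matIn_bot : MatIn (⊥ : Ideal R) X ↔ X = 0 := by
  refine ⟨fun h => ?_, fun h => h ▸ MatIn.zero⟩
  ext i j
  exact (Ideal.mem_bot).mp (h i j)

theorem map_mk_eq_one_iff : X.map (Ideal.Quotient.mk I) = 1 ↔ MatIn I (X - 1) := by
  rw [← Matrix.map_one (n := Fin n) (Ideal.Quotient.mk I) (map_zero _) (map_one _)]
  constructor
  · intro h i j
    have := congrFun (congrFun h i) j
    rwa [Matrix.map_apply, Matrix.map_apply, Ideal.Quotient.eq] at this
  · intro h
    ext i j
    rw [Matrix.map_apply, Matrix.map_apply, Ideal.Quotient.eq]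
    exact h i j

theorem MatIn.det_sub_one_mem (hX : MatIn I (X - 1)) : X.det - 1 ∈ I := by
  rw [← Ideal.Quotient.eq_zero_iff_mem, map_sub, map_one, RingHom.map_det,
    RingHom.mapMatrix_apply, map_mk_eq_one_iff.mpr hX, det_one, sub_self]

theorem MatIn.isUnit [IsLocalRing R] (hX : MatIn (maximalIdeal R) (X - 1)) : IsUnit X := by
  refine isUnit_matrix_of_residue ?_
  have : X.map (residue R) = 1 := map_mk_eq_one_iff.mpr hX
  rw [this]
  exact isUnit_one

/-- In `X ^ p - 1 = (1 + X + ⋯ + X ^ (p - 1)) (X - 1)` the first factor is congruent to `p` modulo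
`I`, hence has entries in `I`. -/
theorem MatIn.pow_prime_sub_one {p : ℕ} (hp : (p : R) ∈ I) {i : ℕ} (hi : 1 ≤ i)
    (hX : MatIn (I ^ i) (X - 1)) : MatIn (I ^ (i + 1)) (X ^ p - 1) := by
  have h1 : X ^ p - 1 = (∑ j ∈ Finset.range p, X ^ j) * (X - 1) := (geom_sum_mul X p).symm
  have h2 : MatIn I (∑ j ∈ Finset.range p, X ^ j) := by
    have hX' : MatIn I (X - 1) := hX.mono (Ideal.pow_le_self (by omega))
    have h3 : (∑ j ∈ Finset.range p, X ^ j) =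
        (∑ j ∈ Finset.range p, (X ^ j - 1)) + (p : R) • 1 := by
      rw [Finset.sum_sub_distrib, Finset.sum_const, Finset.card_range, Nat.cast_smul_eq_nsmul]
      abel
    rw [h3]
    refine MatIn.add (fun a b => ?_) (MatIn.smul_of_mem hp _)
    rw [Matrix.sum_apply]
    exact sum_mem fun j _ => hX'.pow_sub_one j a b
  rw [h1, pow_succ']
  exact h2.mul hX

theorem MatIn.pow_prime_pow_sub_one {p : ℕ} (hp : (p : R) ∈ I) (hX : MatIn I (X - 1)) (k : ℕ) :
    MatIn (I ^ (k + 1)) (X ^ p ^ k - 1) := by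
  induction k with
  | zero => simpa using hX
  | succ k ih =>
    rw [pow_succ p, pow_mul]
    exact ih.pow_prime_sub_one hp (by omega)

end MatIn

/-! ## Roots of elements congruent to one -/

section Roots

variable {R : Type*} [CommRing R] {I : Ideal R} {p : ℕ}

theorem pow_prime_pow_eq_one (hp : (p : R) ∈ I) {N : ℕ} (hN : I ^ N = ⊥) {a : R} (ha : a - 1 ∈ I) :
    a ^ p ^ N = 1 := by
  have := (MatIn.smul_one_sub_one (n := 1) ha).pow_prime_pow_sub_one hp N
  rw [pow_succ, hN, Ideal.bot_mul] at this
  have h := this 0 0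
  rw [_root_.smul_pow, one_pow, Matrix.sub_apply, Matrix.smul_apply, one_apply_eq, smul_eq_mul,
    mul_one, Ideal.mem_bot, sub_eq_zero] at h
  exact h

/-- Raising to the power `s` inverts the `r`-th power map on elements killed by `p ^ (N + 1)`. The
exponent `N + 1` keeps the modulus above one when `N = 0`. -/
theorem exists_mul_eq_prime_pow_mul_add_one {r : ℕ} (hr : r.Coprime p) (hp1 : 1 < p) (N : ℕ) :
    ∃ s j : ℕ, r * s = p ^ (N + 1) * j + 1 := by
  obtain ⟨s, hs⟩ := Nat.exists_mul_mod_eq_one_of_coprime (hr.pow_right (N + 1))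
    (Nat.one_lt_pow (by omega) hp1)
  refine ⟨s, r * s / p ^ (N + 1), ?_⟩
  conv_lhs => rw [← Nat.div_add_mod (r * s) (p ^ (N + 1)), hs.2]

theorem pow_sub_one_mem {a : R} (ha : a - 1 ∈ I) (k : ℕ) : a ^ k - 1 ∈ I :=
  Ideal.mem_of_dvd I (sub_one_dvd_pow_sub_one a k) ha

/-- The elements congruent to `1` form a group killed by a power of `p`, on which the `r`-th power
map is bijective. The root is taken of the inverse of `a`, the form in which it rescales a
determinant or a multiplier to one. -/
theorem exists_root (hp : (p : R) ∈ I) (hp1 : 1 < p) {N : ℕ} (hN : I ^ N = ⊥) {r : ℕ}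
    (hr : r.Coprime p) {a : R} (ha : a - 1 ∈ I) : ∃ s, s - 1 ∈ I ∧ s ^ r * a = 1 := by
  obtain ⟨s, j, hs⟩ := exists_mul_eq_prime_pow_mul_add_one hr hp1 N
  have h1 : a ^ p ^ (N + 1) = 1 := pow_prime_pow_eq_one hp (by rw [pow_succ, hN, Ideal.bot_mul]) ha
  have h2 : a ^ (p ^ (N + 1) - 1) * a = 1 := by
    rw [← pow_succ, Nat.sub_add_cancel (Nat.one_le_pow _ _ (by omega)), h1]
  refine ⟨(a ^ (p ^ (N + 1) - 1)) ^ s, pow_sub_one_mem (pow_sub_one_mem ha _) _, ?_⟩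
  have h3 : (a ^ s) ^ r = a := by
    rw [← pow_mul, mul_comm, hs, pow_succ, pow_mul, h1, one_pow, one_mul]
  calc ((a ^ (p ^ (N + 1) - 1)) ^ s) ^ r * a = (a ^ (p ^ (N + 1) - 1)) ^ (r * s) * a := by
        rw [← pow_mul, mul_comm s]
    _ = ((a ^ s) ^ r) ^ (p ^ (N + 1) - 1) * a := by ring
    _ = 1 := by rw [h3, h2]

theorem root_unique (hp : (p : R) ∈ I) (hp1 : 1 < p) {N : ℕ} (hN : I ^ N = ⊥) {r : ℕ}
    (hr : r.Coprime p) {s s' a : R} (hs : s - 1 ∈ I) (hs' : s' - 1 ∈ I) (h : s ^ r * a = 1)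
    (h' : s' ^ r * a = 1) : s = s' := by
  obtain ⟨k, j, hk⟩ := exists_mul_eq_prime_pow_mul_add_one hr hp1 N
  have hN' : I ^ (N + 1) = ⊥ := by rw [pow_succ, hN, Ideal.bot_mul]
  have h1 : ∀ x : R, x - 1 ∈ I → (x ^ r) ^ k = x := by
    intro x hx
    rw [← pow_mul, hk, pow_succ, pow_mul, pow_prime_pow_eq_one hp hN' hx, one_pow, one_mul]
  have h2 : s ^ r = s' ^ r := by
    calc s ^ r = s ^ r * (s' ^ r * a) := by rw [h', mul_one]
      _ = s' ^ r * (s ^ r * a) := by ring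
      _ = s' ^ r := by rw [h, mul_one]
  rw [← h1 s hs, h2, h1 s' hs']

end Roots

/-! ### Roots over complete local rings -/

section RootLimit

variable {n : ℕ} {R : Type*} [CommRing R]

theorem matIn_sub_iff {I : Ideal R} {X Y : Matrix (Fin n) (Fin n) R} :
    MatIn I (X - Y) ↔
      (Ideal.Quotient.mk I).mapMatrix X = (Ideal.Quotient.mk I).mapMatrix Y := by
  constructor
  · intro h
    ext i j
    exact Ideal.Quotient.eq.mpr (h i j)
  · intro h i j
    exact Ideal.Quotient.eq.mp (congrFun (congrFun h i) j)

theorem matIn_of_forall_pow [IsLocalRing R] [IsHausdorff (maximalIdeal R) R]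
    {X : Matrix (Fin n) (Fin n) R}
    (h : ∀ i, MatIn (maximalIdeal R ^ i) X) : X = 0 := by
  ext a b
  refine IsHausdorff.haus' (I := maximalIdeal R) _ fun i => ?_
  rw [SModEq.zero, smul_eq_mul, Ideal.mul_top]
  exact h i a b

/-- Roots of matrices congruent to one over a complete local ring, as limits of powers. -/
theorem exists_root_limit [IsLocalRing R] [IsAdicComplete (maximalIdeal R) R] {p : ℕ}
    (hp : (p : R) ∈ maximalIdeal R) (hp1 : 1 < p) {r : ℕ} (hr : r.Coprime p)
    {u : Matrix (Fin n) (Fin n) R} (hu : MatIn (maximalIdeal R) (u - 1)) :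
    ∃ b : Matrix (Fin n) (Fin n) R, MatIn (maximalIdeal R) (b - 1) ∧ b ^ r = u ∧
      ∀ i, ∃ j : ℕ, MatIn (maximalIdeal R ^ i) (b - u ^ j) := by
  -- `s k` inverts `r` modulo `p ^ (k + 1)`, so `u ^ s k` is an `r`-th root of `u` modulo the `k`-th
  -- power of the maximal ideal. These powers form a Cauchy sequence, and the limit inherits every
  -- closed property shared by the powers of `u`.
  choose s j hsj using exists_mul_eq_prime_pow_mul_add_one hr hp1
  let Φ : ∀ i, Matrix (Fin n) (Fin n) R →+* Matrix (Fin n) (Fin n) (R ⧸ maximalIdeal R ^ i) :=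
    fun i => (Ideal.Quotient.mk (maximalIdeal R ^ i)).mapMatrix
  have h1 : ∀ i k, i ≤ k → Φ i u ^ (r * s k) = Φ i u := by
    intro i k hik
    have h2 : Φ i (u ^ p ^ (k + 1)) = 1 := by
      have := (hu.pow_prime_pow_sub_one hp (k + 1)).mono
        (Ideal.pow_le_pow_right (show i ≤ k + 1 + 1 by omega))
      rw [matIn_sub_iff] at this
      exact this.trans (map_one _)
    rw [hsj, pow_succ, pow_mul, ← map_pow, h2, one_pow, one_mul]
  have h3 : ∀ i k, i ≤ k → Φ i u ^ s i = Φ i u ^ s k := by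
    intro i k hik
    calc Φ i u ^ s i = (Φ i u ^ (r * s k)) ^ s i := by rw [h1 i k hik]
      _ = (Φ i u ^ (r * s i)) ^ s k := by rw [← pow_mul, ← pow_mul]; congr 1; ring
      _ = _ := by rw [h1 i i le_rfl]
  have h4 : ∀ a b {i k : ℕ}, i ≤ k → (u ^ s i) a b ≡ (u ^ s k) a b
      [SMOD (maximalIdeal R ^ i • ⊤ : Submodule R R)] := by
    intro a b i k hik
    have : MatIn (maximalIdeal R ^ i) (u ^ s i - u ^ s k) := by
      rw [matIn_sub_iff]
      rw [map_pow, map_pow]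
      exact h3 i k hik
    rw [SModEq.sub_mem, smul_eq_mul, Ideal.mul_top]
    exact this a b
  choose L hL using fun a b => IsPrecomplete.prec' (I := maximalIdeal R) _ (fun {_ _} => h4 a b)
  let b : Matrix (Fin n) (Fin n) R := Matrix.of L
  have hb : ∀ i, MatIn (maximalIdeal R ^ i) (b - u ^ s i) := by
    intro i a c
    have := (hL a c i).symm
    rwa [SModEq.sub_mem, smul_eq_mul, Ideal.mul_top] at this
  refine ⟨b, ?_, ?_, fun i => ⟨s i, hb i⟩⟩
  · have h5 := hb 1
    rw [pow_one] at h5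
    have := h5.add (hu.pow_sub_one (s 1))
    rwa [sub_add_sub_cancel] at this
  · rw [← sub_eq_zero]
    refine matIn_of_forall_pow fun i => ?_
    rw [matIn_sub_iff]
    have h6 := matIn_sub_iff.mp (hb i)
    rw [map_pow, h6, map_pow, ← pow_mul, mul_comm]
    exact h1 i i le_rfl

theorem exists_scalar_root_limit [IsLocalRing R] [IsAdicComplete (maximalIdeal R) R] {p : ℕ}
    (hp : (p : R) ∈ maximalIdeal R) (hp1 : 1 < p) {r : ℕ} (hr : r.Coprime p)
    {a : R} (ha : a - 1 ∈ maximalIdeal R) :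
    ∃ s : R, s - 1 ∈ maximalIdeal R ∧ s ^ r = a := by
  obtain ⟨b, hb, hbr, -⟩ := exists_root_limit hp hp1 hr (MatIn.smul_one_sub_one (n := 1) ha)
  refine ⟨b.det, hb.det_sub_one_mem, ?_⟩
  rw [← det_pow, hbr]
  simp

end RootLimit

/-! ## The adjoint involution -/

section Adjoint

variable {n : ℕ} {R : Type*} [CommRing R]

/-- `J` is the matrix of a perfect `ε`-symmetric pairing, with `J² = ε`. -/
structure IsForm (ε : R) (J : Matrix (Fin n) (Fin n) R) : Prop where
  sq : ε * ε = 1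
  transpose : Jᵀ = ε • J
  mul_self : J * J = ε • 1

/-- The adjoint of `X` with respect to the pairing `J`. -/
def adj (ε : R) (J X : Matrix (Fin n) (Fin n) R) : Matrix (Fin n) (Fin n) R := ε • (J * Xᵀ * J)

variable {ε : R} {J : Matrix (Fin n) (Fin n) R} (X Y : Matrix (Fin n) (Fin n) R)

theorem adj_add : adj ε J (X + Y) = adj ε J X + adj ε J Y := by
  simp [adj, Matrix.mul_add, Matrix.add_mul]

theorem adj_sub : adj ε J (X - Y) = adj ε J X - adj ε J Y := by
  simp [adj, Matrix.mul_sub, Matrix.sub_mul, smul_sub]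

theorem adj_smul (a : R) : adj ε J (a • X) = a • adj ε J X := by
  rw [adj, adj, transpose_smul, Matrix.mul_smul, Matrix.smul_mul, smul_comm]

theorem adj_map {S : Type*} [CommRing S] (f : R →+* S) :
    (adj ε J X).map f = adj (f ε) (J.map f) (X.map f) := by
  rw [adj, adj, ← Matrix.transpose_map, ← Matrix.map_mul, ← Matrix.map_mul]
  ext i j
  simp only [Matrix.map_apply, Matrix.smul_apply, smul_eq_mul, map_mul]

theorem MatIn.adj {I : Ideal R} {X : Matrix (Fin n) (Fin n) R} (hX : MatIn I X) :
    MatIn I (adj ε J X) :=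
  ((hX.transpose.mul_left _).mul_right _).smul _

namespace IsForm

variable (hJ : IsForm ε J)
include hJ

/-- Thus `J⁻¹ = ε J`, and the adjoint is `J⁻¹ Xᵀ J` written without an inverse. -/
theorem inv_mul : (ε • J) * J = 1 := by
  rw [Matrix.smul_mul, hJ.mul_self, smul_smul, hJ.sq, one_smul]

theorem adj_one : adj ε J 1 = 1 := by
  rw [adj, transpose_one, Matrix.mul_one, hJ.mul_self, smul_smul, hJ.sq, one_smul]

theorem adj_mul : adj ε J (X * Y) = adj ε J Y * adj ε J X := by
  simp only [adj, transpose_mul, Matrix.smul_mul, Matrix.mul_smul, smul_smul, hJ.sq, one_smul]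
  calc ε • (J * (Yᵀ * Xᵀ) * J) = J * Yᵀ * (ε • 1 : Matrix (Fin n) (Fin n) R) * Xᵀ * J := by
        simp only [Matrix.mul_smul, Matrix.smul_mul, Matrix.mul_one, Matrix.mul_assoc]
    _ = _ := by rw [← hJ.mul_self]; simp only [Matrix.mul_assoc]

theorem adj_adj : adj ε J (adj ε J X) = X := by
  rw [adj, adj, transpose_smul, transpose_mul, transpose_mul, transpose_transpose, hJ.transpose]
  simp only [Matrix.smul_mul, Matrix.mul_smul, smul_smul, hJ.sq, one_smul]
  have : J * (J * (X * J)) * J = (J * J) * X * (J * J) := by simp only [Matrix.mul_assoc]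
  rw [this, hJ.mul_self]
  simp [smul_smul, hJ.sq]

theorem adj_pow (k : ℕ) : adj ε J (X ^ k) = adj ε J X ^ k := by
  induction k with
  | zero => simp [hJ.adj_one]
  | succ k ih => rw [pow_succ, hJ.adj_mul, ih, pow_succ']

/-- Multiplication by the invertible matrix `ε J` turns conditions on the Gram matrix into
conditions on the involution, which is an anti-automorphism and easier to compute with. -/
theorem transpose_mul_mul_iff {X Y : Matrix (Fin n) (Fin n) R} {c : R} :
    Xᵀ * J * Y = c • J ↔ adj ε J X * Y = c • 1 := by
  have h1 := hJ.inv_mul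
  have h2 : J * (ε • J) = 1 := mul_eq_one_comm.mp h1
  have h3 : adj ε J X * Y = (ε • J) * (Xᵀ * J * Y) := by
    simp only [adj, Matrix.smul_mul, Matrix.mul_assoc]
  rw [h3]
  constructor
  · intro h
    rw [h, Matrix.mul_smul, h1]
  · intro h
    calc Xᵀ * J * Y = (J * (ε • J)) * (Xᵀ * J * Y) := by rw [h2, Matrix.one_mul]
      _ = J * ((ε • J) * (Xᵀ * J * Y)) := by rw [Matrix.mul_assoc]
      _ = _ := by rw [h, Matrix.mul_smul, Matrix.mul_one]

theorem transpose_mul_add_iff {X : Matrix (Fin n) (Fin n) R} {a : R} :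
    Xᵀ * J + J * X = a • J ↔ adj ε J X + X = a • 1 := by
  have h1 := hJ.inv_mul
  have h2 : J * (ε • J) = 1 := mul_eq_one_comm.mp h1
  have h3 : adj ε J X + X = (ε • J) * (Xᵀ * J + J * X) := by
    rw [Matrix.mul_add, ← Matrix.mul_assoc (ε • J) J X, h1, Matrix.one_mul]
    simp only [adj, Matrix.smul_mul, Matrix.mul_assoc]
  rw [h3]
  constructor
  · intro h
    rw [h, Matrix.mul_smul, h1]
  · intro h
    calc Xᵀ * J + J * X = (J * (ε • J)) * (Xᵀ * J + J * X) := by rw [h2, Matrix.one_mul]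
      _ = J * ((ε • J) * (Xᵀ * J + J * X)) := by rw [Matrix.mul_assoc]
      _ = _ := by rw [h, Matrix.mul_smul, Matrix.mul_one]

theorem det_adj : (adj ε J X).det = X.det := by
  have h := congrArg Matrix.det hJ.inv_mul
  rw [det_mul, det_one] at h
  rw [adj, ← Matrix.smul_mul, ← Matrix.smul_mul, det_mul, det_mul, det_transpose]
  linear_combination X.det * h

theorem trace_adj : (adj ε J X).trace = X.trace := by
  rw [adj, trace_smul, trace_mul_comm, ← Matrix.mul_assoc, hJ.mul_self, Matrix.smul_mul,
    Matrix.one_mul, trace_smul, smul_smul, hJ.sq, one_smul, trace_transpose]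

end IsForm

theorem stdSym_isForm : IsForm (1 : R) (stdSym n R) where
  sq := one_mul _
  transpose := by
    rw [one_smul]
    ext i j
    simp only [stdSym, transpose_apply, of_apply]
    exact if_congr (by omega) rfl rfl
  mul_self := by
    rw [one_smul]
    ext i j
    rw [Matrix.mul_apply, Finset.sum_eq_single i.rev]
    · simp only [stdSym, of_apply, Fin.val_rev, one_apply, Fin.ext_iff]
      rw [if_pos (by omega), one_mul]
      exact if_congr (by omega) rfl rfl
    · intro b _ hb
      rw [stdSym, of_apply, if_neg, zero_mul]
      intro h
      exact hb (Fin.ext (by rw [Fin.val_rev]; omega))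
    · simp

theorem stdAlt_isForm (hn : Even n) : IsForm (-1 : R) (stdAlt n R) where
  sq := by ring
  transpose := by
    obtain ⟨m, rfl⟩ := hn
    ext i j
    simp only [stdAlt, transpose_apply, of_apply, Matrix.smul_apply, smul_eq_mul]
    split_ifs <;> first | omega | simp
  mul_self := by
    obtain ⟨m, rfl⟩ := hn
    ext i j
    rw [Matrix.mul_apply, Finset.sum_eq_single i.rev]
    · simp only [stdAlt, of_apply, Fin.val_rev, one_apply, Fin.ext_iff, Matrix.smul_apply,
        smul_eq_mul]
      rw [if_pos (by omega)]
      split_ifs <;> first | omega | simp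
    · intro b _ hb
      rw [stdAlt, of_apply, if_neg, zero_mul]
      intro h
      exact hb (Fin.ext (by rw [Fin.val_rev]; omega))
    · simp

end Adjoint

/-! ### Cancelling units, and commutators to first order -/

section UnitHelpers

variable {n : ℕ} {R : Type*} [CommRing R] {I : Ideal R}

theorem MatIn.of_mul_isUnit {X U : Matrix (Fin n) (Fin n) R} (hU : IsUnit U)
    (h : MatIn I (X * U)) : MatIn I X := by
  obtain ⟨V, rfl⟩ := hU
  have := h.mul_right ((V⁻¹ : (Matrix (Fin n) (Fin n) R)ˣ) : Matrix (Fin n) (Fin n) R)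
  rwa [Matrix.mul_assoc, ← Units.val_mul, mul_inv_cancel, Units.val_one, Matrix.mul_one] at this

theorem MatIn.of_isUnit_mul {X U : Matrix (Fin n) (Fin n) R} (hU : IsUnit U)
    (h : MatIn I (U * X)) : MatIn I X := by
  obtain ⟨V, rfl⟩ := hU
  have := h.mul_left ((V⁻¹ : (Matrix (Fin n) (Fin n) R)ˣ) : Matrix (Fin n) (Fin n) R)
  rwa [← Matrix.mul_assoc, ← Units.val_mul, inv_mul_cancel, Units.val_one, Matrix.one_mul] at this

/-- Since `h - 1` commutes with `N`, the commutator of `a Y` with `N` is, up to sign, that of the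
error `h - 1 - a Y`. -/
theorem commutator_mem_of_sub_mem {h Y N : Matrix (Fin n) (Fin n) R} {a : R}
    (ha : IsUnit a) (h1 : MatIn I (h - 1 - a • Y)) (hN : h * N = N * h) :
    MatIn I (Y * N - N * Y) := by
  refine MatIn.of_smul ha ?_
  have : a • (Y * N - N * Y) = N * (h - 1 - a • Y) - (h - 1 - a • Y) * N := by
    simp only [Matrix.mul_sub, Matrix.sub_mul, Matrix.mul_one, Matrix.one_mul, hN, smul_sub,
      Matrix.mul_smul, Matrix.smul_mul]
    abel
  rw [this]
  exact (h1.mul_left _).sub (h1.mul_right _)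

end UnitHelpers

/-! ## The Cayley transform -/

section Cayley

variable {n : ℕ} {A : Type*} [CommRing A] [IsLocalRing A]

/-- The Cayley transform `(1 + X) (1 - X)⁻¹`. -/
def cayley (X : Matrix (Fin n) (Fin n) A) : Matrix (Fin n) (Fin n) A := (1 + X) * (1 - X)⁻¹

variable {X Y g : Matrix (Fin n) (Fin n) A}

theorem isUnit_one_sub (hX : MatIn (maximalIdeal A) X) : IsUnit (1 - X) := by
  refine MatIn.isUnit ?_
  rw [sub_sub_cancel_left]
  exact hX.neg

theorem isUnit_one_add (hX : MatIn (maximalIdeal A) X) : IsUnit (1 + X) := by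
  refine MatIn.isUnit ?_
  rwa [add_sub_cancel_left]

/-- Half of `g + 1` is congruent to the identity. -/
theorem isUnit_add_one (h2 : IsUnit (2 : A)) (hg : MatIn (maximalIdeal A) (g - 1)) :
    IsUnit (g + 1) := by
  have h : IsUnit ((h2.unit⁻¹ : Aˣ) • (g + 1)) := by
    refine MatIn.isUnit ?_
    have : (h2.unit⁻¹ : Aˣ) • (g + 1) - 1 = ((h2.unit⁻¹ : Aˣ) : A) • (g - 1) := by
      have h3 : ((h2.unit⁻¹ : Aˣ) : A) * 2 = 1 := h2.val_inv_mul
      have h4 : (1 : Matrix (Fin n) (Fin n) A) = (((h2.unit⁻¹ : Aˣ) : A) * 2) • 1 := by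
        rw [h3, one_smul]
      rw [Units.smul_def]
      nth_rewrite 2 [h4]
      rw [mul_smul, ← smul_sub]
      congr 1
      rw [two_smul]
      abel
    rw [this]
    exact hg.smul _
  have := h.smul h2.unit
  rwa [smul_inv_smul] at this

theorem cayley_mul (hX : MatIn (maximalIdeal A) X) : cayley X * (1 - X) = 1 + X := by
  rw [cayley, Matrix.mul_assoc,
    nonsing_inv_mul _ ((isUnit_iff_isUnit_det _).mp (isUnit_one_sub hX)), Matrix.mul_one]

theorem cayley_unique (hX : MatIn (maximalIdeal A) X) (h : g * (1 - X) = 1 + X) :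
    g = cayley X :=
  (isUnit_one_sub hX).mul_left_injective (h.trans (cayley_mul hX).symm)

/-- For fixed `g` this equation is linear in `X`, and it determines `X` once `g + 1` is invertible;
it replaces the inverse transform below. -/
theorem cayley_add_one_mul (hX : MatIn (maximalIdeal A) X) :
    (cayley X + 1) * X = cayley X - 1 := by
  have := cayley_mul hX
  rw [Matrix.mul_sub, Matrix.mul_one, sub_eq_iff_eq_add] at this
  rw [Matrix.add_mul, Matrix.one_mul]
  nth_rewrite 2 [this]
  abel

theorem cayley_sub_one (hX : MatIn (maximalIdeal A) X) : MatIn (maximalIdeal A) (cayley X - 1) := by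
  refine MatIn.of_mul_isUnit (isUnit_one_sub hX) ?_
  rw [Matrix.sub_mul, cayley_mul hX, Matrix.one_mul]
  have : 1 + X - (1 - X) = X + X := by abel
  rw [this]
  exact hX.add hX

theorem eq_cayley_of_add_one_mul (hX : MatIn (maximalIdeal A) X)
    (h : (g + 1) * X = g - 1) : g = cayley X := by
  refine cayley_unique hX ?_
  rw [Matrix.add_mul, Matrix.one_mul] at h
  have : g = g * X + X + 1 := by rw [h]; abel
  rw [Matrix.mul_sub, Matrix.mul_one]
  nth_rewrite 1 [this]
  abel

theorem cayley_injOn (h2 : IsUnit (2 : A)) (hX : MatIn (maximalIdeal A) X)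
    (hY : MatIn (maximalIdeal A) Y) (h : cayley X = cayley Y) : X = Y := by
  have h1 := cayley_add_one_mul hX
  have h3 := cayley_add_one_mul hY
  rw [← h] at h3
  exact (isUnit_add_one h2 (cayley_sub_one hX)).mul_right_injective (h1.trans h3.symm)

theorem exists_cayley_eq (h2 : IsUnit (2 : A)) (hg : MatIn (maximalIdeal A) (g - 1)) :
    ∃ X, MatIn (maximalIdeal A) X ∧ (g + 1) * X = g - 1 ∧ cayley X = g := by
  obtain ⟨U, hU⟩ := isUnit_add_one h2 hg
  set V : Matrix (Fin n) (Fin n) A := ((U⁻¹ : (Matrix (Fin n) (Fin n) A)ˣ) : Matrix (Fin n) (Fin n) A)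
  have hUV : (g + 1) * V = 1 := by rw [← hU, ← Units.val_mul, mul_inv_cancel, Units.val_one]
  have hX : MatIn (maximalIdeal A) (V * (g - 1)) := hg.mul_left _
  have h : (g + 1) * (V * (g - 1)) = g - 1 := by rw [← Matrix.mul_assoc, hUV, Matrix.one_mul]
  exact ⟨V * (g - 1), hX, h, (eq_cayley_of_add_one_mul hX h).symm⟩

theorem cayley_map {B : Type*} [CommRing B] [IsLocalRing B] (f : A →+* B)
    (hf : ∀ a ∈ maximalIdeal A, f a ∈ maximalIdeal B) (hX : MatIn (maximalIdeal A) X) :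
    (cayley X).map f = cayley (X.map f) := by
  refine cayley_unique (hX.map f hf) ?_
  have := congrArg f.mapMatrix (cayley_mul hX)
  rw [map_mul, map_sub, map_add, map_one] at this
  exact this

/-- Each of `X` and `cayley X` is a rational expression in the other with invertible denominator, so
they commute with the same matrices. This makes the transform compatible with centralizers. -/
theorem cayley_commute (h2 : IsUnit (2 : A)) (hX : MatIn (maximalIdeal A) X)
    (N : Matrix (Fin n) (Fin n) A) : cayley X * N = N * cayley X ↔ X * N = N * X := by
  set g := cayley X with hg
  constructor
  · intro h
    refine (isUnit_add_one h2 (cayley_sub_one hX)).mul_right_injective ?_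
    have e := cayley_add_one_mul hX
    change (g + 1) * (X * N) = (g + 1) * (N * X)
    calc (g + 1) * (X * N) = (g + 1) * X * N := (Matrix.mul_assoc _ _ _).symm
      _ = N * (g - 1) := by
        rw [e, Matrix.sub_mul, Matrix.mul_sub, h, Matrix.one_mul, Matrix.mul_one]
      _ = N * (g + 1) * X := by rw [← e, Matrix.mul_assoc]
      _ = (g + 1) * N * X := by
        rw [Matrix.mul_add, Matrix.add_mul _ _ N, h, Matrix.one_mul, Matrix.mul_one]
      _ = _ := Matrix.mul_assoc _ _ _
  · intro h
    refine (isUnit_one_sub hX).mul_left_injective ?_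
    have e := cayley_mul hX
    change g * N * (1 - X) = N * g * (1 - X)
    calc g * N * (1 - X) = g * (1 - X) * N := by
          rw [Matrix.mul_assoc, Matrix.mul_assoc, Matrix.mul_sub, Matrix.sub_mul, h,
            Matrix.mul_one, Matrix.one_mul]
      _ = N * (1 + X) := by
        rw [e, Matrix.add_mul, Matrix.mul_add, h, Matrix.mul_one, Matrix.one_mul]
      _ = _ := by rw [← e, Matrix.mul_assoc]

/-- Subtracting the linear equations of the two transforms gives `(g + 1) (Y - X) = g (h - 1) (1 -
Y)`. As `g` reduces to `1` and `Y` to `0`, the difference of `h - 1` and `2 (Y - X)` lies one order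
deeper; since `h` commutes with `N`, so does the commutator of `Y - X` with `N`. -/
theorem cayley_commutator (h2 : IsUnit (2 : A)) {i : ℕ} (hX : MatIn (maximalIdeal A) X)
    (hY : MatIn (maximalIdeal A) Y) (hXY : MatIn (maximalIdeal A ^ i) (Y - X))
    {N h : Matrix (Fin n) (Fin n) A} (hh : cayley X * h = cayley Y) (hN : h * N = N * h) :
    MatIn (maximalIdeal A ^ (i + 1)) ((Y - X) * N - N * (Y - X)) := by
  set g := cayley X with hg
  have e1 : (g + 1) * X = g - 1 := cayley_add_one_mul hX
  have e2 : (g * h + 1) * Y = g * h - 1 := hh ▸ cayley_add_one_mul hY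
  have hgm : MatIn (maximalIdeal A) (g - 1) := cayley_sub_one hX
  have key : (g + 1) * (Y - X) = g * (h - 1) * (1 - Y) := by
    have : (g + 1) * (Y - X) - g * (h - 1) * (1 - Y) =
      ((g * h + 1) * Y - (g * h - 1)) - ((g + 1) * X - (g - 1)) := by noncomm_ring
    rw [← sub_eq_zero, this, e1, e2]
    simp
  have hh1 : MatIn (maximalIdeal A ^ i) (h - 1) := by
    refine MatIn.of_isUnit_mul hgm.isUnit (MatIn.of_mul_isUnit (isUnit_one_sub hY) ?_)
    rw [← key]
    exact hXY.mul_left _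
  refine commutator_mem_of_sub_mem h2 ?_ hN
  have : h - 1 - (2 : A) • (Y - X) =
      (g - 1) * (Y - X) - (g - 1) * (h - 1) * (1 - Y) + (h - 1) * Y := by
    have e3 : g * (h - 1) * (1 - Y) - (g + 1) * (Y - X) = 0 := by rw [key, sub_self]
    have e4 : h - 1 - (Y - X + (Y - X)) -
      ((g - 1) * (Y - X) - (g - 1) * (h - 1) * (1 - Y) + (h - 1) * Y) =
      g * (h - 1) * (1 - Y) - (g + 1) * (Y - X) := by noncomm_ring
    rw [two_smul, ← sub_eq_zero, e4, e3]
  rw [this, pow_succ']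
  refine ((hgm.mul hXY).sub ((hgm.mul hh1).mul_right _)).add ?_
  rw [mul_comm]
  exact hh1.mul hY

/-- The involution exchanges `1 + X` and `1 - X` when `X` is skew, hence inverts their quotient. -/
theorem cayley_isometry {ε : A} {J : Matrix (Fin n) (Fin n) A} (hJ : IsForm ε J)
    (hX : MatIn (maximalIdeal A) X) (hX' : adj ε J X = -X) :
    adj ε J (cayley X) * cayley X = 1 := by
  have e1 := cayley_mul hX
  have e2 := congrArg (adj ε J) e1
  rw [hJ.adj_mul, adj_sub, adj_add, hJ.adj_one, hX', sub_neg_eq_add, ← sub_eq_add_neg] at e2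
  refine (isUnit_one_sub hX).mul_left_injective ((isUnit_one_add hX).mul_right_injective ?_)
  change (1 + X) * (adj ε J (cayley X) * cayley X * (1 - X)) = (1 + X) * (1 * (1 - X))
  rw [Matrix.mul_assoc, e1, ← Matrix.mul_assoc, e2]
  noncomm_ring

theorem adj_eq_neg_of_isometry {ε : A} {J : Matrix (Fin n) (Fin n) A} (hJ : IsForm ε J)
    (h2 : IsUnit (2 : A)) (hg : MatIn (maximalIdeal A) (g - 1)) (hgi : adj ε J g * g = 1)
    (hgX : (g + 1) * X = g - 1) (hX : MatIn (maximalIdeal A) X) : adj ε J X = -X := by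
  have h1 : g * adj ε J g = 1 := mul_eq_one_comm.mp hgi
  have hXg : X * (g + 1) = g - 1 := by
    have hc := (cayley_commute h2 hX g).mp (by rw [← eq_cayley_of_add_one_mul hX hgX])
    rw [← hgX, Matrix.mul_add, Matrix.add_mul, hc, Matrix.mul_one, Matrix.one_mul]
  have e := congrArg (adj ε J) hXg
  rw [hJ.adj_mul, adj_add, adj_sub, hJ.adj_one] at e
  have hu : IsUnit (adj ε J g + 1) := by
    refine isUnit_add_one h2 ?_
    have := hg.adj (ε := ε) (J := J)
    rwa [adj_sub, hJ.adj_one] at this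
  refine hu.mul_right_injective ((isUnit_add_one h2 hg).mul_left_injective ?_)
  change (adj ε J g + 1) * adj ε J X * (g + 1) = (adj ε J g + 1) * -X * (g + 1)
  rw [e, Matrix.mul_assoc, Matrix.neg_mul, hXg, Matrix.mul_neg]
  have h3 : (adj ε J g - 1) * (g + 1) + (adj ε J g + 1) * (g - 1) =
    adj ε J g * g + adj ε J g * g - (1 + 1) := by noncomm_ring
  rw [eq_neg_iff_add_eq_zero, h3, hgi, sub_self]

end Cayley

/-! ## The derived groups and their Lie algebras -/

section Families

variable {t : Family} {n : ℕ} {p : ℕ} {R : Type*} [CommRing R]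

/-- The Gram matrix of the pairing attached to the family (the identity matrix for `GL`). -/
def formMatrix (t : Family) (n : ℕ) (R : Type*) [CommRing R] : Matrix (Fin n) (Fin n) R :=
  match t with
  | .GL => 1
  | .GSp => stdAlt n R
  | .GO => stdSym n R

/-- The sign of the pairing attached to the family. -/
def formSign (t : Family) (R : Type*) [CommRing R] : R :=
  match t with
  | .GL => 1
  | .GSp => -1
  | .GO => 1

theorem formMatrix_isForm (h : t = .GSp → Even n) :
    IsForm (formSign t R) (formMatrix t n R) := by
  cases t
  · exact ⟨one_mul _, by simp [formMatrix, formSign], by simp [formMatrix, formSign]⟩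
  · exact stdAlt_isForm (h rfl)
  · exact stdSym_isForm

/-- The adjoint involution of the pairing attached to the family. -/
def star (t : Family) (X : Matrix (Fin n) (Fin n) R) : Matrix (Fin n) (Fin n) R :=
  adj (formSign t R) (formMatrix t n R) X

theorem star_map {S : Type*} [CommRing S] (f : R →+* S) (X : Matrix (Fin n) (Fin n) R) :
    (star t X).map f = star t (X.map f) := by
  rw [star, adj_map, star]
  congr 1
  · cases t <;> simp [formSign]
  · cases t
    · simp [formMatrix]
    · exact stdAlt_map n f
    · exact stdSym_map n f

/-- The Lie algebra of `G'`. -/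
def lieDerived (t : Family) (n : ℕ) (R : Type*) [CommRing R] :
    Submodule R (Matrix (Fin n) (Fin n) R) where
  carrier := {X | match t with
    | .GL => X.trace = 0
    | _ => star t X = -X}
  zero_mem' := by cases t <;> simp [star, adj]
  add_mem' := by
    intro X Y hX hY
    cases t
    · simp_all [trace_add]
    all_goals
      simp only [Set.mem_ofPred_eq] at hX hY ⊢
      rw [star] at hX hY ⊢
      rw [adj_add, hX, hY, neg_add]
  smul_mem' := by
    intro a X hX
    cases t
    · simp_all [trace_smul]
    all_goals
      simp only [Set.mem_ofPred_eq] at hX ⊢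
      rw [star] at hX ⊢
      rw [adj_smul, hX, smul_neg]

theorem mem_lieDerived_GL {X : Matrix (Fin n) (Fin n) R} :
    X ∈ lieDerived .GL n R ↔ X.trace = 0 := Iff.rfl

theorem mem_lieDerived (ht : t ≠ .GL) {X : Matrix (Fin n) (Fin n) R} :
    X ∈ lieDerived t n R ↔ star t X = -X := by
  cases t
  · exact absurd rfl ht
  · exact Iff.rfl
  · exact Iff.rfl

/-- The equations defining `SL_n`, `Sp_n` and `O_n`. -/
def IsIsom (t : Family) (g : Matrix (Fin n) (Fin n) R) : Prop :=
  match t with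
  | .GL => g.det = 1
  | _ => star t g * g = 1

theorem isIsom_iff (ht : t ≠ .GL) {g : Matrix (Fin n) (Fin n) R} :
    IsIsom t g ↔ star t g * g = 1 := by
  cases t
  · exact absurd rfl ht
  · exact Iff.rfl
  · exact Iff.rfl

theorem mem_G_iff (ht : t ≠ .GL) (h : t = .GSp → Even n) {g : GL (Fin n) R} :
    g ∈ G t n R ↔ ∃ c : Rˣ, star t (g : Matrix (Fin n) (Fin n) R) * g = (c : R) • 1 := by
  have hJ := formMatrix_isForm (R := R) h
  cases t
  · exact absurd rfl ht
  all_goals exact exists_congr fun c => hJ.transpose_mul_mul_iff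

theorem mem_lie_iff (ht : t ≠ .GL) (h : t = .GSp → Even n) {X : Matrix (Fin n) (Fin n) R} :
    X ∈ lie t n R ↔ ∃ a : R, star t X + X = a • 1 := by
  have hJ := formMatrix_isForm (R := R) h
  cases t
  · exact absurd rfl ht
  all_goals exact exists_congr fun c => hJ.transpose_mul_add_iff

theorem isIsom_of_mem_G' (h : t = .GSp → Even n) {g : G t n R} (hg : g ∈ G' t n R) :
    IsIsom t (mat g) := by
  have hJ := formMatrix_isForm (R := R) h
  cases t
  · exact congrArg Units.val (MonoidHom.mem_ker.mp (Subgroup.mem_subgroupOf.mp hg))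
  · have h1 : (mat g)ᵀ * stdAlt n R * mat g = stdAlt n R := Subgroup.mem_subgroupOf.mp hg
    have := (hJ.transpose_mul_mul_iff (c := 1)).mp (h1.trans (one_smul _ _).symm)
    rwa [one_smul] at this
  · have h1 : (mat g)ᵀ * stdSym n R * mat g = stdSym n R := (Subgroup.mem_subgroupOf.mp hg).1
    have := (hJ.transpose_mul_mul_iff (c := 1)).mp (h1.trans (one_smul _ _).symm)
    rwa [one_smul] at this

theorem det_eq_one_of_mem_G' {g : G t n R} (ht : t ≠ .GSp) (hg : g ∈ G' t n R) :
    (mat g).det = 1 := by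
  cases t
  · exact congrArg Units.val (MonoidHom.mem_ker.mp (Subgroup.mem_subgroupOf.mp hg))
  · exact absurd rfl ht
  · exact congrArg Units.val (MonoidHom.mem_ker.mp (Subgroup.mem_subgroupOf.mp hg).2)

theorem mem_G'_of_isIsom (h : t = .GSp → Even n) {g : G t n R} (hg : IsIsom t (mat g))
    (hdet : t = .GO → (mat g).det = 1) : g ∈ G' t n R := by
  have hJ := formMatrix_isForm (R := R) h
  cases t
  · exact Subgroup.mem_subgroupOf.mpr (MonoidHom.mem_ker.mpr (Units.ext hg))
  · have := (hJ.transpose_mul_mul_iff (c := 1)).mpr (hg.trans (one_smul _ _).symm)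
    exact Subgroup.mem_subgroupOf.mpr (this.trans (one_smul _ _))
  · have := (hJ.transpose_mul_mul_iff (c := 1)).mpr (hg.trans (one_smul _ _).symm)
    exact Subgroup.mem_subgroupOf.mpr
      ⟨this.trans (one_smul _ _), MonoidHom.mem_ker.mpr (Units.ext (hdet rfl))⟩

theorem exists_G_of_isIsom (h : t = .GSp → Even n) {g : Matrix (Fin n) (Fin n) R}
    (hg : IsIsom t g) : ∃ g' : G t n R, mat g' = g := by
  by_cases ht : t = .GL
  · subst ht
    have hu : IsUnit g := by
      rw [isUnit_iff_isUnit_det, show g.det = 1 from hg]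
      exact isUnit_one
    exact ⟨⟨hu.unit, Subgroup.mem_top _⟩, rfl⟩
  · have h1 := (isIsom_iff ht).mp hg
    have hu : IsUnit g := ⟨⟨g, star t g, mul_eq_one_comm.mp h1, h1⟩, rfl⟩
    exact ⟨⟨hu.unit, (mem_G_iff ht h).mpr ⟨1, by simpa using h1⟩⟩, rfl⟩

theorem star_mul_similitude (h : t = .GSp → Even n) {a b : Matrix (Fin n) (Fin n) R} {c d : R}
    (ha : star t a * a = c • 1) (hb : star t b * b = d • 1) :
    star t (a * b) * (a * b) = (c * d) • 1 := by
  have e : star t (a * b) = star t b * star t a := (formMatrix_isForm h).adj_mul a b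
  rw [e, Matrix.mul_assoc, ← Matrix.mul_assoc (star t a), ha, Matrix.smul_mul, Matrix.one_mul,
    Matrix.mul_smul, hb, smul_smul]

theorem star_one (h : t = .GSp → Even n) : star t (1 : Matrix (Fin n) (Fin n) R) = 1 :=
  (formMatrix_isForm h).adj_one

/-- The quotient `S = G / G'` is commutative. -/
theorem mk_conj (h : t = .GSp → Even n) (g x : G t n R) :
    (QuotientGroup.mk (g * x * g⁻¹) : S t n R) = QuotientGroup.mk x := by
  -- The element in question is a commutator, so its determinant is one in a commutative ring; this
  -- also settles the extra determinant condition in the orthogonal case.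
  have hdet : (mat ((g * x * g⁻¹)⁻¹ * x)).det = 1 := by
    have hc : ∀ u v : Rˣ, (u * v * u⁻¹)⁻¹ * v = 1 := fun u v => by
      rw [mul_right_comm, mul_inv_cancel, one_mul, inv_mul_cancel]
    have : Matrix.GeneralLinearGroup.det (((g * x * g⁻¹)⁻¹ * x : G t n R) : GL (Fin n) R) = 1 := by
      simp only [Subgroup.coe_mul, Subgroup.coe_inv, map_mul, map_inv]
      exact hc _ _
    exact congrArg Units.val this
  refine QuotientGroup.eq.mpr (mem_G'_of_isIsom h ?_ fun _ => hdet)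
  by_cases ht : t = .GL
  · subst ht
    exact hdet
  · rw [isIsom_iff ht]
    -- Multipliers are multiplicative, and those of an element and its inverse cancel. The
    -- cancellation is kept as an identity between scalar matrices, which needs no assumption on
    -- `n`.
    obtain ⟨c, hc⟩ := (mem_G_iff ht h).mp g.2
    obtain ⟨c', hc'⟩ := (mem_G_iff ht h).mp (g⁻¹).2
    obtain ⟨d, hd⟩ := (mem_G_iff ht h).mp x.2
    obtain ⟨d', hd'⟩ := (mem_G_iff ht h).mp (x⁻¹).2
    have e1 := star_mul_similitude h hc hc'
    have e2 := star_mul_similitude h hd hd'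
    have e : ∀ y : G t n R, mat y * mat y⁻¹ = 1 := fun y => congrArg Units.val (mul_inv_cancel y.1)
    have e1' : ((c : R) * c') • (1 : Matrix (Fin n) (Fin n) R) = 1 := by
      rw [← e1]; erw [e g]; rw [star_one h, Matrix.one_mul]
    have e2' : ((d : R) * d') • (1 : Matrix (Fin n) (Fin n) R) = 1 := by
      rw [← e2]; erw [e x]; rw [star_one h, Matrix.one_mul]
    have e3 := star_mul_similitude h (star_mul_similitude h (star_mul_similitude h hc hd') hc') hd
    have e4 : mat ((g * x * g⁻¹)⁻¹ * x) = mat g * mat x⁻¹ * mat g⁻¹ * mat x := by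
      rw [show (g * x * g⁻¹)⁻¹ * x = g * x⁻¹ * g⁻¹ * x by group]
      rfl
    rw [e4]
    refine e3.trans ?_
    rw [show (c : R) * d' * c' * d = (c * c') * (d * d') by ring, mul_smul, e2', e1']

end Families

/-! ## Standing hypotheses -/

/-- The numerical hypotheses on the family, the rank and the residue characteristic. -/
structure Admissible (t : Family) (n p : ℕ) (A : Type*) [CommRing A] [IsLocalRing A] : Prop where
  prime : p.Prime
  mem : (p : A) ∈ maximalIdeal A
  one_le : 1 ≤ n
  lt : n < p
  even : t = .GSp → Even n
  ne_two : t ≠ .GL → p ≠ 2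

namespace Admissible

variable {t : Family} {n p : ℕ} {A : Type*} [CommRing A] [IsLocalRing A]

theorem isUnit_natCast (h : Admissible t n p A) {r : ℕ} (hr : r.Coprime p) : IsUnit (r : A) := by
  by_contra hu
  have h1 : (r : A) ∈ maximalIdeal A := hu
  obtain ⟨a, b, hab⟩ := (Nat.isCoprime_iff_coprime.mpr hr)
  have h2 : ((a * r + b * p : ℤ) : A) ∈ maximalIdeal A := by
    push_cast
    exact add_mem (Ideal.mul_mem_left _ _ h1) (Ideal.mul_mem_left _ _ h.mem)
  rw [hab, Int.cast_one] at h2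
  exact (Ideal.ne_top_iff_one _).mp (maximalIdeal.isMaximal A).ne_top h2

theorem coprime_of_lt (h : Admissible t n p A) {r : ℕ} (h0 : 0 < r) (hr : r < p) : r.Coprime p :=
  ((Nat.Prime.coprime_iff_not_dvd h.prime).mpr (Nat.not_dvd_of_pos_of_lt h0 hr)).symm

theorem coprime (h : Admissible t n p A) : n.Coprime p := h.coprime_of_lt h.one_le h.lt

theorem isUnit_n (h : Admissible t n p A) : IsUnit (n : A) := h.isUnit_natCast h.coprime

theorem coprime_two (h : Admissible t n p A) (ht : t ≠ .GL) : (2 : ℕ).Coprime p :=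
  (Nat.coprime_primes Nat.prime_two h.prime).mpr (h.ne_two ht).symm

theorem isUnit_two (h : Admissible t n p A) (ht : t ≠ .GL) : IsUnit (2 : A) := by
  exact_mod_cast h.isUnit_natCast (h.coprime_two ht)

theorem isUnit_factorial (h : Admissible t n p A) (i : ℕ) (hi : i < n) :
    IsUnit ((i.factorial : ℕ) : A) :=
  h.isUnit_natCast ((Nat.Prime.coprime_iff_not_dvd h.prime).mpr fun hd =>
    absurd ((h.prime.dvd_factorial).mp hd) (by have := h.lt; omega)).symm

theorem map (h : Admissible t n p A) {B : Type*} [CommRing B] [IsLocalRing B] (f : A →+* B)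
    [IsLocalHom f] : Admissible t n p B :=
  ⟨h.prime, by
    rw [← map_natCast f]
    exact fun hu => h.mem ((isUnit_map_iff f _).mp hu), h.one_le, h.lt,
    h.even, h.ne_two⟩

end Admissible

/-! ## A chart of the formal group of `G'` at the identity -/

section Chart

variable {O : Type u} [CommRing O] [IsLocalRing O] {t : Family} {n p : ℕ} {A B : ArtAlg O}

/-- The chart `X ↦ det(1 + X)^{-1/n} (1 + X)` of `SL_n`, and the Cayley transform for the other
families. -/
def chart (t : Family) (A : ArtAlg O) (X : Matrix (Fin n) (Fin n) A.carrier) :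
    Matrix (Fin n) (Fin n) A.carrier :=
  open Classical in
  match t with
  -- For `X` in the maximal ideal the scalar exists and is unique when `n` is prime to `p`, so the
  -- choice is harmless; `0` is a default for all other `X`.
  | .GL => if h : ∃ s : A.carrier, s - 1 ∈ maximalIdeal A.carrier ∧ s ^ n * (1 + X).det = 1
      then h.choose • (1 + X) else 0
  | _ => cayley X

theorem chart_of_ne (ht : t ≠ .GL) (X : Matrix (Fin n) (Fin n) A.carrier) :
    chart t A X = cayley X := by
  cases t
  · exact absurd rfl ht
  · rfl
  · rfl

variable {X Y g : Matrix (Fin n) (Fin n) A.carrier}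

theorem exists_chart_GL (h : Admissible .GL n p A.carrier)
    (hX : MatIn (maximalIdeal A.carrier) X) :
    ∃ s : A.carrier, s - 1 ∈ maximalIdeal A.carrier ∧ s ^ n * (1 + X).det = 1 ∧
      chart .GL A X = s • (1 + X) := by
  obtain ⟨N, hN⟩ := A.exists_pow_eq_bot
  have h1 : (1 + X).det - 1 ∈ maximalIdeal A.carrier := by
    refine MatIn.det_sub_one_mem ?_
    rwa [add_sub_cancel_left]
  have hs := exists_root h.mem h.prime.one_lt hN h.coprime h1
  refine ⟨hs.choose, hs.choose_spec.1, hs.choose_spec.2, ?_⟩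
  simp only [chart]
  rw [dif_pos hs]

/-- Uniqueness of roots frees the chart from the choice in its definition; this gives its naturality
in `A` and its explicit values. -/
theorem chart_GL_unique (h : Admissible .GL n p A.carrier)
    (hX : MatIn (maximalIdeal A.carrier) X) {s : A.carrier}
    (hs : s - 1 ∈ maximalIdeal A.carrier) (hd : (s • (1 + X)).det = 1) :
    chart .GL A X = s • (1 + X) := by
  obtain ⟨N, hN⟩ := A.exists_pow_eq_bot
  obtain ⟨s', h1, h2, h3⟩ := exists_chart_GL h hX
  rw [det_smul, Fintype.card_fin] at hd
  rw [h3, root_unique h.mem h.prime.one_lt hN h.coprime h1 hs h2 hd]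

theorem isUnit_of_sub_one_mem {R : Type*} [CommRing R] [IsLocalRing R] {s : R}
    (hs : s - 1 ∈ maximalIdeal R) : IsUnit s := by
  by_contra hu
  have : (1 : R) ∈ maximalIdeal R := by
    have h1 : s ∈ maximalIdeal R := hu
    simpa using sub_mem h1 hs
  exact (Ideal.ne_top_iff_one _).mp (maximalIdeal.isMaximal R).ne_top this

theorem isIsom_chart (h : Admissible t n p A.carrier) (hX : MatIn (maximalIdeal A.carrier) X)
    (hX' : X ∈ lieDerived t n A.carrier) : IsIsom t (chart t A X) := by
  by_cases ht : t = .GL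
  · subst ht
    obtain ⟨s, h1, h2, h3⟩ := exists_chart_GL h hX
    change (chart .GL A X).det = 1
    rw [h3, det_smul, Fintype.card_fin, h2]
  · rw [chart_of_ne ht, isIsom_iff ht]
    exact cayley_isometry (formMatrix_isForm h.even) hX ((mem_lieDerived ht).mp hX')

theorem chart_sub_one (h : Admissible t n p A.carrier) (hX : MatIn (maximalIdeal A.carrier) X) :
    MatIn (maximalIdeal A.carrier) (chart t A X - 1) := by
  by_cases ht : t = .GL
  · subst ht
    obtain ⟨s, h1, h2, h3⟩ := exists_chart_GL h hX
    have : s • (1 + X) - 1 = s • X + (s • 1 - 1) := by rw [smul_add]; abel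
    rw [h3, this]
    exact (hX.smul s).add (MatIn.smul_one_sub_one h1)
  · rw [chart_of_ne ht]
    exact cayley_sub_one hX

theorem exists_chart_eq (h : Admissible t n p A.carrier)
    (hg : MatIn (maximalIdeal A.carrier) (g - 1)) (hi : IsIsom t g) :
    ∃ X ∈ lieDerived t n A.carrier, MatIn (maximalIdeal A.carrier) X ∧ chart t A X = g := by
  by_cases ht : t = .GL
  · subst ht
    -- If `g = s (1 + X)` with `X` of trace zero, then the trace of `g` is `n s`. So `s` must be `ν`
    -- times the trace, with `ν = 1 / n`, and `X = w g - 1` with `w = s⁻¹`.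
    obtain ⟨ν, hν⟩ := h.isUnit_n.exists_left_inv
    have h1 : ν * g.trace - 1 ∈ maximalIdeal A.carrier := by
      have := Ideal.mul_mem_left _ ν hg.trace_mem
      rwa [trace_sub, trace_one, Fintype.card_fin, mul_sub, hν] at this
    obtain ⟨w, hw⟩ := (isUnit_of_sub_one_mem h1).exists_left_inv
    have hw1 : w - 1 ∈ maximalIdeal A.carrier := by
      have := Ideal.mul_mem_left _ (-w) h1
      convert this using 1
      linear_combination hw
    have hX : MatIn (maximalIdeal A.carrier) (w • g - 1) := by
      have : w • g - 1 = w • (g - 1) + (w • 1 - 1) := by rw [smul_sub]; abel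
      rw [this]
      exact (hg.smul w).add (MatIn.smul_one_sub_one hw1)
    have hs : (ν * g.trace) • (1 + (w • g - 1)) = g := by
      rw [add_sub_cancel, smul_smul, mul_comm, hw, one_smul]
    refine ⟨w • g - 1, ?_, hX, ?_⟩
    · rw [mem_lieDerived_GL, trace_sub, trace_smul, trace_one, Fintype.card_fin, smul_eq_mul]
      linear_combination (n : A.carrier) * hw - w * g.trace * hν
    · rw [chart_GL_unique h hX h1 (by rw [hs]; exact hi), hs]
  · obtain ⟨X, hX, hX1, hX2⟩ := exists_cayley_eq (h.isUnit_two ht) hg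
    refine ⟨X, (mem_lieDerived ht).mpr ?_, hX, by rwa [chart_of_ne ht]⟩
    exact adj_eq_neg_of_isometry (formMatrix_isForm h.even) (h.isUnit_two ht) hg
      ((isIsom_iff ht).mp hi) hX1 hX

theorem chart_injOn (h : Admissible t n p A.carrier) (hX : MatIn (maximalIdeal A.carrier) X)
    (hY : MatIn (maximalIdeal A.carrier) Y) (hX' : X ∈ lieDerived t n A.carrier)
    (hY' : Y ∈ lieDerived t n A.carrier) (hXY : chart t A X = chart t A Y) : X = Y := by
  by_cases ht : t = .GL
  · subst ht
    obtain ⟨s, h1, -, h3⟩ := exists_chart_GL h hX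
    obtain ⟨s', h1', -, h3'⟩ := exists_chart_GL h hY
    rw [h3, h3'] at hXY
    rw [mem_lieDerived_GL] at hX' hY'
    have h4 := congrArg Matrix.trace hXY
    rw [trace_smul, trace_smul, trace_add, trace_add, hX', hY', add_zero, trace_one,
      Fintype.card_fin, smul_eq_mul, smul_eq_mul] at h4
    rw [h.isUnit_n.mul_left_injective h4] at hXY
    obtain ⟨w, hw⟩ := (isUnit_of_sub_one_mem h1').exists_left_inv
    have h5 := congrArg (w • ·) hXY
    simp only [smul_smul, hw, one_smul] at h5
    exact add_left_cancel h5
  · rw [chart_of_ne ht, chart_of_ne ht] at hXY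
    exact cayley_injOn (h.isUnit_two ht) hX hY hXY

theorem chart_map (h : Admissible t n p A.carrier) (h' : Admissible t n p B.carrier)
    (f : A.carrier →ₐ[O] B.carrier) (hX : MatIn (maximalIdeal A.carrier) X) :
    (chart t A X).map f = chart t B (X.map f) := by
  have hm : ∀ a ∈ maximalIdeal A.carrier, f a ∈ maximalIdeal B.carrier :=
    fun a ha => ArtAlg.map_mem_maximalIdeal f ha
  by_cases ht : t = .GL
  · subst ht
    obtain ⟨s, h1, h2, h3⟩ := exists_chart_GL h hX
    have e : (s • (1 + X)).map f = f s • (1 + X.map f) := by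
      ext i j
      simp only [Matrix.map_apply, Matrix.smul_apply, Matrix.add_apply, smul_eq_mul, map_mul,
        map_add, Matrix.one_apply]
      split_ifs <;> simp
    have hs : f s - 1 ∈ maximalIdeal B.carrier := by
      rw [← map_one f, ← map_sub]
      exact hm _ h1
    rw [h3, e]
    refine (chart_GL_unique h' (hX.map f.toRingHom hm) hs ?_).symm
    change (f s • (1 + X.map f)).det = 1
    rw [show f s • (1 + X.map f) = f.toRingHom.mapMatrix (s • (1 + X)) from e.symm,
      ← RingHom.map_det, det_smul, Fintype.card_fin, h2, map_one]
  · rw [chart_of_ne ht, chart_of_ne ht]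
    exact cayley_map f.toRingHom hm hX

theorem chart_commute (h : Admissible t n p A.carrier) (hX : MatIn (maximalIdeal A.carrier) X)
    (N : Matrix (Fin n) (Fin n) A.carrier) :
    chart t A X * N = N * chart t A X ↔ X * N = N * X := by
  by_cases ht : t = .GL
  · subst ht
    obtain ⟨s, h1, -, h3⟩ := exists_chart_GL h hX
    obtain ⟨w, hw⟩ := (isUnit_of_sub_one_mem h1).exists_left_inv
    rw [h3, Matrix.smul_mul, Matrix.mul_smul, Matrix.add_mul, Matrix.mul_add, Matrix.one_mul,
      Matrix.mul_one]
    constructor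
    · intro h4
      have h5 := congrArg (w • ·) h4
      simp only [smul_smul, hw, one_smul] at h5
      exact add_left_cancel h5
    · intro h4
      rw [h4]
  · rw [chart_of_ne ht]
    exact cayley_commute (h.isUnit_two ht) hX N

/-- The contraction behind the uniqueness of parameters. For `SL_n`, a scalar multiple `z'` of `z`
satisfies `(1 + X) (z' - 1) = Y - X`, so `z' - 1` and `Y - X` agree to one more order, while `z'`
commutes with `N`. -/
theorem chart_commutator (h : Admissible t n p A.carrier) {i : ℕ}
    (hX : MatIn (maximalIdeal A.carrier) X) (hY : MatIn (maximalIdeal A.carrier) Y)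
    (hXY : MatIn (maximalIdeal A.carrier ^ i) (Y - X)) {N z : Matrix (Fin n) (Fin n) A.carrier}
    (hz : chart t A X * z = chart t A Y) (hN : z * N = N * z) :
    MatIn (maximalIdeal A.carrier ^ (i + 1)) ((Y - X) * N - N * (Y - X)) := by
  by_cases ht : t = .GL
  · subst ht
    obtain ⟨s, h1, -, h3⟩ := exists_chart_GL h hX
    obtain ⟨s', h1', -, h3'⟩ := exists_chart_GL h hY
    obtain ⟨w, hw⟩ := (isUnit_of_sub_one_mem h1').exists_left_inv
    rw [h3, h3'] at hz
    have e : (1 + X) * ((w * s) • z) = 1 + Y := by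
      have h5 := congrArg (w • ·) hz
      simp only [smul_smul, hw, one_smul] at h5
      rw [← h5, Matrix.mul_smul, Matrix.smul_mul, smul_smul]
    set z' := (w * s) • z
    have e1 : (1 + X) * (z' - 1) = Y - X := by
      rw [Matrix.mul_sub, e, Matrix.mul_one]; abel
    have e2 : MatIn (maximalIdeal A.carrier ^ i) (z' - 1) :=
      MatIn.of_isUnit_mul (isUnit_one_add hX) (by rwa [e1])
    refine commutator_mem_of_sub_mem (h := z') isUnit_one ?_ ?_
    · have : z' - 1 - (1 : A.carrier) • (Y - X) = -(X * (z' - 1)) := by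
        rw [one_smul, ← e1, Matrix.add_mul, Matrix.one_mul]; abel
      rw [this, pow_succ']
      exact (hX.mul e2).neg
    · rw [Matrix.smul_mul, Matrix.mul_smul, hN]
  · rw [chart_of_ne ht, chart_of_ne ht] at hz
    exact cayley_commutator (h.isUnit_two ht) hX hY hXY hz hN

/-- The determinant squares to one, and `det + 1` is a unit because it is congruent to `2`. So near
the identity `O_n` and `SO_n` coincide. -/
theorem det_eq_one_of_isometry {R : Type*} [CommRing R] [IsLocalRing R] (h : Admissible t n p R)
    (ht : t ≠ .GL) {g : Matrix (Fin n) (Fin n) R} (hg : g.det - 1 ∈ maximalIdeal R)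
    (hi : star t g * g = 1) : g.det = 1 := by
  have h1 := congrArg Matrix.det hi
  rw [det_mul, det_one, star, (formMatrix_isForm h.even).det_adj] at h1
  have h2 : IsUnit (g.det + 1) := by
    obtain ⟨w, hw⟩ := (h.isUnit_two ht).exists_left_inv
    refine isUnit_of_mul_isUnit_right (x := w) (isUnit_of_sub_one_mem ?_)
    have := Ideal.mul_mem_left _ w hg
    convert this using 1
    linear_combination hw
  refine h2.mul_right_injective ?_
  change (g.det + 1) * g.det = (g.det + 1) * 1
  linear_combination h1

theorem det_eq_one_of_isIsom {R : Type*} [CommRing R] [IsLocalRing R] (h : Admissible t n p R)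
    {g : Matrix (Fin n) (Fin n) R} (hg : MatIn (maximalIdeal R) (g - 1))
    (hi : IsIsom t g) : g.det = 1 := by
  by_cases ht : t = .GL
  · subst ht
    exact hi
  · exact det_eq_one_of_isometry h ht hg.det_sub_one_mem ((isIsom_iff ht).mp hi)

end Chart

/-! ## Base change of linear maps on matrices -/

section BaseChange

variable {O : Type*} [CommRing O] {n : ℕ} (A : Type*) [CommRing A] [Algebra O A]

/-- The base change of a linear functional on matrices. -/
def bcFun (φ : Matrix (Fin n) (Fin n) O →ₗ[O] O) : Matrix (Fin n) (Fin n) A →ₗ[A] A :=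
  ∑ i, ∑ j, (algebraMap O A (φ (single i j 1))) • entryLinearMap A A i j

/-- The base change of an endomorphism of the space of matrices. -/
def bc (f : Matrix (Fin n) (Fin n) O →ₗ[O] Matrix (Fin n) (Fin n) O) :
    Matrix (Fin n) (Fin n) A →ₗ[A] Matrix (Fin n) (Fin n) A where
  toFun X := Matrix.of fun i j => bcFun A (entryLinearMap O O i j ∘ₗ f) X
  map_add' X Y := by ext i j; exact map_add (bcFun A (entryLinearMap O O i j ∘ₗ f)) X Y
  map_smul' a X := by ext i j; exact map_smul (bcFun A (entryLinearMap O O i j ∘ₗ f)) a X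

variable {A}

theorem bcFun_apply (φ : Matrix (Fin n) (Fin n) O →ₗ[O] O) (X : Matrix (Fin n) (Fin n) A) :
    bcFun A φ X = ∑ i, ∑ j, algebraMap O A (φ (single i j 1)) * X i j := by
  simp only [bcFun, LinearMap.sum_apply, LinearMap.smul_apply, entryLinearMap_apply, smul_eq_mul]

theorem bcFun_map_algebraMap (φ : Matrix (Fin n) (Fin n) O →ₗ[O] O)
    (X : Matrix (Fin n) (Fin n) O) :
    bcFun A φ (X.map (algebraMap O A)) = algebraMap O A (φ X) := by
  rw [bcFun_apply]
  conv_rhs => rw [matrix_eq_sum_single X]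
  simp only [map_sum]
  refine Finset.sum_congr rfl fun i _ => Finset.sum_congr rfl fun j _ => ?_
  have : single i j (X i j) = X i j • single i j (1 : O) := by
    rw [smul_single, smul_eq_mul, mul_one]
  rw [this, map_smul, smul_eq_mul, map_mul, Matrix.map_apply, mul_comm]

theorem bcFun_mem {I : Ideal A} (φ : Matrix (Fin n) (Fin n) O →ₗ[O] O)
    {X : Matrix (Fin n) (Fin n) A} (hX : MatIn I X) : bcFun A φ X ∈ I := by
  rw [bcFun_apply]
  exact sum_mem fun i _ => sum_mem fun j _ => Ideal.mul_mem_left _ _ (hX i j)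

theorem bcFun_natural {B : Type*} [CommRing B] [Algebra O B] (g : A →ₐ[O] B)
    (φ : Matrix (Fin n) (Fin n) O →ₗ[O] O) (X : Matrix (Fin n) (Fin n) A) :
    g (bcFun A φ X) = bcFun B φ (X.map g) := by
  simp [bcFun_apply, map_sum]

theorem bc_map_algebraMap (f : Matrix (Fin n) (Fin n) O →ₗ[O] Matrix (Fin n) (Fin n) O)
    (X : Matrix (Fin n) (Fin n) O) :
    bc A f (X.map (algebraMap O A)) = (f X).map (algebraMap O A) := by
  ext i j
  exact bcFun_map_algebraMap _ X

theorem bc_mem {I : Ideal A} (f : Matrix (Fin n) (Fin n) O →ₗ[O] Matrix (Fin n) (Fin n) O)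
    {X : Matrix (Fin n) (Fin n) A} (hX : MatIn I X) : MatIn I (bc A f X) :=
  fun _ _ => bcFun_mem _ hX

theorem bc_natural {B : Type*} [CommRing B] [Algebra O B] (g : A →ₐ[O] B)
    (f : Matrix (Fin n) (Fin n) O →ₗ[O] Matrix (Fin n) (Fin n) O) (X : Matrix (Fin n) (Fin n) A) :
    (bc A f X).map g = bc B f (X.map g) := by
  ext i j
  exact bcFun_natural g _ X

/-- Linear maps on matrices over `A` are determined by their values on matrices over `O`. -/
theorem ext_of_map_algebraMap (O : Type*) [CommRing O] [Algebra O A] {V : Type*} [AddCommGroup V]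
    [Module A V] {f g : Matrix (Fin n) (Fin n) A →ₗ[A] V}
    (h : ∀ X : Matrix (Fin n) (Fin n) O, f (X.map (algebraMap O A)) = g (X.map (algebraMap O A))) :
    f = g := by
  refine Matrix.ext_linearMap A fun i j => LinearMap.ext_ring ?_
  have : (single i j 1 : Matrix (Fin n) (Fin n) O).map (algebraMap O A) = single i j 1 := by
    ext a b
    simp only [single_apply, Matrix.map_apply]
    split_ifs <;> simp
  have h1 := h (single i j 1)
  rwa [this] at h1

end BaseChange

/-! ## The projection onto the Lie algebra of `G'` -/

section Projection

variable {t : Family} {n p : ℕ} {R : Type*} [CommRing R]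

theorem star_add (X Y : Matrix (Fin n) (Fin n) R) : star t (X + Y) = star t X + star t Y :=
  adj_add _ _

theorem star_smul (a : R) (X : Matrix (Fin n) (Fin n) R) : star t (a • X) = a • star t X :=
  adj_smul _ _

/-- The projection of `𝔤𝔩_n` onto the Lie algebra of `G'`. -/
def projDerived (t : Family) (n : ℕ) (R : Type*) [CommRing R] :
    Matrix (Fin n) (Fin n) R →ₗ[R] Matrix (Fin n) (Fin n) R where
  toFun X := match t with
    | .GL => X - (Ring.inverse (n : R) * X.trace) • 1
    | _ => Ring.inverse (2 : R) • (X - star t X)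
  map_add' X Y := by
    cases t
    · simp only [trace_add, mul_add, add_smul]; abel
    all_goals simp only [star_add, ← smul_add]; congr 1; abel
  map_smul' a X := by
    cases t
    · simp only [trace_smul, smul_eq_mul, RingHom.id_apply, smul_sub, smul_smul]
      congr 2; ring
    all_goals simp only [star_smul, RingHom.id_apply, ← smul_sub, smul_comm a]

theorem projDerived_GL (X : Matrix (Fin n) (Fin n) R) :
    projDerived .GL n R X = X - (Ring.inverse (n : R) * X.trace) • 1 := rfl

theorem projDerived_apply (ht : t ≠ .GL) (X : Matrix (Fin n) (Fin n) R) :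
    projDerived t n R X = Ring.inverse (2 : R) • (X - star t X) := by
  cases t
  · exact absurd rfl ht
  · rfl
  · rfl

theorem projDerived_map [IsLocalRing R] (h : Admissible t n p R) {R' : Type*} [CommRing R']
    (f : R →+* R') (X : Matrix (Fin n) (Fin n) R) :
    (projDerived t n R X).map f = projDerived t n R' (X.map f) := by
  by_cases ht : t = .GL
  · subst ht
    have h1 : f X.trace = (X.map f).trace := by simp [trace, map_sum]
    rw [projDerived_GL, projDerived_GL, ← map_natCast f, ← map_ringInverse_of_isUnit f h.isUnit_n,
      ← h1, ← map_mul]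
    ext i j
    simp only [Matrix.map_apply, Matrix.sub_apply, Matrix.smul_apply, Matrix.one_apply, smul_eq_mul,
      map_sub, map_mul]
    split_ifs <;> simp
  · rw [projDerived_apply ht, projDerived_apply ht, ← star_map, ← map_ofNat f,
      ← map_ringInverse_of_isUnit f (h.isUnit_two ht)]
    ext i j
    simp

variable [IsLocalRing R]

theorem projDerived_mem (h : Admissible t n p R) (X : Matrix (Fin n) (Fin n) R) :
    projDerived t n R X ∈ lieDerived t n R := by
  by_cases ht : t = .GL
  · subst ht
    rw [mem_lieDerived_GL, projDerived_GL, trace_sub, trace_smul, trace_one, Fintype.card_fin,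
      smul_eq_mul]
    linear_combination -X.trace * Ring.inverse_mul_cancel _ h.isUnit_n
  · rw [mem_lieDerived ht, projDerived_apply ht, star_smul, star, star, adj_sub,
      (formMatrix_isForm h.even).adj_adj, ← smul_neg, neg_sub]

theorem projDerived_of_mem (h : Admissible t n p R) {X : Matrix (Fin n) (Fin n) R}
    (hX : X ∈ lieDerived t n R) : projDerived t n R X = X := by
  by_cases ht : t = .GL
  · subst ht
    rw [projDerived_GL, mem_lieDerived_GL.mp hX, mul_zero, zero_smul, sub_zero]
  · rw [projDerived_apply ht, (mem_lieDerived ht).mp hX, sub_neg_eq_add, ← two_smul R X, smul_smul,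
      Ring.inverse_mul_cancel _ (h.isUnit_two ht), one_smul]

/-- In the linear case commutators are traceless and scalars commute with `N`. Otherwise the
involution reverses products and negates `N`, so it commutes with taking the commutator with `N`. -/
theorem twistedAd_projDerived (h : Admissible t n p R) {N : Matrix (Fin n) (Fin n) R}
    (hN : N ∈ lieDerived t n R) (X : Matrix (Fin n) (Fin n) R) :
    twistedAd 1 N (projDerived t n R X) = projDerived t n R (twistedAd 1 N X) := by
  simp only [twistedAd_apply, one_smul]
  by_cases ht : t = .GL
  · subst ht
    simp only [projDerived_GL, trace_sub, trace_mul_comm X N, sub_self, mul_zero, zero_smul,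
      sub_zero, Matrix.sub_mul, Matrix.mul_sub, Matrix.smul_mul, Matrix.mul_smul, Matrix.one_mul,
      Matrix.mul_one]
    abel
  · have e : ∀ a b : Matrix (Fin n) (Fin n) R, star t (a * b) = star t b * star t a :=
      fun a b => (formMatrix_isForm h.even).adj_mul a b
    have e' : ∀ a b : Matrix (Fin n) (Fin n) R, star t (a - b) = star t a - star t b :=
      fun a b => adj_sub a b
    simp only [projDerived_apply ht, e, e', (mem_lieDerived ht).mp hN, Matrix.smul_mul,
      Matrix.mul_smul, Matrix.sub_mul, Matrix.mul_sub, ← smul_sub]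
    congr 1
    simp only [Matrix.neg_mul, Matrix.mul_neg]
    abel

end Projection

/-! ## Splitting off the centralizer of a nilpotent -/

section Splitting

variable {t : Family} {n p : ℕ} {O : Type*} [CommRing O] [IsLocalRing O]

/-- A projection `E` of the Lie algebra of `G'` onto a complement of the centralizer of `N`. -/
structure AdSplitting (t : Family) {n : ℕ} (N : Matrix (Fin n) (Fin n) O) where
  E : Matrix (Fin n) (Fin n) O →ₗ[O] Matrix (Fin n) (Fin n) O
  U : Matrix (Fin n) (Fin n) O →ₗ[O] Matrix (Fin n) (Fin n) O
  E_eq : ∀ X, E X = U (twistedAd 1 N X)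
  proj_E : ∀ X, projDerived t n O (E X) = E X
  ad_E : ∀ X, twistedAd 1 N (E X) = twistedAd 1 N (projDerived t n O X)

/-- With `π` the projection to `Lie G'`, take `E = π ∘ T ∘ ad N`. Since `π` commutes with `ad N` and
`T` is a pseudo-inverse, `E X` and `π X` have the same commutator with `N`. Identities of linear
maps on all matrices, in contrast to a decomposition of a submodule, survive any base change. -/
theorem exists_adSplitting (h : Admissible t n p O) {N : Matrix (Fin n) (Fin n) O}
    (hN : N ∈ lieDerived t n O) {T : Matrix (Fin n) (Fin n) O →ₗ[O] Matrix (Fin n) (Fin n) O}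
    (hT : ∀ X, twistedAd 1 N (T (twistedAd 1 N X)) = twistedAd 1 N X) :
    Nonempty (AdSplitting t N) :=
  ⟨{ E := projDerived t n O ∘ₗ T ∘ₗ twistedAd 1 N
     U := projDerived t n O ∘ₗ T
     E_eq := fun _ => rfl
     proj_E := fun _ => projDerived_of_mem h (projDerived_mem h _)
     ad_E := fun X => by
       simp only [LinearMap.comp_apply]
       rw [twistedAd_projDerived h hN, hT, twistedAd_projDerived h hN] }⟩

namespace AdSplitting

variable {N : Matrix (Fin n) (Fin n) O} (s : AdSplitting t N) {A : Type*} [CommRing A] [Algebra O A]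

theorem map_twistedAd {O : Type*} [CommRing O] {A : Type*} [CommRing A] [Algebra O A]
    (N X : Matrix (Fin n) (Fin n) O) :
    (twistedAd 1 N X).map (algebraMap O A) =
      twistedAd 1 (N.map (algebraMap O A)) (X.map (algebraMap O A)) := by
  have := map_sub (algebraMap O A).mapMatrix (X * N) (N * X)
  rw [map_mul, map_mul] at this
  simpa using this

omit [IsLocalRing O] in
theorem bc_E_eq (X : Matrix (Fin n) (Fin n) A) :
    bc A s.E X = bc A s.U (twistedAd 1 (N.map (algebraMap O A)) X) := by
  have : bc A s.E = bc A s.U ∘ₗ twistedAd 1 (N.map (algebraMap O A)) :=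
    ext_of_map_algebraMap O fun X => by
      rw [LinearMap.comp_apply, ← map_twistedAd, bc_map_algebraMap, bc_map_algebraMap, s.E_eq]
  rw [this]
  rfl

theorem bc_E_mem (h : Admissible t n p O) [IsLocalRing A] [IsLocalHom (algebraMap O A)]
    (X : Matrix (Fin n) (Fin n) A) : bc A s.E X ∈ lieDerived t n A := by
  have : projDerived t n A ∘ₗ bc A s.E = bc A s.E :=
    ext_of_map_algebraMap O fun X => by
      rw [LinearMap.comp_apply, bc_map_algebraMap, ← projDerived_map h, s.proj_E]
  rw [← this]
  exact projDerived_mem (h.map (algebraMap O A)) _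

theorem ad_bc_E (h : Admissible t n p O) [IsLocalRing A] [IsLocalHom (algebraMap O A)]
    {X : Matrix (Fin n) (Fin n) A} (hX : X ∈ lieDerived t n A) :
    bc A s.E X * N.map (algebraMap O A) - N.map (algebraMap O A) * bc A s.E X =
      X * N.map (algebraMap O A) - N.map (algebraMap O A) * X := by
  have : twistedAd 1 (N.map (algebraMap O A)) ∘ₗ bc A s.E =
      twistedAd 1 (N.map (algebraMap O A)) ∘ₗ projDerived t n A :=
    ext_of_map_algebraMap O fun X => by
      rw [LinearMap.comp_apply, LinearMap.comp_apply, bc_map_algebraMap, ← projDerived_map h,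
        ← map_twistedAd, ← map_twistedAd, s.ad_E]
  have := LinearMap.congr_fun this X
  rw [LinearMap.comp_apply, LinearMap.comp_apply,
    projDerived_of_mem (h.map (algebraMap O A)) hX] at this
  simpa using this

/-- `E X` depends only on the commutator of `X` with `N`, and `E X` has the same commutator as `X`.
-/
theorem bc_E_bc_E (h : Admissible t n p O) [IsLocalRing A] [IsLocalHom (algebraMap O A)]
    {X : Matrix (Fin n) (Fin n) A} (hX : X ∈ lieDerived t n A) :
    bc A s.E (bc A s.E X) = bc A s.E X := by
  rw [s.bc_E_eq (bc A s.E X)]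
  rw [s.bc_E_eq X]
  refine congrArg (bc A s.U) ?_
  rw [← s.bc_E_eq X]
  simpa using s.ad_bc_E h hX

-- `E` factors through the commutator with `N` by a map defined over `O`, so a gain of order in the
-- commutator is passed on to `E X`.
omit [IsLocalRing O] in
theorem bc_E_mem_of_commutator {I : Ideal A} {X : Matrix (Fin n) (Fin n) A}
    (hX : MatIn I (X * N.map (algebraMap O A) - N.map (algebraMap O A) * X)) :
    MatIn I (bc A s.E X) := by
  rw [s.bc_E_eq]
  refine bc_mem _ ?_
  simpa using hX

end AdSplitting

end Splitting

/-! ## Coordinates on the Lie algebra of `G'` -/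

section Coordinates

variable {t : Family} {n p d : ℕ} {O : Type*} [CommRing O] [IsLocalRing O]

/-- The linear map with coordinates `b` on the Lie algebra of `G'` over an `O`-algebra. -/
def coordMap (b : Module.Basis (Fin d) O (lieDerived t n O)) (A : Type*) [CommRing A] [Algebra O A] :
    (Fin d → A) →ₗ[A] Matrix (Fin n) (Fin n) A :=
  Fintype.linearCombination A fun l => (b l : Matrix (Fin n) (Fin n) O).map (algebraMap O A)

variable (h : Admissible t n p O) (b : Module.Basis (Fin d) O (lieDerived t n O))
  {A : Type*} [CommRing A] [Algebra O A]

/-- The `l`-th coordinate of the projection of a matrix to the Lie algebra of `G'`. -/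
def coordFun (l : Fin d) : Matrix (Fin n) (Fin n) O →ₗ[O] O :=
  b.coord l ∘ₗ (projDerived t n O).codRestrict (lieDerived t n O) (projDerived_mem h)

theorem coordMap_apply {O : Type*} [CommRing O] {A : Type*} [CommRing A] [Algebra O A]
    (b : Module.Basis (Fin d) O (lieDerived t n O)) (x : Fin d → A) :
    coordMap b A x = ∑ l, x l • (b l : Matrix (Fin n) (Fin n) O).map (algebraMap O A) :=
  Fintype.linearCombination_apply ..

omit [IsLocalRing O] in
theorem coordMap_natural {B : Type*} [CommRing B] [Algebra O B] (g : A →ₐ[O] B) (x : Fin d → A) :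
    (coordMap b A x).map g = coordMap b B (fun l => g (x l)) := by
  ext i j
  simp [coordMap_apply, Matrix.sum_apply]

omit [IsLocalRing O] in
theorem coordMap_matIn {I : Ideal A} {x : Fin d → A} (hx : ∀ l, x l ∈ I) :
    MatIn I (coordMap b A x) := by
  intro i j
  rw [coordMap_apply, Matrix.sum_apply]
  exact sum_mem fun l _ => MatIn.smul_of_mem (hx l) _ i j

include h in
theorem coordMap_mem [IsLocalRing A] [IsLocalHom (algebraMap O A)] (x : Fin d → A) :
    coordMap b A x ∈ lieDerived t n A := by
  rw [coordMap_apply]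
  refine sum_mem fun l _ => Submodule.smul_mem _ _ ?_
  rw [← projDerived_of_mem h (b l).2, projDerived_map h]
  exact projDerived_mem (h.map (algebraMap O A)) _

theorem bcFun_coordFun_coordMap (x : Fin d → A) (l : Fin d) :
    bcFun A (coordFun h b l) (coordMap b A x) = x l := by
  rw [coordMap_apply, map_sum, Finset.sum_eq_single l]
  · rw [map_smul, bcFun_map_algebraMap]
    have : (projDerived t n O).codRestrict (lieDerived t n O) (projDerived_mem h) (b l) = b l :=
      Subtype.ext (projDerived_of_mem h (b l).2)
    rw [coordFun, LinearMap.comp_apply, this]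
    simp
  · intro l' _ hl
    rw [map_smul, bcFun_map_algebraMap]
    have : (projDerived t n O).codRestrict (lieDerived t n O) (projDerived_mem h) (b l') = b l' :=
      Subtype.ext (projDerived_of_mem h (b l').2)
    rw [coordFun, LinearMap.comp_apply, this]
    simp [Finsupp.single_eq_of_ne hl.symm]
  · simp

theorem coordMap_bcFun_coordFun [IsLocalRing A] [IsLocalHom (algebraMap O A)]
    {X : Matrix (Fin n) (Fin n) A} (hX : X ∈ lieDerived t n A) :
    coordMap b A (fun l => bcFun A (coordFun h b l) X) = X := by
  have : coordMap b A ∘ₗ LinearMap.pi (fun l => bcFun A (coordFun h b l)) = projDerived t n A :=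
    ext_of_map_algebraMap O fun X => by
      rw [LinearMap.comp_apply, coordMap_apply, ← projDerived_map h]
      simp only [LinearMap.pi_apply, bcFun_map_algebraMap]
      have e := b.sum_repr
        ((projDerived t n O).codRestrict (lieDerived t n O) (projDerived_mem h) X)
      have e' := congrArg (fun Y : lieDerived t n O => (Y : Matrix (Fin n) (Fin n) O).map
        (algebraMap O A)) e
      simp only [LinearMap.codRestrict_apply] at e'
      rw [← e', Submodule.coe_sum]
      ext i j
      simp only [Matrix.sum_apply, Matrix.smul_apply, Matrix.map_apply, map_sum, smul_eq_mul,
        Submodule.coe_smul, map_mul, coordFun, LinearMap.comp_apply, Module.Basis.coord_apply]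
  have := LinearMap.congr_fun this X
  rw [LinearMap.comp_apply, projDerived_of_mem (h.map (algebraMap O A)) hX] at this
  exact this

/-- The coordinates on the Lie algebra of `G'` over an `O`-algebra. -/
def coordEquiv [IsLocalRing A] [IsLocalHom (algebraMap O A)] :
    (Fin d → A) ≃ₗ[A] lieDerived t n A :=
  LinearEquiv.ofLinearMap ((coordMap b A).codRestrict _ (coordMap_mem h b))
    (LinearMap.pi (fun l => bcFun A (coordFun h b l)) ∘ₗ (lieDerived t n A).subtype)
    (LinearMap.ext fun X => Subtype.ext (coordMap_bcFun_coordFun h b X.2))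
    (LinearMap.ext fun x => funext fun l => bcFun_coordFun_coordMap h b x l)

end Coordinates

/-! ## The formal group of `G'` -/

section FormalGroup

variable {O : Type u} [CommRing O] [IsLocalRing O] {t : Family} {n p : ℕ} {A B : ArtAlg O}

theorem mem_Ghat_iff {g : G t n A.carrier} :
    g ∈ Ghat t n A ↔ MatIn (maximalIdeal A.carrier) (mat g - 1) := by
  rw [Ghat, MonoidHom.mem_ker, ← map_mk_eq_one_iff]
  exact ⟨fun h => congrArg (fun x : G t n (ResidueField A.carrier) => mat x) h,
    fun h => Subtype.ext (Units.ext h)⟩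

theorem mat_mul (a b : G t n A.carrier) : mat (a * b) = mat a * mat b := rfl

theorem mat_injective {R : Type*} [CommRing R] : Function.Injective (mat : G t n R → _) :=
  fun _ _ h => Subtype.ext (Units.ext h)

theorem mat_mul_inv {R : Type*} [CommRing R] (a : G t n R) : mat a * mat a⁻¹ = 1 :=
  congrArg Units.val (mul_inv_cancel a.1)

theorem mat_inv_mul {R : Type*} [CommRing R] (a : G t n R) : mat a⁻¹ * mat a = 1 :=
  congrArg Units.val (inv_mul_cancel a.1)

theorem conj_eq_iff {R : Type*} [CommRing R] {a : G t n R} {M M' : Matrix (Fin n) (Fin n) R} :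
    mat a * M * mat a⁻¹ = M' ↔ mat a * M = M' * mat a := by
  constructor
  · rintro rfl
    rw [Matrix.mul_assoc _ (mat a⁻¹), mat_inv_mul, Matrix.mul_one]
  · intro h
    rw [h, Matrix.mul_assoc, mat_mul_inv, Matrix.mul_one]

/-- The chart with values in the group `G(A)`. -/
def chartG (t : Family) (A : ArtAlg O) (X : Matrix (Fin n) (Fin n) A.carrier) : G t n A.carrier :=
  open Classical in
  if h : ∃ g : G t n A.carrier, mat g = chart t A X then h.choose else 1

variable (h : Admissible t n p O) {X Y : Matrix (Fin n) (Fin n) A.carrier}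

/-- The elements of the Lie algebra of `G'` reducing to zero. -/
def formalLie (t : Family) (n : ℕ) (A : ArtAlg O) : Set (Matrix (Fin n) (Fin n) A.carrier) :=
  {X | X ∈ lieDerived t n A.carrier ∧ MatIn (maximalIdeal A.carrier) X}

/-- The elements of `G'(A)` reducing to the identity. -/
def formalGroup (t : Family) (n : ℕ) (A : ArtAlg O) : Set (G t n A.carrier) :=
  {g | g ∈ Ghat t n A ∧ g ∈ G' t n A.carrier}

include h

theorem admissible_carrier (A : ArtAlg O) : Admissible t n p A.carrier :=
  h.map (algebraMap O A.carrier)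

theorem mat_chartG (hX : X ∈ formalLie t n A) : mat (chartG t A X) = chart t A X := by
  have := exists_G_of_isIsom h.even (isIsom_chart (admissible_carrier h A) hX.2 hX.1)
  rw [chartG, dif_pos this]
  exact this.choose_spec

theorem chartG_mem (hX : X ∈ formalLie t n A) : chartG t A X ∈ formalGroup t n A := by
  have h1 := chart_sub_one (admissible_carrier h A) hX.2
  have h2 := isIsom_chart (admissible_carrier h A) hX.2 hX.1
  rw [← mat_chartG h hX] at h1 h2
  exact ⟨mem_Ghat_iff.mpr h1, mem_G'_of_isIsom h.even h2 fun _ =>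
    det_eq_one_of_isIsom (admissible_carrier h A) h1 h2⟩

theorem exists_chartG_eq {g : G t n A.carrier} (hg : g ∈ formalGroup t n A) :
    ∃ X ∈ formalLie t n A, chartG t A X = g := by
  obtain ⟨X, hX, hX', e⟩ := exists_chart_eq (admissible_carrier h A) (mem_Ghat_iff.mp hg.1)
    (isIsom_of_mem_G' h.even hg.2)
  exact ⟨X, ⟨hX, hX'⟩, mat_injective ((mat_chartG h ⟨hX, hX'⟩).trans e)⟩

theorem chartG_injOn : Set.InjOn (chartG t A (n := n)) (formalLie t n A) := fun X hX Y hY e =>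
  chart_injOn (admissible_carrier h A) hX.2 hY.2 hX.1 hY.1 (by
    rw [← mat_chartG h hX, ← mat_chartG h hY, e])

theorem formalLie_map (f : A.carrier →ₐ[O] B.carrier) (hX : X ∈ formalLie t n A) :
    X.map f ∈ formalLie t n B := by
  refine ⟨?_, hX.2.map f.toRingHom fun a ha => ArtAlg.map_mem_maximalIdeal f ha⟩
  rw [← projDerived_of_mem (admissible_carrier h A) hX.1]
  have := projDerived_map (admissible_carrier h A) f.toRingHom X
  exact this ▸ projDerived_mem (admissible_carrier h B) _

theorem Gmap_chartG (f : A.carrier →ₐ[O] B.carrier) (hX : X ∈ formalLie t n A) :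
    Gmap t n f.toRingHom (chartG t A X) = chartG t B (X.map f) := by
  refine mat_injective ?_
  rw [mat_chartG h (formalLie_map h f hX)]
  refine Eq.trans ?_ (chart_map (admissible_carrier h A) (admissible_carrier h B) f hX.2)
  rw [← mat_chartG h hX]
  rfl

theorem chartG_commute (hX : X ∈ formalLie t n A) (N : Matrix (Fin n) (Fin n) A.carrier) :
    mat (chartG t A X) * N = N * mat (chartG t A X) ↔ X * N = N * X := by
  rw [mat_chartG h hX]
  exact chart_commute (admissible_carrier h A) hX.2 N

/-- Up to scalars, the elements of `G(A)` reducing to the identity lie in `G'(A)`. -/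
theorem exists_smul_mem_formalGroup {g : G t n A.carrier} (hg : g ∈ Ghat t n A) :
    ∃ g' ∈ formalGroup t n A, ∃ s : A.carrier, mat g' = s • mat g := by
  have hA := admissible_carrier h A
  have hg1 := mem_Ghat_iff.mp hg
  obtain ⟨k, hk⟩ := A.exists_pow_eq_bot
  -- Scaling by an `n`-th root corrects the determinant, scaling by a square root the multiplier.
  obtain ⟨s, hs, hi⟩ : ∃ s : A.carrier, s - 1 ∈ maximalIdeal A.carrier ∧
      IsIsom t (s • mat g) := by
    by_cases ht : t = .GL
    · subst ht
      obtain ⟨s, h1, h2⟩ := exists_root hA.mem hA.prime.one_lt hk hA.coprime hg1.det_sub_one_mem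
      refine ⟨s, h1, ?_⟩
      change (s • mat g).det = 1
      rw [det_smul, Fintype.card_fin, h2]
    · obtain ⟨c, hc⟩ := (mem_G_iff ht h.even).mp g.2
      have hc1 : (c : A.carrier) - 1 ∈ maximalIdeal A.carrier := by
        have h1 : MatIn (maximalIdeal A.carrier) (star t (mat g) - 1) := by
          have := MatIn.adj (ε := formSign t A.carrier) (J := formMatrix t n A.carrier) hg1
          rwa [adj_sub, (formMatrix_isForm h.even).adj_one] at this
        have h2 := h1.mul_sub_one hg1
        rw [hc] at h2
        have := h2 ⟨0, h.one_le⟩ ⟨0, h.one_le⟩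
        simpa using this
      obtain ⟨s, h1, h2⟩ := exists_root hA.mem hA.prime.one_lt hk (hA.coprime_two ht) hc1
      refine ⟨s, h1, (isIsom_iff ht).mpr ?_⟩
      rw [star_smul, Matrix.smul_mul, Matrix.mul_smul, hc, smul_smul, smul_smul, ← sq, h2,
        one_smul]
  obtain ⟨g', hg'⟩ := exists_G_of_isIsom h.even hi
  have h1 : MatIn (maximalIdeal A.carrier) (mat g' - 1) := by
    have : s • mat g - 1 = s • (mat g - 1) + (s • 1 - 1) := by rw [smul_sub]; abel
    rw [hg', this]
    exact (hg1.smul s).add (MatIn.smul_one_sub_one hs)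
  rw [← hg'] at hi
  exact ⟨g', ⟨mem_Ghat_iff.mpr h1,
    mem_G'_of_isIsom h.even hi fun _ => det_eq_one_of_isIsom hA h1 hi⟩, s, hg'⟩

variable {N : Matrix (Fin n) (Fin n) O} (s : AdSplitting t N)

theorem bc_E_mem_formalLie (hX : X ∈ formalLie t n A) : bc A.carrier s.E X ∈ formalLie t n A :=
  ⟨s.bc_E_mem h X, bc_mem _ hX.2⟩

theorem sub_bc_E_mem_formalLie (hX : X ∈ formalLie t n A) :
    X - bc A.carrier s.E X ∈ formalLie t n A :=
  ⟨sub_mem hX.1 (s.bc_E_mem h X), hX.2.sub (bc_mem _ hX.2)⟩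

theorem chartG_sub_bc_E_commute (hX : X ∈ formalLie t n A) :
    mat (chartG t A (X - bc A.carrier s.E X)) * N.map (algebraMap O A.carrier) =
      N.map (algebraMap O A.carrier) * mat (chartG t A (X - bc A.carrier s.E X)) := by
  rw [chartG_commute h (sub_bc_E_mem_formalLie h s hX)]
  have := s.ad_bc_E h hX.1
  rw [Matrix.sub_mul, Matrix.mul_sub]
  rw [sub_eq_sub_iff_sub_eq_sub] at this
  rw [← neg_sub, this, neg_sub]

/-- Points of the slice are distinct modulo the centralizer of `N`. If `Y - X` lies in the `i`-th
power of the maximal ideal, its commutator with `N` lies in the next one, hence so does `E (Y - X) =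
Y - X`; the maximal ideal is nilpotent. -/
theorem eq_of_chartG_mul_eq (hX : X ∈ formalLie t n A) (hY : Y ∈ formalLie t n A)
    (hX' : bc A.carrier s.E X = X) (hY' : bc A.carrier s.E Y = Y) {z : G t n A.carrier}
    (hz : chartG t A X * z = chartG t A Y)
    (hzN : mat z * N.map (algebraMap O A.carrier) = N.map (algebraMap O A.carrier) * mat z) :
    X = Y := by
  have hz' : chart t A X * mat z = chart t A Y := by
    rw [← mat_chartG h hX, ← mat_chartG h hY, ← hz]
    rfl
  have key : ∀ i, MatIn (maximalIdeal A.carrier ^ i) (Y - X) := by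
    intro i
    induction i with
    | zero => rw [pow_zero, Ideal.one_eq_top]; exact fun _ _ => Submodule.mem_top
    | succ i ih =>
      have h1 := chart_commutator (admissible_carrier h A) hX.2 hY.2 ih hz' hzN
      have h2 := s.bc_E_mem_of_commutator h1
      rwa [map_sub, hX', hY'] at h2
  obtain ⟨k, hk⟩ := A.exists_pow_eq_bot
  have := key k
  rw [hk, matIn_bot, sub_eq_zero] at this
  exact this.symm

/-- The decomposition of the formal group of `G'` adapted to the centralizer of `N`. -/
theorem exists_chartG_mul_chartG [Finite A.carrier] {g : G t n A.carrier}
    (hg : g ∈ formalGroup t n A) :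
    ∃ Y ∈ formalLie t n A,
      chartG t A (bc A.carrier s.E Y) * chartG t A (Y - bc A.carrier s.E Y) = g := by
  have : Finite (G t n A.carrier) := Finite.of_injective mat mat_injective
  have hmem : ∀ Y ∈ formalLie t n A, chartG t A (bc A.carrier s.E Y) *
      chartG t A (Y - bc A.carrier s.E Y) ∈ formalGroup t n A := fun Y hY => by
    have h1 := chartG_mem h (bc_E_mem_formalLie h s hY)
    have h2 := chartG_mem h (sub_bc_E_mem_formalLie h s hY)
    exact ⟨mul_mem h1.1 h2.1, mul_mem h1.2 h2.2⟩
  -- The chart shows that the formal Lie algebra and the formal group are finite sets of equal size.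
  -- Surjectivity of the product map `θ` therefore follows from its injectivity, without successive
  -- approximation.
  let c : formalLie t n A ≃ formalGroup t n A := Equiv.ofBijective
    (fun X => ⟨chartG t A X, chartG_mem h X.2⟩)
    ⟨fun X Y e => Subtype.ext (chartG_injOn h X.2 Y.2 (congrArg Subtype.val e)),
      fun g => let ⟨X, hX, e⟩ := exists_chartG_eq h g.2; ⟨⟨X, hX⟩, Subtype.ext e⟩⟩
  let θ : formalLie t n A → formalGroup t n A := fun Y => ⟨_, hmem Y Y.2⟩
  have hinj : Function.Injective θ := by
    rintro ⟨Y, hY⟩ ⟨Y', hY'⟩ e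
    have e1 : chartG t A (bc A.carrier s.E Y) * chartG t A (Y - bc A.carrier s.E Y) =
      chartG t A (bc A.carrier s.E Y') * chartG t A (Y' - bc A.carrier s.E Y') :=
      congrArg Subtype.val e
    have e2 := eq_of_chartG_mul_eq h s (bc_E_mem_formalLie h s hY) (bc_E_mem_formalLie h s hY')
      (s.bc_E_bc_E h hY.1) (s.bc_E_bc_E h hY'.1)
      (z := chartG t A (Y - bc A.carrier s.E Y) * (chartG t A (Y' - bc A.carrier s.E Y'))⁻¹)
      (by rw [← mul_assoc, e1, mul_inv_cancel_right]) (by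
        have c1 := chartG_sub_bc_E_commute h s hY
        have c2 := chartG_sub_bc_E_commute h s hY'
        have c3 := conj_eq_iff.mpr c2
        set z1 := chartG t A (Y - bc A.carrier s.E Y)
        set z2 := chartG t A (Y' - bc A.carrier s.E Y')
        set M := N.map (algebraMap O A.carrier)
        have c4 : mat z2⁻¹ * M = M * mat z2⁻¹ := by
          nth_rewrite 1 [← c3]
          rw [← Matrix.mul_assoc, ← Matrix.mul_assoc, mat_inv_mul, Matrix.one_mul]
        rw [mat_mul, Matrix.mul_assoc, c4, ← Matrix.mul_assoc, c1, Matrix.mul_assoc])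
    rw [e2] at e1
    have hm := sub_bc_E_mem_formalLie h s hY
    rw [e2] at hm
    have e3 := chartG_injOn h hm (sub_bc_E_mem_formalLie h s hY') (mul_left_cancel e1)
    exact Subtype.ext (sub_left_injective e3)
  obtain ⟨Y, hY⟩ := ((Finite.injective_iff_surjective_of_equiv c).mp hinj) ⟨g, hg⟩
  exact ⟨Y, Y.2, congrArg Subtype.val hY⟩

/-- Every strict conjugate of `N` is the conjugate by an element of the slice. -/
theorem exists_conj_eq [Finite A.carrier] {g : G t n A.carrier} (hg : g ∈ Ghat t n A) :
    ∃ X ∈ formalLie t n A, bc A.carrier s.E X = X ∧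
      mat g * N.map (algebraMap O A.carrier) * mat g⁻¹ =
        mat (chartG t A X) * N.map (algebraMap O A.carrier) * mat (chartG t A X)⁻¹ := by
  -- Scalars act trivially by conjugation, so `g` may be moved into `G'`; the centralizing factor of
  -- its decomposition then drops out.
  obtain ⟨g', hg', a, ha⟩ := exists_smul_mem_formalGroup h hg
  obtain ⟨Y, hY, rfl⟩ := exists_chartG_mul_chartG h s hg'
  refine ⟨_, bc_E_mem_formalLie h s hY, s.bc_E_bc_E h hY.1, ?_⟩
  set x := chartG t A (bc A.carrier s.E Y)
  have c := chartG_sub_bc_E_commute h s hY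
  set z := chartG t A (Y - bc A.carrier s.E Y)
  set M := N.map (algebraMap O A.carrier)
  set P := mat g * M * mat g⁻¹
  have h1 : mat g * M = P * mat g := conj_eq_iff.mp rfl
  have h2 : mat (x * z) * M = P * mat (x * z) := by
    rw [ha, Matrix.smul_mul, h1, Matrix.mul_smul]
  symm
  refine conj_eq_iff.mpr ?_
  rw [mat_mul, Matrix.mul_assoc, c, ← Matrix.mul_assoc, ← Matrix.mul_assoc] at h2
  exact (z : GL (Fin n) A.carrier).isUnit.mul_left_injective h2

end FormalGroup

/-! ## Nilpotent matrices in the Lie algebra -/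

section Nilpotent

variable {t : Family} {n p : ℕ}

theorem jordanMatrix_pow {F : Type*} [CommRing F] (c : Composition n) : jordanMatrix c F ^ n = 0 := by
  -- The `m`-th power is supported on the `m`-th superdiagonal.
  have key : ∀ (m : ℕ) (i j : Fin n), (i : ℕ) + m ≠ j → (jordanMatrix c F ^ m) i j = 0 := by
    intro m
    induction m with
    | zero =>
      intro i j hij
      rw [pow_zero, Matrix.one_apply_ne fun e => hij (by rw [e, add_zero])]
    | succ m ih =>
      intro i j hij
      rw [pow_succ, Matrix.mul_apply]
      refine Finset.sum_eq_zero fun l _ => ?_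
      by_cases hl : (i : ℕ) + m = l
      · have : jordanMatrix c F l j = 0 := if_neg fun e => hij (by rw [← e.2, ← hl]; ring)
        rw [this, mul_zero]
      · rw [ih i l hl, zero_mul]
  ext i j
  exact key n i j (by omega)

theorem InOrbit.pow_eq_zero {F : Type*} [Field F] {σ : n.Partition} {N : Matrix (Fin n) (Fin n) F}
    (h : InOrbit σ N) : N ^ n = 0 := by
  obtain ⟨c, -, P, hP⟩ := h
  have h1 : (P⁻¹ : GL (Fin n) F).1 * P.1 = 1 := by rw [← Units.val_mul, inv_mul_cancel, Units.val_one]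
  have h2 : P.1 * (P⁻¹ : GL (Fin n) F).1 = 1 := mul_eq_one_comm.mp h1
  have h3 := conj_pow' h1 (A := N) n
  rw [hP, jordanMatrix_pow] at h3
  have h4 : N ^ n = (P⁻¹ : GL (Fin n) F).1 * (P.1 * N ^ n * (P⁻¹ : GL (Fin n) F).1) * P.1 := by
    simp only [Matrix.mul_assoc, h1, Matrix.mul_one]
    rw [← Matrix.mul_assoc, h1, Matrix.one_mul]
  rw [h4, ← h3, Matrix.mul_zero, Matrix.zero_mul]

theorem pow_eq_zero_of_map {R S : Type*} [CommRing R] [CommRing S] (φ : R →+* S)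
    (hφ : Function.Injective φ) {N : Matrix (Fin n) (Fin n) R} {k : ℕ} (h : N.map φ ^ k = 0) :
    N ^ k = 0 := by
  have h1 : φ.mapMatrix (N ^ k) = 0 := by rw [map_pow]; exact h
  ext i j
  have h2 : φ ((N ^ k) i j) = 0 := congrFun (congrFun h1 i) j
  exact hφ (h2.trans (map_zero φ).symm)

/-- Over a domain the characteristic polynomial of the nilpotent matrix `-X` is a power of the
variable; evaluate it at `1`. -/
theorem det_one_add_of_pow_eq_zero {O : Type*} [CommRing O] [IsDomain O] {X : Matrix (Fin n) (Fin n) O} {k : ℕ} (hX : X ^ k = 0) :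
    (1 + X).det = 1 := by
  have h1 : IsNilpotent (-X) := ⟨k, by rw [neg_pow, hX, mul_zero]⟩
  have h2 := (isNilpotent_charpoly_sub_pow_of_isNilpotent h1).eq_zero
  have h3 := congrArg (Polynomial.eval 1) (sub_eq_zero.mp h2)
  rw [eval_charpoly] at h3
  simpa using h3

variable {O : Type*} [CommRing O] [IsLocalRing O] [IsDomain O]

/-- A nilpotent matrix over a domain has trace zero. Taking traces in `star N + N = a` gives `n a =
0`, and `n` is a unit. -/
theorem mem_lieDerived_of_pow_eq_zero (h : Admissible t n p O) {N : Matrix (Fin n) (Fin n) O}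
    (hN : N ∈ lie t n O) {k : ℕ} (hk : N ^ k = 0) : N ∈ lieDerived t n O := by
  have htr : N.trace = 0 := (isNilpotent_trace_of_isNilpotent ⟨k, hk⟩).eq_zero
  by_cases ht : t = .GL
  · subst ht
    exact htr
  · obtain ⟨a, ha⟩ := (mem_lie_iff ht h.even).mp hN
    have h1 := congrArg Matrix.trace ha
    rw [trace_add, star, (formMatrix_isForm h.even).trace_adj, htr, trace_smul, trace_one,
      add_zero, Fintype.card_fin, smul_eq_mul] at h1
    have h2 : a = 0 := by
      refine h.isUnit_n.mul_left_injective ?_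
      change a * (n : O) = 0 * n
      rw [zero_mul, ← h1]
    rw [h2, zero_smul] at ha
    exact (mem_lieDerived ht).mpr (eq_neg_of_add_eq_zero_left ha)

theorem star_truncExp {O : Type*} [CommRing O] (h : t = .GSp → Even n) (X : Matrix (Fin n) (Fin n) O) :
    star t (truncExp X) = truncExp (star t X) := by
  have hJ := formMatrix_isForm (R := O) h
  have e : ∀ Y : Matrix (Fin n) (Fin n) O,
      star t Y = (formSign t O • formMatrix t n O) * Yᵀ * formMatrix t n O := fun Y => by
    simp only [star, adj, Matrix.smul_mul]
  rw [e, e, truncExp_transpose, truncExp_conj (mul_eq_one_comm.mp hJ.inv_mul)]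

theorem truncExp_sub_one_pow {O : Type*} [CommRing O] (h : ∀ i < n, IsUnit ((i.factorial : ℕ) : O)) (hn : 0 < n)
    {X : Matrix (Fin n) (Fin n) O} (hX : X ^ n = 0) : (truncExp X - 1) ^ n = 0 := by
  obtain ⟨m, rfl⟩ : ∃ m, n = m + 1 := ⟨n - 1, by omega⟩
  obtain ⟨Q, hQ⟩ : ∃ Q, truncExp X - 1 = X * Q := by
    refine ⟨∑ i ∈ Finset.range m, Ring.inverse (((i + 1).factorial : ℕ) : O) • X ^ i, ?_⟩
    rw [truncExp, Finset.sum_range_succ', Matrix.mul_sum]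
    simp only [Matrix.mul_smul, ← pow_succ', Nat.factorial_zero, Nat.cast_one, Ring.inverse_one,
      pow_zero, one_smul, add_sub_cancel_right]
  have hc : Commute X (truncExp X - 1) := by
    refine Commute.sub_right ?_ (Commute.one_right _)
    exact Commute.sum_right _ _ _ fun i _ => ((Commute.refl X).pow_right i).smul_right _
  have key : ∀ j : ℕ, ∃ Q', (truncExp X - 1) ^ j = X ^ j * Q' := by
    intro j
    induction j with
    | zero => exact ⟨1, by simp⟩
    | succ j ih =>
      obtain ⟨Q', hQ'⟩ := ih
      refine ⟨Q * Q', ?_⟩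
      rw [pow_succ', hQ', ← mul_assoc, ← (hc.pow_left j).eq, hQ, ← mul_assoc, ← pow_succ, mul_assoc]
  obtain ⟨Q', hQ'⟩ := key (m + 1)
  rw [hQ', hX, zero_mul]

/-- The exponential of a nilpotent element of the Lie algebra of `G'` lies in `G'`. -/
theorem exists_mat_eq_truncExp (h : Admissible t n p O) {N : Matrix (Fin n) (Fin n) O}
    (hN : N ∈ lieDerived t n O) (hn : N ^ n = 0) :
    ∃ g : G t n O, g ∈ G' t n O ∧ mat g = truncExp N := by
  have hdet : (truncExp N).det = 1 := by
    have := det_one_add_of_pow_eq_zero (truncExp_sub_one_pow h.isUnit_factorial h.one_le hn)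
    rwa [add_sub_cancel] at this
  have hi : IsIsom t (truncExp N) := by
    by_cases ht : t = .GL
    · subst ht
      exact hdet
    · rw [isIsom_iff ht, star_truncExp h.even, (mem_lieDerived ht).mp hN]
      exact mul_eq_one_comm.mp (truncExp_mul_neg h.isUnit_factorial h.one_le hn)
  obtain ⟨g, hg⟩ := exists_G_of_isIsom h.even hi
  refine ⟨g, mem_G'_of_isIsom h.even (by rwa [hg]) fun _ => by rwa [hg], hg⟩

end Nilpotent

/-! ## Lifting the Frobenius -/

section Frobenius

variable {t : Family} {n p : ℕ}

theorem MatIn.linearMap {O : Type*} [CommRing O] {I : Ideal O} (T : Matrix (Fin n) (Fin n) O →ₗ[O] Matrix (Fin n) (Fin n) O)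
    {X : Matrix (Fin n) (Fin n) O} (hX : MatIn I X) : MatIn I (T X) := by
  have h1 := bc_mem (A := O) T hX
  have h2 : bc O T = T := ext_of_map_algebraMap O fun X => bc_map_algebraMap T X
  rwa [h2] at h1

variable {O : Type*} [CommRing O] [IsLocalRing O]

theorem smul_map {R S : Type*} [CommRing R] [CommRing S] (f : R →+* S) (a : R)
    (X : Matrix (Fin n) (Fin n) R) : (a • X).map f = f a • X.map f := by
  ext i j
  simp

theorem one_map {R S : Type*} [CommRing R] [CommRing S] (f : R →+* S) :
    (1 : Matrix (Fin n) (Fin n) R).map f = 1 :=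
  map_one f.mapMatrix

/-- A matrix over the residue field which intertwines `N` and `q N` lifts. -/
theorem exists_lift_ker_twistedAd {q : O} {N : Matrix (Fin n) (Fin n) O}
    {T : Matrix (Fin n) (Fin n) O →ₗ[O] Matrix (Fin n) (Fin n) O}
    (hT : ∀ X, twistedAd q N (T (twistedAd q N X)) = twistedAd q N X)
    {r : Matrix (Fin n) (Fin n) (ResidueField O)}
    (hr : r * N.map (residue O) = residue O q • (N.map (residue O) * r)) :
    ∃ X : Matrix (Fin n) (Fin n) O, X * N = q • (N * X) ∧ X.map (residue O) = r := by
  obtain ⟨X, hX⟩ : ∃ X : Matrix (Fin n) (Fin n) O, X.map (residue O) = r := by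
    choose f hf using fun i j => residue_surjective (r i j)
    exact ⟨Matrix.of f, by ext i j; exact hf i j⟩
  -- The pseudo-inverse identity puts this in the kernel. The correction vanishes in the residue
  -- field because the reduction of `X` already intertwines.
  refine ⟨X - T (twistedAd q N X), ?_, ?_⟩
  · have : twistedAd q N (X - T (twistedAd q N X)) = 0 := by rw [map_sub, hT, sub_self]
    rwa [twistedAd_apply, sub_eq_zero] at this
  · have h1 : MatIn (maximalIdeal O) (twistedAd q N X) := by
      intro i j
      rw [← residue_eq_zero_iff]
      have e : (twistedAd q N X).map (residue O) = 0 := by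
        have h2 : (residue O).mapMatrix (X * N) = r * N.map (residue O) := by
          rw [map_mul, ← hX]; rfl
        have h3 : (residue O).mapMatrix (N * X) = N.map (residue O) * r := by
          rw [map_mul, ← hX]; rfl
        have h4 : (q • (N * X)).map (residue O) = residue O q • (N.map (residue O) * r) := by
          rw [← h3, smul_map]; rfl
        rw [twistedAd_apply, ← RingHom.mapMatrix_apply, map_sub, h2, RingHom.mapMatrix_apply, h4,
          hr, sub_self]
      exact congrFun (congrFun e i) j
    have h2 : (T (twistedAd q N X)).map (residue O) = 0 := by
      ext i j
      exact (residue_eq_zero_iff _).mpr (h1.linearMap T i j)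
    have h3 := map_sub (residue O).mapMatrix X (T (twistedAd q N X))
    simp only [RingHom.mapMatrix_apply] at h3
    rw [h3, h2, sub_zero, hX]

theorem eq_of_forall_pow_mem [IsHausdorff (maximalIdeal O) O] {X Y : Matrix (Fin n) (Fin n) O}
    (h : ∀ i, MatIn (maximalIdeal O ^ i) (X - Y)) : X = Y :=
  sub_eq_zero.mp (matIn_of_forall_pow h)

theorem map_residue_of_sub_one {X b : Matrix (Fin n) (Fin n) O}
    (hb : MatIn (maximalIdeal O) (b - 1)) : (X * b).map (residue O) = X.map (residue O) := by
  refine matIn_sub_iff.mp ?_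
  have : X * b - X = X * (b - 1) := by rw [Matrix.mul_sub, Matrix.mul_one]
  rw [this]
  exact hb.mul_left _

variable [IsAdicComplete (maximalIdeal O) O]

/-- A self-adjoint matrix congruent to `1` has a self-adjoint inverse square root commuting with
every matrix with which it commutes. -/
theorem exists_inverse_sqrt (h : Admissible t n p O) (ht : t ≠ .GL) {u : Matrix (Fin n) (Fin n) O}
    (hu : MatIn (maximalIdeal O) (u - 1)) (hu' : star t u = u) {N : Matrix (Fin n) (Fin n) O}
    (huN : u * N = N * u) :
    ∃ b : Matrix (Fin n) (Fin n) O, MatIn (maximalIdeal O) (b - 1) ∧ star t b = b ∧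
      b * N = N * b ∧ b * u * b = 1 := by
  have hJ := formMatrix_isForm (R := O) h.even
  -- Being a limit of powers of `u`, the square root is self-adjoint and commutes with `N`; its
  -- inverse is the matrix sought.
  obtain ⟨b, hb, hb2, hlim⟩ := exists_root_limit h.mem h.prime.one_lt (h.coprime_two ht) hu
  have e1 : star t b = b := by
    refine eq_of_forall_pow_mem fun i => ?_
    obtain ⟨j, hj⟩ := hlim i
    have h1 := MatIn.adj (ε := formSign t O) (J := formMatrix t n O) hj
    have h2 : star t (u ^ j) = u ^ j := by
      have := hJ.adj_pow u j
      rw [star] at hu' ⊢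
      rw [this, hu']
    rw [adj_sub] at h1
    have h3 : star t b - b = (star t b - star t (u ^ j)) - (b - u ^ j) := by rw [h2]; abel
    rw [h3]
    exact h1.sub hj
  have e2 : b * N = N * b := by
    refine eq_of_forall_pow_mem fun i => ?_
    obtain ⟨j, hj⟩ := hlim i
    have h2 : u ^ j * N = N * u ^ j := (Commute.pow_left (show Commute u N from huN) j).eq
    have h3 : b * N - N * b = (b - u ^ j) * N - N * (b - u ^ j) := by
      rw [Matrix.sub_mul, Matrix.mul_sub, h2]; abel
    rw [h3]
    exact (hj.mul_right _).sub (hj.mul_left _)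
  obtain ⟨U, rfl⟩ := hb.isUnit
  set b' : Matrix (Fin n) (Fin n) O := ((U⁻¹ : (Matrix (Fin n) (Fin n) O)ˣ) : Matrix (Fin n) (Fin n) O)
  have hb' : b' * (U : Matrix (Fin n) (Fin n) O) = 1 := U.inv_mul
  have hb'' : (U : Matrix (Fin n) (Fin n) O) * b' = 1 := U.mul_inv
  refine ⟨b', ?_, ?_, ?_, ?_⟩
  · have : b' - 1 = -(b' * ((U : Matrix (Fin n) (Fin n) O) - 1)) := by
      rw [Matrix.mul_sub, hb', Matrix.mul_one, neg_sub]
    rw [this]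
    exact (hb.mul_left _).neg
  · have h1 : star t (U * b' : Matrix (Fin n) (Fin n) O) = star t b' * U := by
      nth_rewrite 2 [← e1]
      exact hJ.adj_mul _ _
    rw [hb'', star_one h.even] at h1
    exact U.isUnit.mul_left_injective (h1.symm.trans hb'.symm)
  · refine U.isUnit.mul_left_injective (U.isUnit.mul_right_injective ?_)
    change (U : Matrix (Fin n) (Fin n) O) * (b' * N * U) = U * (N * b' * U)
    rw [Matrix.mul_assoc N, hb', Matrix.mul_one, ← Matrix.mul_assoc, ← Matrix.mul_assoc, hb'',
      Matrix.one_mul, e2]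
  · rw [← hb2, sq, ← Matrix.mul_assoc, hb', Matrix.one_mul, hb'']

/-- A Frobenius matrix over the residue field lifts to a similitude with prescribed class in `S`
which intertwines `N` and `q N`. -/
theorem exists_frobenius_lift (h : Admissible t n p O) {q : O} {N : Matrix (Fin n) (Fin n) O}
    (hN : N ∈ lieDerived t n O)
    {T : Matrix (Fin n) (Fin n) O →ₗ[O] Matrix (Fin n) (Fin n) O}
    (hT : ∀ X, twistedAd q N (T (twistedAd q N X)) = twistedAd q N X)
    {r : G t n (ResidueField O)}
    (hr : mat r * N.map (residue O) = residue O q • (N.map (residue O) * mat r))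
    (h₀ : G t n O) (hh : (Gmap t n (residue O) h₀)⁻¹ * r ∈ G' t n (ResidueField O)) :
    ∃ Φ : G t n O, mat Φ * N = q • (N * mat Φ) ∧ Gmap t n (residue O) Φ = r ∧
      h₀⁻¹ * Φ ∈ G' t n O := by
  -- `X` has the right intertwining property but need not be a similitude. It is corrected by a
  -- factor that commutes with `N` and reduces to the identity.
  obtain ⟨X, hX, hXr⟩ := exists_lift_ker_twistedAd hT hr
  have hXu : IsUnit X := isUnit_matrix_of_residue (by rw [hXr]; exact r.1.isUnit)
  set w := (Gmap t n (residue O) h₀)⁻¹ * r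
  have hw : mat r = (mat h₀).map (residue O) * mat w := by
    have : r = Gmap t n (residue O) h₀ * w := by rw [mul_inv_cancel_left]
    nth_rewrite 1 [this]
    rfl
  by_cases ht : t = .GL
  · subst ht
    have hdr : residue O X.det = residue O (mat h₀).det := by
      rw [RingHom.map_det, RingHom.map_det, RingHom.mapMatrix_apply, RingHom.mapMatrix_apply, hXr,
        hw, det_mul, det_eq_one_of_mem_G' (by simp) hh, mul_one]
    obtain ⟨y, hy⟩ := ((isUnit_iff_isUnit_det X).mp hXu).exists_left_inv
    have hu : y * (mat h₀).det - 1 ∈ maximalIdeal O := by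
      rw [← residue_eq_zero_iff, map_sub, map_mul, ← hdr, ← map_mul, hy, sub_self]
    -- Here `y` is the inverse of `det X`, so `s ^ n = det h₀ / det X` and rescaling by `s` gives
    -- the determinant of `h₀`.
    obtain ⟨s, hs, hsn⟩ := exists_scalar_root_limit h.mem h.prime.one_lt h.coprime hu
    have hdet : (X * (s • 1)).det = (mat h₀).det := by
      rw [det_mul, det_smul, Fintype.card_fin, hsn, det_one]
      linear_combination (mat h₀).det * hy
    have hΦu : IsUnit (X * (s • 1)) := by
      rw [isUnit_iff_isUnit_det, hdet, ← isUnit_iff_isUnit_det]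
      exact (h₀ : GL (Fin n) O).isUnit
    let Φ : G .GL n O := ⟨hΦu.unit, Subgroup.mem_top _⟩
    refine ⟨Φ, ?_, ?_, ?_⟩
    · change X * (s • 1) * N = q • (N * (X * (s • 1)))
      simp only [Matrix.mul_smul, Matrix.mul_one, Matrix.smul_mul, hX]
      rw [smul_comm]
    · refine mat_injective ?_
      exact (map_residue_of_sub_one (MatIn.smul_one_sub_one hs)).trans hXr
    · refine mem_G'_of_isIsom h.even ?_ (by simp)
      change (mat h₀⁻¹ * (X * (s • 1))).det = 1
      rw [det_mul, hdet, ← det_mul, mat_inv_mul, det_one]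
  · have hJ := formMatrix_isForm (R := O) h.even
    have hmul : ∀ a b : Matrix (Fin n) (Fin n) O, star t (a * b) = star t b * star t a := hJ.adj_mul
    obtain ⟨c, hc⟩ := (mem_G_iff ht h.even).mp h₀.2
    have hrr : star t (mat r) * mat r = (residue O c) • 1 := by
      have h1 : star t ((mat h₀).map (residue O)) * (mat h₀).map (residue O) =
          residue O c • 1 := by
        rw [← star_map, ← Matrix.map_mul, hc, smul_map, one_map]
      have h2 : star t (mat w) * mat w = (1 : ResidueField O) • 1 := by
        rw [one_smul]
        exact (isIsom_iff ht).mp (isIsom_of_mem_G' h.even hh)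
      have := star_mul_similitude h.even h1 h2
      rwa [← hw, mul_one] at this
    -- `B` measures the failure of `X` to be a similitude. Applying the involution to `X N = q N X`
    -- gives `N (star X) = q (star X) N`, so `B` commutes with `N`; it is self-adjoint and reduces
    -- to the multiplier `c` of `h₀`.
    set B := star t X * X with hB
    have hBN : B * N = N * B := by
      have h1 := congrArg (star t) hX
      rw [hmul, star_smul, hmul, (mem_lieDerived ht).mp hN, Matrix.neg_mul, Matrix.mul_neg,
        smul_neg, neg_inj] at h1
      rw [hB, Matrix.mul_assoc, hX, Matrix.mul_smul, ← Matrix.mul_assoc, ← Matrix.mul_assoc, h1,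
        Matrix.smul_mul]
    have hBs : star t B = B := by
      rw [hB, hmul]
      congr 1
      exact hJ.adj_adj X
    have hBr : B.map (residue O) = residue O c • 1 := by
      rw [hB, Matrix.map_mul, star_map, hXr, hrr]
    have hcc : (((c⁻¹ : Oˣ) : O)) * c = 1 := c.inv_mul
    -- `b` is an inverse square root of `c⁻¹ B`, so `X b` has multiplier exactly `c`; as `b`
    -- commutes with `N`, the intertwining property is kept.
    obtain ⟨b, hb, hbs, hbN, hbb⟩ := exists_inverse_sqrt h ht
      (u := ((c⁻¹ : Oˣ) : O) • B) (N := N)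
      (by
        rw [← map_mk_eq_one_iff]
        change (((c⁻¹ : Oˣ) : O) • B).map (residue O) = 1
        rw [smul_map, hBr, smul_smul, ← map_mul, hcc, map_one, one_smul])
      (by rw [star_smul, hBs])
      (by rw [Matrix.smul_mul, Matrix.mul_smul, hBN])
    have hΦ : star t (X * b) * (X * b) = (c : O) • 1 := by
      rw [← hbb, hmul, hbs]
      simp only [Matrix.mul_smul, Matrix.smul_mul, smul_smul, Units.mul_inv, one_smul, hB,
        Matrix.mul_assoc]
    have hΦu : IsUnit (X * b) := hXu.mul hb.isUnit
    let Φ : G t n O := ⟨hΦu.unit, (mem_G_iff ht h.even).mpr ⟨c, hΦ⟩⟩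
    have hΦr : Gmap t n (residue O) Φ = r :=
      mat_injective ((map_residue_of_sub_one hb).trans hXr)
    refine ⟨Φ, ?_, hΦr, ?_⟩
    · change X * b * N = q • (N * (X * b))
      rw [Matrix.mul_assoc, hbN, ← Matrix.mul_assoc, hX, Matrix.smul_mul, Matrix.mul_assoc]
    · obtain ⟨c', hc'⟩ := (mem_G_iff ht h.even).mp (h₀⁻¹).2
      have e1 := star_mul_similitude h.even hc' hc
      have e2 : star t (mat (h₀⁻¹ * Φ)) * mat (h₀⁻¹ * Φ) = ((c' : O) * c) • 1 :=
        star_mul_similitude h.even hc' hΦ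
      have e3 : star t (mat (h₀⁻¹ * Φ)) * mat (h₀⁻¹ * Φ) = 1 := by
        rw [e2, ← e1]
        have := mat_inv_mul h₀
        simp only [mat] at this
        rw [this, star_one h.even, Matrix.one_mul]
      refine mem_G'_of_isIsom h.even ((isIsom_iff ht).mpr e3) fun hO => ?_
      -- In the orthogonal case the determinant of this isometry is a sign, fixed by its reduction
      -- `w`, which lies in `SO_n` of the residue field.
      refine det_eq_one_of_isometry h ht ?_ e3
      rw [← residue_eq_zero_iff, map_sub, map_one, RingHom.map_det, sub_eq_zero]
      have e4 : Gmap t n (residue O) (h₀⁻¹ * Φ) = w := by rw [map_mul, map_inv, hΦr]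
      rw [← det_eq_one_of_mem_G' (by rw [hO]; simp) hh, ← e4]
      rfl

end Frobenius

/-! ## Parametrization of the minimally ramified lifts -/

section Functoriality

variable {t : Family} {n : ℕ} {R S S' : Type*} [CommRing R] [CommRing S] [CommRing S']

theorem Gmap_Gmap (f : R →+* S) (g : S →+* S') (x : G t n R) :
    Gmap t n g (Gmap t n f x) = Gmap t n (g.comp f) x := rfl

theorem Smap_Smap (f : R →+* S) (g : S →+* S') (x : MinRam.S t n R) :
    Smap t n g (Smap t n f x) = Smap t n (g.comp f) x := by
  obtain ⟨y, rfl⟩ := QuotientGroup.mk_surjective x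
  rfl

theorem Gmap_mem_G' (f : R →+* S) {x : G t n R} (hx : x ∈ G' t n R) :
    Gmap t n f x ∈ G' t n S := by
  have h1 : Smap t n f (QuotientGroup.mk x) = QuotientGroup.mk (Gmap t n f x) := rfl
  rw [(QuotientGroup.eq_one_iff x).mpr hx, map_one] at h1
  exact (QuotientGroup.eq_one_iff _).mp h1.symm

end Functoriality

section Parametrization

variable {O : Type u} [CommRing O] [IsLocalRing O] {t : Family} {n : ℕ} {p : ℕ} [Fact p.Prime]
  {q : ℕ} {hq : p.Coprime q}

/-- Lifts to `O` of the values of `ρ̄` on the generators, and a splitting for `N`. -/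
structure TameDatum (ρbar : Tame p q hq →* G t n (ResidueField O)) (N : Matrix (Fin n) (Fin n) O)
    (ν : Tame p q hq →* S t n O) where
  adm : Admissible t n p O
  split : AdSplitting t N
  u : G t n O
  Φ : G t n O
  N_pow : N ^ n = 0
  mat_u : mat u = truncExp N
  u_mem : u ∈ G' t n O
  Φ_mul : mat Φ * N = (q : O) • (N * mat Φ)
  u_res : Gmap t n (residue O) u = ρbar (tau hq)
  Φ_res : Gmap t n (residue O) Φ = ρbar (phi hq)
  ν_tau : ν (tau hq) = 1
  ν_phi : ν (phi hq) = QuotientGroup.mk Φ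
  ν_cont : ∀ i : ℕ, IsLocallyConstant fun x =>
    Smap t n (Ideal.Quotient.mk (maximalIdeal O ^ i)) (ν x)
  ν_res : ∀ x, Smap t n (residue O) (ν x) = QuotientGroup.mk (ρbar x)
  ρbar_cont : IsLocallyConstant ρbar

namespace TameDatum

variable {ρbar : Tame p q hq →* G t n (ResidueField O)} {N : Matrix (Fin n) (Fin n) O}
  {ν : Tame p q hq →* S t n O} (D : TameDatum ρbar N ν) (A : ArtAlg O) {B : ArtAlg O}

include D in
theorem N_map_pow : N.map (algebraMap O A.carrier) ^ n = 0 := by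
  have := map_pow (algebraMap O A.carrier).mapMatrix N n
  rw [D.N_pow, map_zero] at this
  exact this.symm

theorem mat_Gmap_u :
    mat (Gmap t n (algebraMap O A.carrier) D.u) = truncExp (N.map (algebraMap O A.carrier)) := by
  rw [← truncExp_map _ D.adm.isUnit_factorial, ← D.mat_u]
  rfl

theorem mat_Gmap_Φ_mul :
    mat (Gmap t n (algebraMap O A.carrier) D.Φ) * N.map (algebraMap O A.carrier) =
      (q : A.carrier) • (N.map (algebraMap O A.carrier) *
        mat (Gmap t n (algebraMap O A.carrier) D.Φ)) := by
  have := congrArg (algebraMap O A.carrier).mapMatrix D.Φ_mul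
  rw [map_mul, RingHom.mapMatrix_apply, RingHom.mapMatrix_apply, RingHom.mapMatrix_apply,
    smul_map, map_natCast, Matrix.map_mul] at this
  exact this

/-- The element of the slice attached to a parameter. -/
def x (Y : Matrix (Fin n) (Fin n) A.carrier) : G t n A.carrier :=
  chartG t A (bc A.carrier D.split.E Y)

/-- The element of the centralizer of `N` attached to a parameter. -/
def z (Y : Matrix (Fin n) (Fin n) A.carrier) : G t n A.carrier :=
  chartG t A (Y - bc A.carrier D.split.E Y)

/-- The value at `τ` of the lift attached to a parameter. -/
def valTau (Y : Matrix (Fin n) (Fin n) A.carrier) : G t n A.carrier :=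
  D.x A Y * Gmap t n (algebraMap O A.carrier) D.u * (D.x A Y)⁻¹

/-- The value at `φ` of the lift attached to a parameter. -/
def valPhi (Y : Matrix (Fin n) (Fin n) A.carrier) : G t n A.carrier :=
  D.x A Y * (Gmap t n (algebraMap O A.carrier) D.Φ * D.z A Y) * (D.x A Y)⁻¹

variable {A} {Y Y' : Matrix (Fin n) (Fin n) A.carrier}
  {X : G t n A.carrier}

theorem x_mem (hY : Y ∈ formalLie t n A) : D.x A Y ∈ formalGroup t n A :=
  chartG_mem D.adm (bc_E_mem_formalLie D.adm D.split hY)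

theorem z_mem (hY : Y ∈ formalLie t n A) : D.z A Y ∈ formalGroup t n A :=
  chartG_mem D.adm (sub_bc_E_mem_formalLie D.adm D.split hY)

theorem z_commute (hY : Y ∈ formalLie t n A) :
    mat (D.z A Y) * N.map (algebraMap O A.carrier) =
      N.map (algebraMap O A.carrier) * mat (D.z A Y) :=
  chartG_sub_bc_E_commute D.adm D.split hY

/-- Here `u = exp N` and `u ^ q = exp (q N)`, and conjugation passes through the exponential. -/
theorem conj_u_of_mul {f : G t n A.carrier}
    (hf : mat f * N.map (algebraMap O A.carrier) =
      (q : A.carrier) • (N.map (algebraMap O A.carrier) * mat f)) :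
    f * Gmap t n (algebraMap O A.carrier) D.u * f⁻¹ =
      Gmap t n (algebraMap O A.carrier) D.u ^ q := by
  have hA := admissible_carrier D.adm A
  refine mat_injective ?_
  have e1 : mat (Gmap t n (algebraMap O A.carrier) D.u ^ q) =
      mat (Gmap t n (algebraMap O A.carrier) D.u) ^ q := rfl
  have e2 : mat f * N.map (algebraMap O A.carrier) * mat f⁻¹ =
      (q : A.carrier) • N.map (algebraMap O A.carrier) := by
    rw [conj_eq_iff, hf, Matrix.smul_mul]
  rw [mat_mul, mat_mul, e1, D.mat_Gmap_u, truncExp_pow hA.isUnit_factorial hA.one_le (D.N_map_pow A),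
    ← e2, truncExp_conj (mat_inv_mul f)]

/-- The exponential is injective on matrices whose `n`-th power vanishes, so the group relation
descends to the linear one. -/
theorem mul_of_conj_u {f : G t n A.carrier}
    (hf : f * Gmap t n (algebraMap O A.carrier) D.u * f⁻¹ =
      Gmap t n (algebraMap O A.carrier) D.u ^ q) :
    mat f * N.map (algebraMap O A.carrier) =
      (q : A.carrier) • (N.map (algebraMap O A.carrier) * mat f) := by
  have hA := admissible_carrier D.adm A
  have e1 : mat (Gmap t n (algebraMap O A.carrier) D.u ^ q) =
      mat (Gmap t n (algebraMap O A.carrier) D.u) ^ q := rfl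
  have h1 := congrArg mat hf
  rw [mat_mul, mat_mul, e1, D.mat_Gmap_u, truncExp_pow hA.isUnit_factorial hA.one_le (D.N_map_pow A),
    ← truncExp_conj (mat_inv_mul f)] at h1
  have h2 := truncExp_injOn hA.isUnit_factorial hA.one_le
    (by rw [conj_pow' (mat_inv_mul f), D.N_map_pow A, Matrix.mul_zero, Matrix.zero_mul])
    (by rw [_root_.smul_pow, D.N_map_pow A, smul_zero]) h1
  rw [conj_eq_iff, Matrix.smul_mul] at h2
  exact h2

theorem valPhi_conj (hY : Y ∈ formalLie t n A) :
    D.valPhi A Y * D.valTau A Y * (D.valPhi A Y)⁻¹ = D.valTau A Y ^ q := by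
  have h1 : (Gmap t n (algebraMap O A.carrier) D.Φ * D.z A Y) *
      Gmap t n (algebraMap O A.carrier) D.u *
        (Gmap t n (algebraMap O A.carrier) D.Φ * D.z A Y)⁻¹ =
      Gmap t n (algebraMap O A.carrier) D.u ^ q := by
    refine D.conj_u_of_mul ?_
    rw [mat_mul, Matrix.mul_assoc, D.z_commute hY, ← Matrix.mul_assoc, D.mat_Gmap_Φ_mul,
      Matrix.smul_mul, Matrix.mul_assoc]
  rw [valTau, conj_pow, ← h1, valPhi]
  group

/-- `u ^ (p ^ m) = exp (p ^ m N)`, and `p` is nilpotent in `A`. -/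
theorem exists_u_pow_eq_one (A : ArtAlg O) :
    ∃ m : ℕ, Gmap t n (algebraMap O A.carrier) D.u ^ p ^ m = 1 := by
  have hA := admissible_carrier D.adm A
  obtain ⟨m, hm⟩ := A.exists_pow_eq_bot
  refine ⟨m, mat_injective ?_⟩
  have e1 : mat (Gmap t n (algebraMap O A.carrier) D.u ^ p ^ m) =
      mat (Gmap t n (algebraMap O A.carrier) D.u) ^ p ^ m := rfl
  have e2 : ((p ^ m : ℕ) : A.carrier) = 0 := by
    have := Ideal.pow_mem_pow hA.mem m
    rw [hm, Ideal.mem_bot] at this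
    exact_mod_cast this
  rw [e1, D.mat_Gmap_u, truncExp_pow hA.isUnit_factorial hA.one_le (D.N_map_pow A), e2, zero_smul,
    truncExp_zero hA.one_le]
  rfl

include D in
-- The structure map of `A` factors through a quotient of `O` by a power of its maximal ideal, where
-- continuity of `ν` is assumed.
theorem isLocallyConstant_Smap_ν (A : ArtAlg O) :
    IsLocallyConstant fun x => Smap t n (algebraMap O A.carrier) (ν x) := by
  obtain ⟨m, hm⟩ := A.exists_pow_eq_bot
  have hle : ∀ a ∈ maximalIdeal O ^ m, algebraMap O A.carrier a = 0 := by
    intro a ha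
    have h1 : (maximalIdeal O).map (algebraMap O A.carrier) ≤ maximalIdeal A.carrier :=
      Ideal.map_le_iff_le_comap.mpr fun a ha => ArtAlg.algebraMap_mem ha
    have h2 := Ideal.mem_map_of_mem (algebraMap O A.carrier) ha
    rw [Ideal.map_pow] at h2
    have h3 := Ideal.pow_right_mono h1 m h2
    rwa [hm, Ideal.mem_bot] at h3
  have h1 := (D.ν_cont m).comp (Smap t n (Ideal.Quotient.lift (maximalIdeal O ^ m)
    (algebraMap O A.carrier) hle))
  have h2 : (fun x => Smap t n (algebraMap O A.carrier) (ν x)) =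
      (Smap t n (Ideal.Quotient.lift (maximalIdeal O ^ m) (algebraMap O A.carrier)
        hle)) ∘
        fun x => Smap t n (Ideal.Quotient.mk (maximalIdeal O ^ m)) (ν x) := by
    funext x
    rw [Function.comp_apply, Smap_Smap, Ideal.Quotient.lift_comp_mk]
  rw [h2]
  exact h1

theorem Gmap_eq_one (hx : X ∈ Ghat t n A) : Gmap t n (residue A.carrier) X = 1 :=
  MonoidHom.mem_ker.mp hx

/-- A homomorphism with the prescribed values on the generators is a minimally ramified lift. -/
theorem mem_minRamLifts (hY : Y ∈ formalLie t n A) {ρ : Tame p q hq →* G t n A.carrier}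
    (hρ : IsLocallyConstant ρ) (hτ : ρ (tau hq) = D.valTau A Y)
    (hφ : ρ (phi hq) = D.valPhi A Y) : ρ ∈ minRamLifts ρbar N ν A := by
  have hcomp : (residue A.carrier).comp (algebraMap O A.carrier) =
      (ResidueField.map (algebraMap O A.carrier)).comp (residue O) :=
    RingHom.ext fun a => (ResidueField.map_residue (algebraMap O A.carrier) a).symm
  have hx1 := Gmap_eq_one (D.x_mem hY).1
  have hz1 := Gmap_eq_one (D.z_mem hY).1
  refine ⟨⟨hρ, fun y => ?_⟩, ⟨_, ⟨D.x A Y, (D.x_mem hY).1, rfl⟩, ?_⟩, fun y => ?_⟩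
  · have : (Gmap t n (residue A.carrier)).comp ρ =
        (Gmap t n (ResidueField.map (algebraMap O A.carrier))).comp ρbar := by
      refine tame_hom_ext (hq := hq) (hρ.comp (Gmap t n (residue A.carrier)))
        (D.ρbar_cont.comp (Gmap t n (ResidueField.map (algebraMap O A.carrier)))) ?_ ?_
      · rw [MonoidHom.comp_apply, MonoidHom.comp_apply, hτ, ← D.u_res, Gmap_Gmap, ← hcomp, valTau,
          map_mul, map_mul, map_inv, hx1, inv_one, mul_one, one_mul, Gmap_Gmap]
      · rw [MonoidHom.comp_apply, MonoidHom.comp_apply, hφ, ← D.Φ_res, Gmap_Gmap, ← hcomp, valPhi,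
          map_mul, map_mul, map_mul, map_inv, hx1, hz1, inv_one, mul_one, mul_one, one_mul,
          Gmap_Gmap]
    exact DFunLike.congr_fun this y
  · rw [hτ, truncExp_conj (mat_inv_mul _), ← D.mat_Gmap_u]
    rfl
  · have : (QuotientGroup.mk' (G' t n A.carrier)).comp ρ =
        (Smap t n (algebraMap O A.carrier)).comp ν := by
      refine tame_hom_ext (hq := hq) (hρ.comp (QuotientGroup.mk' (G' t n A.carrier)))
        (D.isLocallyConstant_Smap_ν A) ?_ ?_
      · rw [MonoidHom.comp_apply, MonoidHom.comp_apply, hτ, D.ν_tau, map_one]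
        refine (mk_conj D.adm.even _ _).trans ?_
        exact (QuotientGroup.eq_one_iff _).mpr (Gmap_mem_G' _ D.u_mem)
      · rw [MonoidHom.comp_apply, MonoidHom.comp_apply, hφ, D.ν_phi]
        refine (mk_conj D.adm.even _ _).trans ?_
        refine (QuotientGroup.eq.mpr ?_).symm
        change (Gmap t n (algebraMap O A.carrier) D.Φ)⁻¹ *
          (Gmap t n (algebraMap O A.carrier) D.Φ * D.z A Y) ∈ _
        rw [inv_mul_cancel_left]
        exact (D.z_mem hY).2
    exact DFunLike.congr_fun this y

theorem exists_hom [Finite (ResidueField O)] (hY : Y ∈ formalLie t n A) :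
    ∃ ρ : Tame p q hq →* G t n A.carrier, IsLocallyConstant ρ ∧ ρ (tau hq) = D.valTau A Y ∧
      ρ (phi hq) = D.valPhi A Y := by
  have : Finite (G t n A.carrier) := Finite.of_injective mat mat_injective
  obtain ⟨m, hm⟩ := D.exists_u_pow_eq_one A
  refine exists_tame_hom (m := m) ?_ (D.valPhi_conj hY)
  rw [valTau, conj_pow, hm, mul_one, mul_inv_cancel]

/-- Every minimally ramified lift is given by a parameter. -/
theorem exists_parameter [Finite (ResidueField O)] {ρ : Tame p q hq →* G t n A.carrier}
    (hρ : ρ ∈ minRamLifts ρbar N ν A) :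
    ∃ Y ∈ formalLie t n A, ρ (tau hq) = D.valTau A Y ∧ ρ (phi hq) = D.valPhi A Y := by
  obtain ⟨⟨-, hlift⟩, ⟨-, ⟨g, hg, rfl⟩, hN⟩, hν⟩ := hρ
  obtain ⟨X, hX, hEX, e⟩ := exists_conj_eq D.adm D.split hg
  have hcomp : (residue A.carrier).comp (algebraMap O A.carrier) =
      (ResidueField.map (algebraMap O A.carrier)).comp (residue O) :=
    RingHom.ext fun a => (ResidueField.map_residue (algebraMap O A.carrier) a).symm
  set x := chartG t A X
  have hx := chartG_mem D.adm hX
  have hτ : ρ (tau hq) = x * Gmap t n (algebraMap O A.carrier) D.u * x⁻¹ := by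
    refine mat_injective ?_
    rw [hN, e, truncExp_conj (mat_inv_mul _), ← D.mat_Gmap_u]
    rfl
  -- Undo the conjugation by `x`: the relation of `T_q` now holds between `f` and `u` itself.
  set f := x⁻¹ * ρ (phi hq) * x
  have hf : ρ (phi hq) = x * f * x⁻¹ := by simp only [f]; group
  have hrel : f * Gmap t n (algebraMap O A.carrier) D.u * f⁻¹ =
      Gmap t n (algebraMap O A.carrier) D.u ^ q := by
    have h1 := congrArg ρ (phi_tau hq)
    rw [map_mul, map_mul, map_inv, map_pow, hτ, hf, conj_pow] at h1
    have h2 : x * (f * Gmap t n (algebraMap O A.carrier) D.u * f⁻¹) * x⁻¹ =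
        x * (Gmap t n (algebraMap O A.carrier) D.u ^ q) * x⁻¹ := by
      rw [← h1]; group
    exact mul_left_cancel (mul_right_cancel h2)
  have hfN := D.mul_of_conj_u hrel
  set F := Gmap t n (algebraMap O A.carrier) D.Φ with hF
  -- `F` and `f` both carry `N` to `q N`, so their quotient centralizes `N`.
  have hzN : mat (F⁻¹ * f) * N.map (algebraMap O A.carrier) =
      N.map (algebraMap O A.carrier) * mat (F⁻¹ * f) := by
    have h1 : mat F * mat (F⁻¹ * f) = mat f := by rw [← mat_mul, mul_inv_cancel_left]
    refine F.1.isUnit.mul_right_injective ?_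
    change mat F * (mat (F⁻¹ * f) * _) = mat F * (_ * mat (F⁻¹ * f))
    rw [← Matrix.mul_assoc, h1, hfN, ← Matrix.mul_assoc, D.mat_Gmap_Φ_mul, Matrix.smul_mul,
      Matrix.mul_assoc, ← hF, h1]
  have hz : F⁻¹ * f ∈ formalGroup t n A := by
    constructor
    · have h1 := hlift (phi hq)
      rw [hf, map_mul, map_mul, map_inv, Gmap_eq_one hx.1, inv_one, one_mul, mul_one, ← D.Φ_res,
        Gmap_Gmap, ← hcomp, ← Gmap_Gmap] at h1
      refine MonoidHom.mem_ker.mpr ?_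
      rw [map_mul, map_inv, h1, hF, inv_mul_cancel]
    · have h1 := hν (phi hq)
      rw [hf, mk_conj D.adm.even, D.ν_phi] at h1
      exact QuotientGroup.eq.mp h1.symm
  obtain ⟨Z, hZ, hZz⟩ := exists_chartG_eq D.adm hz
  -- `Z` commutes with `N`, so `E Z = 0`, whereas `E X = X`. The single parameter `X + Z` therefore
  -- splits back into `X` and `Z`.
  have hEZ : bc A.carrier D.split.E Z = 0 := by
    rw [← hZz, chartG_commute D.adm hZ] at hzN
    refine matIn_bot.mp (D.split.bc_E_mem_of_commutator (matIn_bot.mpr ?_))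
    rw [hzN, sub_self]
  have hEY : bc A.carrier D.split.E (X + Z) = X := by rw [map_add, hEX, hEZ, add_zero]
  refine ⟨X + Z, ⟨add_mem hX.1 hZ.1, hX.2.add hZ.2⟩, ?_, ?_⟩
  · rw [hτ, valTau, TameDatum.x, hEY]
  · rw [hf, valPhi, TameDatum.x, TameDatum.z, hEY, add_sub_cancel_left, hZz, ← hF,
      mul_inv_cancel_left]

/-- The value at `τ` determines `x N x⁻¹`, as the exponential is injective, hence `x` modulo the
centralizer and so `E Y`. Once `x` is known, the value at `φ` determines `z`. -/
theorem parameter_unique (hY : Y ∈ formalLie t n A) (hY' : Y' ∈ formalLie t n A)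
    (hτ : D.valTau A Y = D.valTau A Y') (hφ : D.valPhi A Y = D.valPhi A Y') : Y = Y' := by
  have hA := admissible_carrier D.adm A
  have hmat : ∀ W, mat (D.valTau A W) =
      truncExp (mat (D.x A W) * N.map (algebraMap O A.carrier) * mat (D.x A W)⁻¹) := fun W => by
    rw [truncExp_conj (mat_inv_mul _), ← D.mat_Gmap_u]
    rfl
  have hpow : ∀ W, (mat (D.x A W) * N.map (algebraMap O A.carrier) * mat (D.x A W)⁻¹) ^ n = 0 :=
    fun W => by rw [conj_pow' (mat_inv_mul _), D.N_map_pow A, Matrix.mul_zero, Matrix.zero_mul]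
  have h1 := congrArg mat hτ
  rw [hmat, hmat] at h1
  have h2 := truncExp_injOn hA.isUnit_factorial hA.one_le (hpow Y) (hpow Y') h1
  have hx : bc A.carrier D.split.E Y = bc A.carrier D.split.E Y' := by
    refine eq_of_chartG_mul_eq D.adm D.split (bc_E_mem_formalLie D.adm D.split hY)
      (bc_E_mem_formalLie D.adm D.split hY') (D.split.bc_E_bc_E D.adm hY.1)
      (D.split.bc_E_bc_E D.adm hY'.1) (z := (D.x A Y)⁻¹ * D.x A Y') (mul_inv_cancel_left _ _) ?_
    refine (D.x A Y).1.isUnit.mul_right_injective ?_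
    change mat (D.x A Y) * (mat ((D.x A Y)⁻¹ * D.x A Y') * _) =
      mat (D.x A Y) * (_ * mat ((D.x A Y)⁻¹ * D.x A Y'))
    have h3 : mat (D.x A Y) * mat ((D.x A Y)⁻¹ * D.x A Y') = mat (D.x A Y') := by
      rw [← mat_mul, mul_inv_cancel_left]
    rw [← Matrix.mul_assoc, h3, conj_eq_iff.mp h2.symm, mat_mul]
    simp only [Matrix.mul_assoc]
  have hz : D.z A Y = D.z A Y' := by
    rw [valPhi, valPhi, x, x, hx] at hφ
    exact mul_left_cancel (mul_left_cancel (mul_right_cancel hφ))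
  have h4 := chartG_injOn D.adm (sub_bc_E_mem_formalLie D.adm D.split hY)
    (sub_bc_E_mem_formalLie D.adm D.split hY') hz
  rw [hx] at h4
  exact sub_left_injective h4

theorem Gmap_valTau (f : A.carrier →ₐ[O] B.carrier) (hY : Y ∈ formalLie t n A) :
    Gmap t n f.toRingHom (D.valTau A Y) = D.valTau B (Y.map f) := by
  have h1 : Gmap t n f.toRingHom (D.x A Y) = D.x B (Y.map f) := by
    rw [x, Gmap_chartG D.adm f (bc_E_mem_formalLie D.adm D.split hY), bc_natural]
    rfl
  have h2 : f.toRingHom.comp (algebraMap O A.carrier) = algebraMap O B.carrier :=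
    f.comp_algebraMap
  rw [valTau, valTau, map_mul, map_mul, map_inv, h1, Gmap_Gmap, h2]

theorem Gmap_valPhi (f : A.carrier →ₐ[O] B.carrier) (hY : Y ∈ formalLie t n A) :
    Gmap t n f.toRingHom (D.valPhi A Y) = D.valPhi B (Y.map f) := by
  have h1 : Gmap t n f.toRingHom (D.x A Y) = D.x B (Y.map f) := by
    rw [x, Gmap_chartG D.adm f (bc_E_mem_formalLie D.adm D.split hY), bc_natural]
    rfl
  have h3 : Gmap t n f.toRingHom (D.z A Y) = D.z B (Y.map f) := by
    rw [z, Gmap_chartG D.adm f (sub_bc_E_mem_formalLie D.adm D.split hY), z, ← bc_natural]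
    congr 1
    exact map_sub f.toRingHom.mapMatrix _ _
  have h2 : f.toRingHom.comp (algebraMap O A.carrier) = algebraMap O B.carrier :=
    f.comp_algebraMap
  rw [valPhi, valPhi, map_mul, map_mul, map_mul, map_inv, h1, h3, Gmap_Gmap, h2]

end TameDatum

end Parametrization

/-! ## Functors with coordinates -/

section Coordinates

variable {O : Type u} [CommRing O] [IsLocalRing O] {t : Family} {n : ℕ} {T : Type} [Group T]

/-- The functor `D` is naturally isomorphic to `A ↦ m_A ^ d`. -/
def HasCoordinates (d : ℕ) (D : ∀ A : ArtAlg O, Set (T →* G t n A.carrier)) : Prop :=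
  ∃ c : ∀ A : ArtAlg O, {x : Fin d → A.carrier // ∀ l, x l ∈ maximalIdeal A.carrier} ≃ D A,
    ∀ (A B : ArtAlg O) (f : A.carrier →ₐ[O] B.carrier)
      (x : {x : Fin d → A.carrier // ∀ l, x l ∈ maximalIdeal A.carrier}),
      (c B ⟨fun l => f (x.1 l), fun l => ArtAlg.map_mem_maximalIdeal f (x.2 l)⟩ :
        T →* G t n B.carrier) = push f (c A x)

variable {d : ℕ} {D : ∀ A : ArtAlg O, Set (T →* G t n A.carrier)}

theorem push_push {A B C : ArtAlg O} (f : A.carrier →ₐ[O] B.carrier) (g : B.carrier →ₐ[O] C.carrier)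
    (ρ : T →* G t n A.carrier) : push g (push f ρ) = push (g.comp f) ρ := rfl

namespace HasCoordinates

theorem push_mem (h : HasCoordinates d D) {A B : ArtAlg O} (f : A.carrier →ₐ[O] B.carrier)
    {ρ : T →* G t n A.carrier} (hρ : ρ ∈ D A) : push f ρ ∈ D B := by
  obtain ⟨c, hc⟩ := h
  have := hc A B f ((c A).symm ⟨ρ, hρ⟩)
  rw [Equiv.apply_symm_apply] at this
  rw [← this]
  exact Subtype.coe_prop _

/-- The functor `A ↦ m_A ^ d` respects fibre products, so the coordinates of the two images glue. -/
theorem cartesian (h : HasCoordinates d D) {A A₁ A₂ A₀ : ArtAlg O} (π₁ : A.carrier →ₐ[O] A₁.carrier)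
    (π₂ : A.carrier →ₐ[O] A₂.carrier) (f₁ : A₁.carrier →ₐ[O] A₀.carrier)
    (f₂ : A₂.carrier →ₐ[O] A₀.carrier) (hf : f₁.comp π₁ = f₂.comp π₂)
    (hA : ∀ a₁ a₂, f₁ a₁ = f₂ a₂ → ∃! a, π₁ a = a₁ ∧ π₂ a = a₂) (ρ : T →* G t n A.carrier) :
    ρ ∈ D A ↔ push π₁ ρ ∈ D A₁ ∧ push π₂ ρ ∈ D A₂ := by
  refine ⟨fun hρ => ⟨h.push_mem π₁ hρ, h.push_mem π₂ hρ⟩, fun ⟨h₁, h₂⟩ => ?_⟩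
  obtain ⟨c, hc⟩ := h
  obtain ⟨x₁, e₁⟩ := (c A₁).surjective ⟨_, h₁⟩
  obtain ⟨x₂, e₂⟩ := (c A₂).surjective ⟨_, h₂⟩
  have e : ∀ l, f₁ (x₁.1 l) = f₂ (x₂.1 l) := by
    have h3 := hc A₁ A₀ f₁ x₁
    have h4 := hc A₂ A₀ f₂ x₂
    rw [e₁, push_push, hf, ← push_push, ← Subtype.coe_mk (p := (· ∈ D A₂)) _ h₂, ← e₂, ← h4] at h3
    have h5 := congrArg Subtype.val ((c A₀).injective (Subtype.ext h3))
    exact fun l => congrFun h5 l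
  choose a ha hau using fun l => hA _ _ (e l)
  have ham : ∀ l, a l ∈ maximalIdeal A.carrier := fun l =>
    ArtAlg.mem_maximalIdeal_of_map π₁ (by rw [(ha l).1]; exact x₁.2 l)
  have g₁ : push π₁ (c A ⟨a, ham⟩ : T →* G t n A.carrier) = push π₁ ρ := by
    rw [← hc]
    refine Eq.trans ?_ (congrArg Subtype.val e₁)
    congr 2
    exact Subtype.ext (funext fun l => (ha l).1)
  have g₂ : push π₂ (c A ⟨a, ham⟩ : T →* G t n A.carrier) = push π₂ ρ := by
    rw [← hc]
    refine Eq.trans ?_ (congrArg Subtype.val e₂)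
    congr 2
    exact Subtype.ext (funext fun l => (ha l).2)
  -- The glued lift and `ρ` have the same images over both factors, and an element of a fibre
  -- product is determined by its two images.
  have key : (c A ⟨a, ham⟩ : T →* G t n A.carrier) = ρ := by
    refine MonoidHom.ext fun y => mat_injective ?_
    ext i j
    refine (hA _ _ (DFunLike.congr_fun hf (mat (ρ y) i j))).unique ⟨?_, ?_⟩ ⟨rfl, rfl⟩
    · exact congrArg (fun g : G t n A₁.carrier => mat g i j) (DFunLike.congr_fun g₁ y)
    · exact congrArg (fun g : G t n A₂.carrier => mat g i j) (DFunLike.congr_fun g₂ y)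
  rw [← key]
  exact Subtype.coe_prop _

theorem isLiftable (h : HasCoordinates d D) : IsLiftable D := by
  intro A₁ A₀ f hf _ ρ₀ hρ₀
  obtain ⟨c, hc⟩ := h
  obtain ⟨x₀, e₀⟩ := (c A₀).surjective ⟨_, hρ₀⟩
  choose x₁ hx₁ using fun l => hf (x₀.1 l)
  refine ⟨c A₁ ⟨x₁, fun l => ArtAlg.mem_maximalIdeal_of_map f (by rw [hx₁]; exact x₀.2 l)⟩,
    Subtype.coe_prop _, ?_⟩
  rw [← hc]
  refine Eq.trans ?_ (congrArg Subtype.val e₀)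
  congr 2
  exact Subtype.ext (funext hx₁)

/-- A homomorphism from the power series ring to `A` amounts to a choice of images of the variables
in the maximal ideal of `A`. -/
theorem proRepresents [IsNoetherianRing O] [IsAdicComplete (maximalIdeal O) O]
    (h : HasCoordinates d D) : ProRepresents (powerSeriesCoeffAlg O d) D := by
  obtain ⟨c, hc⟩ := h
  let v : ∀ A : ArtAlg O, ((powerSeriesCoeffAlg O d).carrier →ₐ[O] A.carrier) →
      {x : Fin d → A.carrier // ∀ l, x l ∈ maximalIdeal A.carrier} := fun A g =>
    ⟨fun l => (show MvPowerSeries (Fin d) O →ₐ[O] A.carrier from g) (MvPowerSeries.X l), fun l =>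
      powerSeries_map_mem A g (by
        rw [mem_maximalIdeal, mem_nonunits_iff, MvPowerSeries.isUnit_iff_constantCoeff,
          MvPowerSeries.constantCoeff_X]
        exact not_isUnit_zero)⟩
  have hv : ∀ A, Function.Bijective (v A) := fun A =>
    ⟨fun g g' e => powerSeries_algHom_ext fun l => congrFun (congrArg Subtype.val e) l, fun x =>
      let ⟨g, hg⟩ := exists_powerSeries_algHom A x.1 x.2
      ⟨g, Subtype.ext (funext hg)⟩⟩
  exact ⟨fun A => (Equiv.ofBijective _ (hv A)).trans (c A), fun A B f g => hc A B f (v A g)⟩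

end HasCoordinates

end Coordinates

/-! ## Coordinates on the functor of minimally ramified lifts -/

section MinRamCoordinates

variable {O : Type u} [CommRing O] [IsLocalRing O] [Finite (ResidueField O)] {t : Family} {n : ℕ}
  {p : ℕ} [Fact p.Prime] {q : ℕ} {hq : p.Coprime q}
  {ρbar : Tame p q hq →* G t n (ResidueField O)} {N : Matrix (Fin n) (Fin n) O}
  {ν : Tame p q hq →* S t n O}

/-- Coordinates of a lift are those of its parameter in a basis of `Lie G'`. Equality of lifts and
naturality are tested on `τ` and `φ`, where the values are explicit. -/
theorem TameDatum.hasCoordinates (D : TameDatum ρbar N ν) {d : ℕ}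
    (b : Module.Basis (Fin d) O (lieDerived t n O)) :
    HasCoordinates d (minRamLifts ρbar N ν) := by
  have hmem : ∀ (A : ArtAlg O) (x : {x : Fin d → A.carrier // ∀ l, x l ∈ maximalIdeal A.carrier}),
      coordMap b A.carrier x.1 ∈ formalLie t n A := fun A x =>
    ⟨coordMap_mem D.adm b x.1, coordMap_matIn b x.2⟩
  choose r hr hrτ hrφ using fun (A : ArtAlg O)
    (x : {x : Fin d → A.carrier // ∀ l, x l ∈ maximalIdeal A.carrier}) => D.exists_hom (hmem A x)
  have hrmem : ∀ A x, r A x ∈ minRamLifts ρbar N ν A := fun A x =>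
    D.mem_minRamLifts (hmem A x) (hr A x) (hrτ A x) (hrφ A x)
  refine ⟨fun A => Equiv.ofBijective (fun x => ⟨r A x, hrmem A x⟩) ⟨fun x y e => ?_, fun ρ => ?_⟩,
    fun A B f x => ?_⟩
  · have e' : r A x = r A y := congrArg Subtype.val e
    have h1 := D.parameter_unique (hmem A x) (hmem A y) (by rw [← hrτ, ← hrτ, e'])
      (by rw [← hrφ, ← hrφ, e'])
    refine Subtype.ext (funext fun l => ?_)
    rw [← bcFun_coordFun_coordMap D.adm b x.1 l, h1, bcFun_coordFun_coordMap]
  · obtain ⟨Y, hY, hτ, hφ⟩ := D.exists_parameter ρ.2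
    have hY' := coordMap_bcFun_coordFun D.adm b hY.1
    refine ⟨⟨fun l => bcFun A.carrier (coordFun D.adm b l) Y, fun l => bcFun_mem _ hY.2⟩,
      Subtype.ext (tame_hom_ext (hq := hq) (hr A _) ρ.2.1.1 ?_ ?_)⟩
    · rw [hrτ, hτ, hY']
    · rw [hrφ, hφ, hY']
  · have hn := coordMap_natural b f x.1
    refine tame_hom_ext (hq := hq) (hr B _) ((hr A x).comp (Gmap t n f.toRingHom)) ?_ ?_
    · refine (hrτ B _).trans ?_
      refine Eq.trans ?_ (congrArg (Gmap t n f.toRingHom) (hrτ A x)).symm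
      rw [D.Gmap_valTau f (hmem A x), hn]
    · refine (hrφ B _).trans ?_
      refine Eq.trans ?_ (congrArg (Gmap t n f.toRingHom) (hrφ A x)).symm
      rw [D.Gmap_valPhi f (hmem A x), hn]

omit [Finite (ResidueField O)] in
theorem conj_mem_minRamLifts (heven : t = .GSp → Even n) {A : ArtAlg O}
    {ρ : Tame p q hq →* G t n A.carrier} (hρ : ρ ∈ minRamLifts ρbar N ν A) {g : G t n A.carrier}
    (hg : g ∈ Ghat t n A) :
    (MulAut.conj g).toMonoidHom.comp ρ ∈ minRamLifts ρbar N ν A := by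
  obtain ⟨⟨h1, h2⟩, ⟨-, ⟨a, ha, rfl⟩, h3⟩, h4⟩ := hρ
  have hg1 : Gmap t n (residue A.carrier) g = 1 := MonoidHom.mem_ker.mp hg
  refine ⟨⟨h1.comp (MulAut.conj g), fun x => ?_⟩, ⟨_, ⟨g * a, mul_mem hg ha, rfl⟩, ?_⟩, fun x => ?_⟩
  · change Gmap t n (residue A.carrier) (g * ρ x * g⁻¹) = _
    rw [map_mul, map_mul, map_inv, hg1, h2, one_mul, inv_one, mul_one]
  · change mat g * mat (ρ (tau hq)) * mat g⁻¹ = _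
    rw [h3, ← truncExp_conj (mat_inv_mul g), _root_.mul_inv_rev, mat_mul, mat_mul]
    simp only [Matrix.mul_assoc]
  · exact (mk_conj heven _ _).trans (h4 x)

theorem TameDatum.isLiftingCondition (D : TameDatum ρbar N ν) {d : ℕ}
    (b : Module.Basis (Fin d) O (lieDerived t n O)) :
    IsLiftingCondition ρbar (minRamLifts ρbar N ν) where
  isLift _ _ hρ := hρ.1
  map _ _ f _ hρ := (D.hasCoordinates b).push_mem f hρ
  strictEquiv _ _ hρ _ hg := conj_mem_minRamLifts D.adm.even hρ hg
  cartesian _ _ _ _ π₁ π₂ f₁ f₂ hf hA ρ _ := (D.hasCoordinates b).cartesian π₁ π₂ f₁ f₂ hf hA ρ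

end MinRamCoordinates

/-! ## Matrices over the dual numbers -/

section Dual

variable {n : ℕ} {k : Type*} [CommRing k]

/-- The matrix `A + ε B` over the dual numbers. -/
def dual (A B : Matrix (Fin n) (Fin n) k) : Matrix (Fin n) (Fin n) (DualNumber k) :=
  A.map (TrivSqZeroExt.inlHom k k) + (DualNumber.eps : DualNumber k) • B.map (TrivSqZeroExt.inlHom k k)

variable {A B A' B' : Matrix (Fin n) (Fin n) k}

theorem dual_fst (A B : Matrix (Fin n) (Fin n) k) (i j : Fin n) :
    TrivSqZeroExt.fst (dual A B i j) = A i j := by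
  simp [dual]

theorem dual_snd (A B : Matrix (Fin n) (Fin n) k) (i j : Fin n) :
    TrivSqZeroExt.snd (dual A B i j) = B i j := by
  simp [dual]

theorem dual_inj : dual A B = dual A' B' ↔ A = A' ∧ B = B' := by
  refine ⟨fun h => ⟨?_, ?_⟩, fun h => by rw [h.1, h.2]⟩
  · ext i j
    rw [← dual_fst A B, h, dual_fst]
  · ext i j
    rw [← dual_snd A B, h, dual_snd]

theorem dual_fst_snd (M : Matrix (Fin n) (Fin n) (DualNumber k)) :
    dual (M.map TrivSqZeroExt.fst) (M.map TrivSqZeroExt.snd) = M := by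
  ext i j
  · rw [dual_fst]; rfl
  · rw [dual_snd]; rfl

theorem dual_zero (A : Matrix (Fin n) (Fin n) k) :
    dual A 0 = A.map (TrivSqZeroExt.inlHom k k) := by
  have : (0 : Matrix (Fin n) (Fin n) k).map (TrivSqZeroExt.inlHom k k) = 0 :=
    map_zero (TrivSqZeroExt.inlHom k k).mapMatrix
  rw [dual, this, smul_zero, add_zero]

theorem dual_one_zero : dual (1 : Matrix (Fin n) (Fin n) k) 0 = 1 := by
  rw [dual_zero]
  exact map_one (TrivSqZeroExt.inlHom k k).mapMatrix

theorem dual_mul : dual A B * dual A' B' = dual (A * A') (A * B' + B * A') := by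
  have h : (A * B' + B * A').map (TrivSqZeroExt.inlHom k k) =
      A.map (TrivSqZeroExt.inlHom k k) * B'.map (TrivSqZeroExt.inlHom k k) +
        B.map (TrivSqZeroExt.inlHom k k) * A'.map (TrivSqZeroExt.inlHom k k) := by
    have := map_add (TrivSqZeroExt.inlHom k k).mapMatrix (A * B') (B * A')
    rwa [map_mul, map_mul] at this
  simp only [dual, h, Matrix.map_mul, Matrix.add_mul, Matrix.mul_add, Matrix.smul_mul,
    Matrix.mul_smul, smul_smul, DualNumber.eps_mul_eps, zero_smul, smul_add]
  abel

theorem one_add_map_inr_mul (X g : Matrix (Fin n) (Fin n) k) :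
    (1 + X.map TrivSqZeroExt.inr) * g.map TrivSqZeroExt.inl = dual g (X * g) := by
  have h1 : (1 : Matrix (Fin n) (Fin n) (DualNumber k)) + X.map TrivSqZeroExt.inr = dual 1 X := by
    have : X.map TrivSqZeroExt.inr =
        (DualNumber.eps : DualNumber k) • X.map (TrivSqZeroExt.inlHom k k) := by
      ext i j <;> simp
    rw [this, ← dual_one_zero, dual_zero, dual]
  have h2 : g.map TrivSqZeroExt.inl = dual g 0 := (dual_zero g).symm
  rw [h1, h2, dual_mul, Matrix.one_mul, Matrix.mul_zero, zero_add]

/-- To first order `det (1 + ε X) = 1 + ε tr X`, and `star (1 + ε X) (1 + ε X) = 1 + ε (star X +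
X)`. -/
theorem isIsom_dual_one_iff {t : Family} (h : t = .GSp → Even n) {X : Matrix (Fin n) (Fin n) k} :
    IsIsom t (dual 1 X) ↔ X ∈ lieDerived t n k := by
  have h1 : (1 : Matrix (Fin n) (Fin n) k).map (TrivSqZeroExt.inlHom k k) = 1 :=
    map_one (TrivSqZeroExt.inlHom k k).mapMatrix
  by_cases ht : t = .GL
  · subst ht
    have htr : (X.map (TrivSqZeroExt.inlHom k k)).trace = TrivSqZeroExt.inl X.trace := by
      exact (map_sum (TrivSqZeroExt.inlHom k k) _ _).symm
    rw [mem_lieDerived_GL]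
    change (dual 1 X).det = 1 ↔ _
    rw [dual, h1, det_one_add_smul, sq, DualNumber.eps_mul_eps, mul_zero, add_zero, htr]
    constructor
    · intro h2
      have := congrArg TrivSqZeroExt.snd h2
      simpa using this
    · intro h2
      rw [h2, TrivSqZeroExt.inl_zero, zero_mul, add_zero]
  · have h2 : star t (dual 1 X) = dual 1 (star t X) := by
      rw [dual, dual, star_add, star_smul, ← star_map, ← star_map, star_one h]
    rw [isIsom_iff ht, mem_lieDerived ht, h2, dual_mul, ← dual_one_zero, dual_inj,
      Matrix.one_mul, Matrix.one_mul, Matrix.mul_one, add_comm, eq_neg_iff_add_eq_zero]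
    simp

end Dual

/-! ### The formal group over the dual numbers -/

section DualLifts

variable {O : Type u} [CommRing O] [IsLocalRing O] {t : Family} {n p : ℕ}

theorem mem_maximalIdeal_dualNumbers {a : (dualNumbers O).carrier} :
    a ∈ maximalIdeal (dualNumbers O).carrier ↔
      TrivSqZeroExt.fst (show DualNumber (ResidueField O) from a) = 0 := by
  rw [mem_maximalIdeal, mem_nonunits_iff]
  have h := TrivSqZeroExt.isUnit_iff_isUnit_fst (x := (show DualNumber (ResidueField O) from a))
  exact (not_congr h).trans (by rw [isUnit_iff_ne_zero, not_not])

/-- The inclusion of the residue field in its dual numbers. -/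
def inlDual (O : Type u) [CommRing O] [IsLocalRing O] : ResidueField O →+* (dualNumbers O).carrier :=
  TrivSqZeroExt.inlHom (ResidueField O) (ResidueField O)

theorem inlDual_comp_residue :
    (inlDual O).comp (residue O) = algebraMap O (dualNumbers O).carrier := rfl

theorem residue_comp_inlDual :
    (residue (dualNumbers O).carrier).comp (inlDual O) =
      ResidueField.map (algebraMap O (dualNumbers O).carrier) := by
  ext a
  obtain ⟨b, rfl⟩ := residue_surjective a
  rw [ResidueField.map_residue]
  rfl

theorem mat_Gmap_inlDual (g : G t n (ResidueField O)) :
    mat (Gmap t n (inlDual O) g) = dual (mat g) 0 := (dual_zero _).symm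

theorem exists_mat_eq_dual_one (h : Admissible t n p O) {X : Matrix (Fin n) (Fin n) (ResidueField O)}
    (hX : X ∈ lieDerived t n (ResidueField O)) :
    ∃ g ∈ formalGroup t n (dualNumbers O), mat g = dual 1 X := by
  have hi := (isIsom_dual_one_iff h.even).mpr hX
  obtain ⟨g, hg⟩ := exists_G_of_isIsom (R := (dualNumbers O).carrier) h.even hi
  have h1 : MatIn (maximalIdeal (dualNumbers O).carrier) (mat g - 1) := by
    intro i j
    rw [mem_maximalIdeal_dualNumbers, hg]
    change TrivSqZeroExt.fst ((dual 1 X - (1 : Matrix (Fin n) (Fin n)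
      (DualNumber (ResidueField O)))) i j) = 0
    rw [← dual_one_zero, Matrix.sub_apply, TrivSqZeroExt.fst_sub, dual_fst, dual_fst, sub_self]
  have hi' : IsIsom t (mat g) := by rw [hg]; exact hi
  exact ⟨g, ⟨mem_Ghat_iff.mpr h1, mem_G'_of_isIsom h.even hi' fun _ =>
    det_eq_one_of_isIsom (admissible_carrier h _) h1 hi'⟩, hg⟩

theorem mat_eq_dual_one (h : Admissible t n p O) {g : G t n (dualNumbers O).carrier}
    (hg : g ∈ formalGroup t n (dualNumbers O)) :
    mat g = dual 1 ((mat g).map TrivSqZeroExt.snd) ∧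
      (mat g).map TrivSqZeroExt.snd ∈ lieDerived t n (ResidueField O) := by
  have h1 := mem_Ghat_iff.mp hg.1
  have h2 : (mat g).map TrivSqZeroExt.fst = (1 : Matrix (Fin n) (Fin n) (ResidueField O)) := by
    ext i j
    have h3 := mem_maximalIdeal_dualNumbers.mp (h1 i j)
    have h4 : TrivSqZeroExt.fst ((1 : Matrix (Fin n) (Fin n) (DualNumber (ResidueField O))) i j) =
        (1 : Matrix (Fin n) (Fin n) (ResidueField O)) i j := by
      rw [← dual_one_zero, dual_fst]
    rw [← h4]
    exact sub_eq_zero.mp h3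
  have h3 : mat g = dual 1 ((mat g).map TrivSqZeroExt.snd) := by
    rw [← h2]
    exact (dual_fst_snd (k := ResidueField O) (mat g)).symm
  refine ⟨h3, (isIsom_dual_one_iff h.even).mp ?_⟩
  rw [← h3]
  exact isIsom_of_mem_G' (R := (dualNumbers O).carrier) h.even hg.2

end DualLifts

/-! ## Dimensions -/

section Dimension

variable {t : Family} {n p : ℕ} {R : Type*} [CommRing R]

theorem lieDerived_le_lie (h : t = .GSp → Even n) : lieDerived t n R ≤ lie t n R := by
  intro X hX
  by_cases ht : t = .GL
  · subst ht
    exact Submodule.mem_top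
  · rw [mem_lie_iff ht h, (mem_lieDerived ht).mp hX]
    exact ⟨0, by simp⟩

theorem one_mem_lie (h : t = .GSp → Even n) : (1 : Matrix (Fin n) (Fin n) R) ∈ lie t n R := by
  by_cases ht : t = .GL
  · subst ht
    exact Submodule.mem_top
  · rw [mem_lie_iff ht h, star_one h]
    exact ⟨2, by rw [two_smul]⟩

variable [IsLocalRing R]

theorem exists_lieDerived_add_smul (h : Admissible t n p R) {X : Matrix (Fin n) (Fin n) R}
    (hX : X ∈ lie t n R) : ∃ Y ∈ lieDerived t n R, ∃ a : R, Y + a • 1 = X := by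
  refine ⟨_, projDerived_mem h X, ?_⟩
  by_cases ht : t = .GL
  · subst ht
    exact ⟨_, sub_add_cancel _ _⟩
  · obtain ⟨a, ha⟩ := (mem_lie_iff ht h.even).mp hX
    refine ⟨Ring.inverse 2 * a, ?_⟩
    rw [projDerived_apply ht, mul_smul, ← ha, ← smul_add,
      show X - star t X + (star t X + X) = (2 : R) • X by rw [two_smul]; abel, smul_smul, Ring.inverse_mul_cancel _ (h.isUnit_two ht), one_smul]

theorem eq_zero_of_smul_one_mem (h : Admissible t n p R) {a : R}
    (ha : a • (1 : Matrix (Fin n) (Fin n) R) ∈ lieDerived t n R) : a = 0 := by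
  by_cases ht : t = .GL
  · subst ht
    rw [mem_lieDerived_GL, trace_smul, trace_one, Fintype.card_fin, smul_eq_mul] at ha
    exact (h.isUnit_n.mul_left_eq_zero).mp ha
  · rw [mem_lieDerived ht, star_smul, star_one h.even, eq_neg_iff_add_eq_zero, ← two_smul R,
      smul_smul] at ha
    have := congrFun (congrFun ha ⟨0, h.one_le⟩) ⟨0, h.one_le⟩
    rw [Matrix.smul_apply, one_apply_eq, smul_eq_mul, mul_one] at this
    exact (h.isUnit_two ht).mul_right_eq_zero.mp this

/-- The Lie algebra of `G` is that of `G'` plus the scalars, a direct sum because `n` and, outside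
the linear case, `2` are invertible. -/
theorem finrank_lie {k : Type*} [Field k] (h : Admissible t n p k) :
    Module.finrank k (lie t n k) = Module.finrank k (lieDerived t n k) + 1 := by
  let f : (lieDerived t n k × k) →ₗ[k] lie t n k :=
    (Submodule.inclusion (lieDerived_le_lie h.even)).coprod
      (LinearMap.toSpanSingleton k (lie t n k) ⟨1, one_mem_lie h.even⟩)
  have hf : ∀ x, (f x : Matrix (Fin n) (Fin n) k) = x.1 + x.2 • 1 := fun x => rfl
  have hbij : Function.Bijective f := by
    constructor
    · refine (injective_iff_map_eq_zero f).mpr fun x hx => ?_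
      have h1 : (x.1 : Matrix (Fin n) (Fin n) k) + x.2 • 1 = 0 := by rw [← hf, hx]; rfl
      have h2 : x.2 = 0 := by
        refine eq_zero_of_smul_one_mem h ?_
        rw [eq_neg_of_add_eq_zero_right h1]
        exact neg_mem x.1.2
      rw [h2, zero_smul, add_zero] at h1
      exact Prod.ext (Subtype.ext h1) h2
    · intro X
      obtain ⟨Y, hY, a, e⟩ := exists_lieDerived_add_smul h X.2
      exact ⟨(⟨Y, hY⟩, a), Subtype.ext e⟩
  rw [← (LinearEquiv.ofBijective f hbij).finrank_eq, Module.finrank_prod, Module.finrank_self]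

theorem finrank_lieDerived_residueField {O : Type u} [CommRing O] [IsLocalRing O] {d : ℕ}
    (h : Admissible t n p O) (b : Module.Basis (Fin d) O (lieDerived t n O)) :
    Module.finrank (ResidueField O) (lieDerived t n (ResidueField O)) = d := by
  have : IsLocalHom (algebraMap O (ResidueField O)) :=
    inferInstanceAs (IsLocalHom (residue O))
  have := (coordEquiv (A := ResidueField O) h b).finrank_eq
  rw [Module.finrank_fin_fun] at this
  exact this.symm

end Dimension

/-! ## Tangent spaces -/

section Adjoint

variable {t : Family} {n p : ℕ} {k : Type u} [Field k] {T : Type} [Group T]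
  (ρbar : T →* G t n k)

theorem adAct_mul_mat (x : T) (X : Matrix (Fin n) (Fin n) k) :
    adAct ρbar x X * mat (ρbar x) = mat (ρbar x) * X := by
  rw [adAct, Matrix.mul_assoc, mat_inv_mul, Matrix.mul_one]

theorem adAct_mul (x y : T) (X : Matrix (Fin n) (Fin n) k) :
    adAct ρbar (x * y) X = adAct ρbar x (adAct ρbar y X) := by
  simp only [adAct, map_mul, _root_.mul_inv_rev]
  have h1 : mat (ρbar x * ρbar y) = mat (ρbar x) * mat (ρbar y) := rfl
  have h2 : mat ((ρbar y)⁻¹ * (ρbar x)⁻¹) = mat (ρbar y)⁻¹ * mat (ρbar x)⁻¹ := rfl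
  rw [h1, h2]
  simp only [Matrix.mul_assoc]

/-- For a similitude `star g` is the multiplier times `g⁻¹`, so conjugation by `g` commutes with the
involution. -/
theorem conj_mem_lieDerived {R : Type*} [CommRing R] (h : t = .GSp → Even n) (g : G t n R)
    {X : Matrix (Fin n) (Fin n) R} (hX : X ∈ lieDerived t n R) :
    mat g * X * mat g⁻¹ ∈ lieDerived t n R := by
  by_cases ht : t = .GL
  · subst ht
    rw [mem_lieDerived_GL, trace_mul_comm, ← Matrix.mul_assoc, mat_inv_mul, Matrix.one_mul]
    exact hX
  · have hJ := formMatrix_isForm (R := R) h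
    have hmul : ∀ a b : Matrix (Fin n) (Fin n) R, star t (a * b) = star t b * star t a := hJ.adj_mul
    obtain ⟨c, hc⟩ := (mem_G_iff ht h).mp g.2
    have h1 : star t (mat g) = (c : R) • mat g⁻¹ := by
      have := congrArg (· * mat g⁻¹) hc
      simp only [Matrix.mul_assoc, Matrix.smul_mul, Matrix.one_mul] at this
      rwa [mat_mul_inv, Matrix.mul_one] at this
    have h2 : (c : R) • star t (mat g⁻¹) = mat g := by
      rw [← star_smul, ← h1]
      exact hJ.adj_adj _
    rw [mem_lieDerived ht, hmul, hmul, (mem_lieDerived ht).mp hX, h1, Matrix.mul_smul,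
      Matrix.mul_smul, ← Matrix.smul_mul, h2, Matrix.neg_mul, Matrix.mul_neg, Matrix.mul_assoc]

/-- Scalars have zero coboundary, so the scalar part of `X` may be dropped. -/
theorem exists_lieDerived_coboundary_eq (h : Admissible t n p k) {X : Matrix (Fin n) (Fin n) k}
    (hX : X ∈ lie t n k) :
    ∃ Y ∈ lieDerived t n k, ∀ x, adAct ρbar x X - X = adAct ρbar x Y - Y := by
  obtain ⟨Y, hY, a, rfl⟩ := exists_lieDerived_add_smul h hX
  refine ⟨Y, hY, fun x => ?_⟩
  have : mat (ρbar x) * mat (ρbar x)⁻¹ = 1 := mat_mul_inv _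
  simp only [adAct, Matrix.mul_add, Matrix.add_mul, Matrix.mul_smul, Matrix.smul_mul,
    Matrix.mul_one, this]
  abel

/-- The coboundary of an element of the Lie algebra. -/
def coboundary : Matrix (Fin n) (Fin n) k →ₗ[k] (T → Matrix (Fin n) (Fin n) k) where
  toFun X x := adAct ρbar x X - X
  map_add' X Y := by
    funext x
    simp only [adAct, Matrix.mul_add, Matrix.add_mul, Pi.add_apply]
    abel
  map_smul' a X := by
    funext x
    simp only [adAct, Matrix.mul_smul, Matrix.smul_mul, Pi.smul_apply, smul_sub, RingHom.id_apply]

theorem map_coboundary_lie : (lie t n k).map (coboundary ρbar) = B1 ρbar := by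
  ext c
  constructor
  · rintro ⟨X, hX, rfl⟩
    exact ⟨X, hX, fun _ => rfl⟩
  · rintro ⟨X, hX, h⟩
    exact ⟨X, hX, funext fun x => (h x).symm⟩

/-- Rank and nullity of the coboundary map on the Lie algebra. -/
theorem finrank_B1_add_finrank_H0 :
    Module.finrank k (B1 ρbar) + Module.finrank k (H0 ρbar) = Module.finrank k (lie t n k) := by
  let f := (coboundary ρbar).domRestrict (lie t n k)
  have h1 : LinearMap.range f = B1 ρbar := by
    rw [← map_coboundary_lie, LinearMap.range_domRestrict]
  have h2 : (LinearMap.ker f).map (lie t n k).subtype = H0 ρbar := by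
    ext X
    constructor
    · rintro ⟨Y, hY, rfl⟩
      exact ⟨Y.2, fun x => sub_eq_zero.mp (congrFun hY x)⟩
    · rintro ⟨hX, hX'⟩
      exact ⟨⟨X, hX⟩, funext fun x => sub_eq_zero.mpr (hX' x), rfl⟩
  have h3 := LinearMap.finrank_range_add_finrank_ker f
  rw [h1] at h3
  rw [← h3, ← h2, Submodule.finrank_map_subtype_eq]

theorem B1_le_Z1 [TopologicalSpace T] (h : Admissible t n p k) (hρ : IsLocallyConstant ρbar) : B1 ρbar ≤ Z1 ρbar := by
  rintro c ⟨X, hX, hc⟩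
  refine ⟨?_, fun x => ?_, fun x y => ?_⟩
  · have : c = (fun g : G t n k => mat g * X * mat g⁻¹ - X) ∘ ρbar := funext hc
    rw [this]
    exact hρ.comp _
  · obtain ⟨Y, hY, e⟩ := exists_lieDerived_coboundary_eq ρbar h hX
    rw [hc, e]
    exact lieDerived_le_lie h.even (sub_mem (conj_mem_lieDerived h.even _ hY) hY)
  · rw [hc, hc, hc, adAct_mul]
    have : adAct ρbar x (adAct ρbar y X - X) = adAct ρbar x (adAct ρbar y X) - adAct ρbar x X := by
      simp only [adAct, Matrix.mul_sub, Matrix.sub_mul]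
    rw [this]
    abel

end Adjoint

/-! ### Lifts to the dual numbers and the dimension of the tangent space -/

section Tangent

variable {O : Type u} [CommRing O] [IsLocalRing O] {t : Family} {n : ℕ} {p : ℕ} [Fact p.Prime]
  {q : ℕ} {hq : p.Coprime q}

/-- The cocycles corresponding to minimally ramified lifts to the dual numbers. -/
def tangentCocycles {k : Type u} [Field k] (ρbar : Tame p q hq →* G t n k) :
    Submodule k (Z1 ρbar) where
  -- The first condition says that the value at `τ` moves only by conjugation; the second that the
  -- class in `S` is that of the constant lift.
  carrier := {c | (∃ X ∈ lieDerived t n k, c.1 (tau hq) = adAct ρbar (tau hq) X - X) ∧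
    ∀ x, c.1 x ∈ lieDerived t n k}
  zero_mem' := ⟨⟨0, zero_mem _, by simp [adAct]⟩, fun _ => zero_mem _⟩
  add_mem' := by
    rintro c c' ⟨⟨X, hX, h⟩, h'⟩ ⟨⟨Y, hY, e⟩, e'⟩
    refine ⟨⟨X + Y, add_mem hX hY, ?_⟩, fun x => add_mem (h' x) (e' x)⟩
    have := congrFun ((coboundary ρbar).map_add X Y) (tau hq)
    exact (congrArg₂ (· + ·) h e).trans this.symm
  smul_mem' := by
    rintro a c ⟨⟨X, hX, h⟩, h'⟩
    refine ⟨⟨a • X, Submodule.smul_mem _ a hX, ?_⟩, fun x => Submodule.smul_mem _ a (h' x)⟩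
    have := congrFun ((coboundary ρbar).map_smul a X) (tau hq)
    exact (congrArg (a • ·) h).trans this.symm

theorem B1_submoduleOf_le_tangentCocycles {k : Type u} [Field k] (h : Admissible t n p k)
    (ρbar : Tame p q hq →* G t n k) : (B1 ρbar).submoduleOf (Z1 ρbar) ≤ tangentCocycles ρbar := by
  rintro c ⟨X, hX, hc⟩
  obtain ⟨Y, hY, e⟩ := exists_lieDerived_coboundary_eq ρbar h hX
  refine ⟨⟨Y, hY, (hc _).trans (e _)⟩, fun x => ?_⟩
  rw [show c.1 x = _ from (hc x).trans (e x)]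
  exact sub_mem (conj_mem_lieDerived h.even _ hY) hY

variable {ρbar : Tame p q hq →* G t n (ResidueField O)} {N : Matrix (Fin n) (Fin n) O}
  {ν : Tame p q hq →* S t n O}

theorem expEps_eq_dual (X g : Matrix (Fin n) (Fin n) (ResidueField O)) :
    expEps X g = dual g (X * g) := one_add_map_inr_mul X g

theorem mat_mul_Gmap_inlDual {g : G t n (dualNumbers O).carrier}
    {X : Matrix (Fin n) (Fin n) (ResidueField O)} (hg : mat g = dual 1 X)
    (r : G t n (ResidueField O)) :
    mat (g * Gmap t n (inlDual O) r) = dual (mat r) (X * mat r) := by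
  rw [mat_mul, hg, mat_Gmap_inlDual]
  refine (dual_mul (k := ResidueField O)).trans ?_
  rw [Matrix.one_mul, Matrix.mul_zero, zero_add]

theorem TameDatum.mat_u_dualNumbers (D : TameDatum ρbar N ν) :
    Gmap t n (algebraMap O (dualNumbers O).carrier) D.u = Gmap t n (inlDual O) (ρbar (tau hq)) := by
  rw [← inlDual_comp_residue, ← Gmap_Gmap, D.u_res]

/-- A cocycle with the required properties defines a minimally ramified lift. -/
theorem TameDatum.exists_lift_of_mem (D : TameDatum ρbar N ν) {c : Z1 ρbar}
    (hc : c ∈ tangentCocycles ρbar) :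
    ∃ ρ ∈ minRamLifts ρbar N ν (dualNumbers O), ∀ x, mat (ρ x) = expEps (c.1 x) (mat (ρbar x)) := by
  obtain ⟨⟨X, hX, hcτ⟩, hcd⟩ := hc
  choose g hg hgm using fun x => exists_mat_eq_dual_one D.adm (hcd x)
  have hm : ∀ x, mat (g x * Gmap t n (inlDual O) (ρbar x)) = expEps (c.1 x) (mat (ρbar x)) :=
    fun x => by rw [expEps_eq_dual, mat_mul_Gmap_inlDual (hgm x)]
  let ρ : Tame p q hq →* G t n (dualNumbers O).carrier :=
    MonoidHom.mk' (fun x => g x * Gmap t n (inlDual O) (ρbar x)) fun x y => by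
      refine mat_injective ?_
      change mat (g (x * y) * _) = mat (g x * _) * mat (g y * _)
      rw [hm, hm, hm, expEps_eq_dual, expEps_eq_dual, expEps_eq_dual]
      refine Eq.trans ?_ (dual_mul (k := ResidueField O)).symm
      have e : mat (ρbar (x * y)) = mat (ρbar x) * mat (ρbar y) := by rw [map_mul]; rfl
      rw [e, c.2.2.2 x y]
      refine congrArg (dual _) ?_
      rw [Matrix.add_mul, ← Matrix.mul_assoc (adAct _ _ _), adAct_mul_mat]
      simp only [Matrix.mul_assoc]
      abel
  have hρ : ∀ x, mat (ρ x) = expEps (c.1 x) (mat (ρbar x)) := hm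
  have hg1 : ∀ x, Gmap t n (residue (dualNumbers O).carrier) (g x) = 1 := fun x =>
    MonoidHom.mem_ker.mp (hg x).1
  refine ⟨ρ, ⟨⟨?_, fun x => ?_⟩, ?_, fun x => ?_⟩, hρ⟩
  · refine IsLocallyConstant.desc (⇑ρ) mat ?_ mat_injective
    have : mat ∘ ρ = fun x => expEps (c.1 x) (mat (ρbar x)) := funext hρ
    rw [this]
    exact c.2.1.comp₂ D.ρbar_cont fun X g => expEps X (mat g)
  · change Gmap t n (residue (dualNumbers O).carrier) (g x * Gmap t n (inlDual O) (ρbar x)) = _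
    rw [map_mul, hg1, one_mul, Gmap_Gmap, residue_comp_inlDual]
  -- Conjugating `r = ρ̄(τ)` by `1 - ε X` gives `r + ε (r X - X r)`, which is `1 + ε c(τ)` times
  -- `r`; hence the minus sign.
  · obtain ⟨y, hy, hym⟩ := exists_mat_eq_dual_one D.adm (neg_mem hX)
    refine ⟨_, ⟨y, hy.1, rfl⟩, ?_⟩
    rw [truncExp_conj (mat_inv_mul y), ← D.mat_Gmap_u, D.mat_u_dualNumbers]
    have key : dual 1 (-X) * dual (mat (ρbar (tau hq))) 0 =
        dual (mat (ρbar (tau hq))) (c.1 (tau hq) * mat (ρbar (tau hq))) * dual 1 (-X) := by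
      rw [dual_mul, dual_mul, dual_inj, hcτ, Matrix.sub_mul, adAct_mul_mat]
      refine ⟨by rw [Matrix.one_mul, Matrix.mul_one], ?_⟩
      simp only [Matrix.mul_zero, Matrix.mul_neg, Matrix.neg_mul, Matrix.mul_one]
      abel
    refine (conj_eq_iff.mpr ?_).symm
    exact (congrArg₂ (· * ·) hym (mat_Gmap_inlDual _)).trans (key.trans
      (congrArg₂ (· * ·) ((hρ _).trans (expEps_eq_dual _ _)).symm hym.symm))
  · change (QuotientGroup.mk (g x) * QuotientGroup.mk (Gmap t n (inlDual O) (ρbar x)) :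
      S t n (dualNumbers O).carrier) = _
    rw [(QuotientGroup.eq_one_iff _).mpr (hg x).2, one_mul, ← inlDual_comp_residue, ← Smap_Smap,
      D.ν_res]
    rfl

/-- A minimally ramified lift to the dual numbers is given by a cocycle. -/
theorem TameDatum.exists_mem_of_lift [Finite (ResidueField O)] (D : TameDatum ρbar N ν)
    {ρ : Tame p q hq →* G t n (dualNumbers O).carrier}
    (hρ : ρ ∈ minRamLifts ρbar N ν (dualNumbers O)) :
    ∃ c ∈ tangentCocycles ρbar, ∀ x, mat (ρ x) = expEps (c.1 x) (mat (ρbar x)) := by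
  obtain ⟨Y, hY, hτ, -⟩ := D.exists_parameter hρ
  obtain ⟨⟨hcont, hlift⟩, -, hν⟩ := hρ
  let g : Tame p q hq → G t n (dualNumbers O).carrier :=
    fun x => ρ x * (Gmap t n (inlDual O) (ρbar x))⁻¹
  have hg : ∀ x, g x ∈ formalGroup t n (dualNumbers O) := fun x => by
    constructor
    · refine MonoidHom.mem_ker.mpr ?_
      rw [map_mul, map_inv, hlift, Gmap_Gmap, residue_comp_inlDual, mul_inv_cancel]
    · refine (QuotientGroup.eq_one_iff _).mp ?_
      change (QuotientGroup.mk (ρ x) * (QuotientGroup.mk (Gmap t n (inlDual O) (ρbar x)))⁻¹ :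
        S t n (dualNumbers O).carrier) = 1
      rw [hν, ← inlDual_comp_residue, ← Smap_Smap, D.ν_res]
      exact mul_inv_cancel _
  let c : Tame p q hq → Matrix (Fin n) (Fin n) (ResidueField O) :=
    fun x => (mat (g x)).map TrivSqZeroExt.snd
  have hgc : ∀ x, mat (g x) = dual 1 (c x) := fun x => (mat_eq_dual_one D.adm (hg x)).1
  have hcd : ∀ x, c x ∈ lieDerived t n (ResidueField O) :=
    fun x => (mat_eq_dual_one D.adm (hg x)).2
  have hm : ∀ x, mat (ρ x) = dual (mat (ρbar x)) (c x * mat (ρbar x)) := fun x => by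
    rw [← mat_mul_Gmap_inlDual (hgc x), inv_mul_cancel_right]
  have hcc : IsLocallyConstant c := by
    have h1 := hcont.comp₂ D.ρbar_cont fun a r =>
      (mat (a * (Gmap t n (inlDual O) r)⁻¹)).map TrivSqZeroExt.snd
    exact h1
  have hcoc : ∀ x y, c (x * y) = c x + adAct ρbar x (c y) := fun x y => by
    have h1 : dual (mat (ρbar (x * y))) (c (x * y) * mat (ρbar (x * y))) =
        dual (mat (ρbar x)) (c x * mat (ρbar x)) * dual (mat (ρbar y)) (c y * mat (ρbar y)) := by
      refine (hm (x * y)).symm.trans ((congrArg mat (map_mul ρ x y)).trans ?_)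
      exact congrArg₂ (· * ·) (hm x) (hm y)
    rw [dual_mul, dual_inj] at h1
    refine (ρbar (x * y)).1.isUnit.mul_left_injective ?_
    change c (x * y) * mat (ρbar (x * y)) = (c x + adAct ρbar x (c y)) * mat (ρbar (x * y))
    rw [h1.2, h1.1, Matrix.add_mul, ← Matrix.mul_assoc (adAct _ _ _), adAct_mul_mat]
    simp only [Matrix.mul_assoc]
    abel
  refine ⟨⟨c, hcc, fun x => lieDerived_le_lie D.adm.even (hcd x), hcoc⟩, ⟨?_, hcd⟩,
    fun x => (hm x).trans (expEps_eq_dual _ _).symm⟩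
  -- Write the conjugating element as `1 + ε X`. Comparing `ε`-parts shows that `c(τ)` is the
  -- coboundary of `-X`.
  obtain ⟨e1, e2⟩ := mat_eq_dual_one D.adm (D.x_mem hY)
  set X := (mat (D.x (dualNumbers O) Y)).map TrivSqZeroExt.snd
  refine ⟨-X, neg_mem e2, ?_⟩
  have h1 : dual (mat (ρbar (tau hq))) (c (tau hq) * mat (ρbar (tau hq))) * dual 1 X =
      dual 1 X * dual (mat (ρbar (tau hq))) 0 := by
    have h2 : ρ (tau hq) * D.x (dualNumbers O) Y =
        D.x (dualNumbers O) Y * Gmap t n (inlDual O) (ρbar (tau hq)) := by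
      rw [hτ, valTau, D.mat_u_dualNumbers, inv_mul_cancel_right]
    exact (congrArg₂ (· * ·) (hm _).symm e1.symm).trans ((congrArg mat h2).trans
      (congrArg₂ (· * ·) e1 (mat_Gmap_inlDual _)))
  rw [dual_mul, dual_mul, dual_inj, Matrix.mul_zero, zero_add, Matrix.mul_one] at h1
  have h2 := h1.2
  rw [Matrix.mul_one] at h2
  refine (ρbar (tau hq)).1.isUnit.mul_left_injective ?_
  change c (tau hq) * mat (ρbar (tau hq)) = (adAct ρbar (tau hq) (-X) - -X) * mat (ρbar (tau hq))
  rw [Matrix.sub_mul, adAct_mul_mat, eq_sub_of_add_eq' h2, Matrix.mul_neg, Matrix.neg_mul]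
  abel

theorem dual_mat_injective {c c' : Z1 ρbar}
    (h : ∀ x, expEps (c.1 x) (mat (ρbar x)) = expEps (c'.1 x) (mat (ρbar x))) : c = c' := by
  refine Subtype.ext (funext fun x => ?_)
  have h1 := h x
  rw [expEps_eq_dual, expEps_eq_dual] at h1
  exact (ρbar x).1.isUnit.mul_left_injective (dual_inj.mp h1).2

theorem natCard_coordinates_dualNumbers (d : ℕ) :
    Nat.card {x : Fin d → (dualNumbers O).carrier // ∀ l, x l ∈ maximalIdeal _} =
      Nat.card (ResidueField O) ^ d := by
  have hc : Nat.card (Fin d → ResidueField O) = Nat.card (ResidueField O) ^ d := by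
    rw [Nat.card_fun, Nat.card_fin]
  rw [← hc]
  refine (Nat.card_congr (Equiv.ofBijective (fun y : Fin d → ResidueField O =>
    (⟨fun l => (TrivSqZeroExt.inr (y l) : DualNumber (ResidueField O)), fun l =>
      mem_maximalIdeal_dualNumbers.mpr (TrivSqZeroExt.fst_inr _ _)⟩ :
      {x : Fin d → (dualNumbers O).carrier // ∀ l, x l ∈ maximalIdeal _})) ⟨?_, ?_⟩)).symm
  · intro y y' h
    funext l
    exact TrivSqZeroExt.inr_injective (congrFun (congrArg Subtype.val h) l)
  · intro x
    refine ⟨fun l => TrivSqZeroExt.snd (show DualNumber (ResidueField O) from x.1 l),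
      Subtype.ext (funext fun l => ?_)⟩
    exact TrivSqZeroExt.ext ((TrivSqZeroExt.fst_inr _ _).trans
      (mem_maximalIdeal_dualNumbers.mp (x.2 l)).symm) (TrivSqZeroExt.snd_inr _ _)

/-- Cocycles correspond to lifts over `k[ε]`, and these to `d` coordinates in `ε k`, so the space
has `|k| ^ d` elements. As `k` is finite this gives the dimension, with no need for the bijection to
be linear. -/
theorem TameDatum.finrank_tangentCocycles [Finite (ResidueField O)] (D : TameDatum ρbar N ν)
    {d : ℕ} (b : Module.Basis (Fin d) O (lieDerived t n O)) :
    Module.Finite (ResidueField O) (tangentCocycles ρbar) ∧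
      Module.finrank (ResidueField O) (tangentCocycles ρbar) = d := by
  obtain ⟨e, -⟩ := D.hasCoordinates b
  choose F hF hFm using fun c : tangentCocycles ρbar => D.exists_lift_of_mem c.2
  have hbij : Function.Bijective (fun c : tangentCocycles ρbar =>
      (⟨F c, hF c⟩ : minRamLifts ρbar N ν (dualNumbers O))) := by
    constructor
    · intro c c' h
      have h1 : F c = F c' := congrArg Subtype.val h
      exact Subtype.ext (dual_mat_injective fun x => by rw [← hFm, ← hFm, h1])
    · intro ρ
      obtain ⟨c, hc, hcm⟩ := D.exists_mem_of_lift ρ.2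
      refine ⟨⟨c, hc⟩, Subtype.ext (MonoidHom.ext fun x => mat_injective ?_)⟩
      exact (hFm ⟨c, hc⟩ x).trans (hcm x).symm
  let E := (Equiv.ofBijective _ hbij).trans (e (dualNumbers O)).symm
  have : Finite (tangentCocycles ρbar) := Finite.of_equiv _ E.symm
  have hfin : Module.Finite (ResidueField O) (tangentCocycles ρbar) := Module.Finite.of_finite
  refine ⟨hfin, ?_⟩
  have h1 := Module.natCard_eq_pow_finrank (K := ResidueField O) (V := tangentCocycles ρbar)
  rw [Nat.card_congr E, natCard_coordinates_dualNumbers] at h1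
  exact (Nat.pow_right_injective Finite.one_lt_card h1).symm

/-- `W` is the quotient of the `d`-dimensional cocycle space by the coboundaries, whose dimension is
`dim Lie G - h⁰ = d + 1 - h⁰`. -/
theorem TameDatum.exists_tangentSpace [Finite (ResidueField O)] (D : TameDatum ρbar N ν)
    {d : ℕ} (b : Module.Basis (Fin d) O (lieDerived t n O)) :
    ∃ W : Submodule (ResidueField O) (H1 ρbar),
      IsTangentSpace ρbar (minRamLifts ρbar N ν) W ∧
        Module.Finite (ResidueField O) W ∧
        Module.finrank (ResidueField O) W + 1 = Module.finrank (ResidueField O) (H0 ρbar) := by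
  have hk : Admissible t n p (ResidueField O) := D.adm.map (residue O)
  have hle := B1_submoduleOf_le_tangentCocycles hk ρbar
  obtain ⟨hfin, hrank⟩ := D.finrank_tangentCocycles b
  set B := (B1 ρbar).submoduleOf (Z1 ρbar) with hB
  refine ⟨(tangentCocycles ρbar).map B.mkQ, fun c => ?_, ?_, ?_⟩
  -- All coboundaries lie in the cocycle space, so membership of a class does not depend on the
  -- representative.
  · have h1 : Submodule.Quotient.mk c ∈ (tangentCocycles ρbar).map B.mkQ ↔
        c ∈ tangentCocycles ρbar := by
      change c ∈ ((tangentCocycles ρbar).map B.mkQ).comap B.mkQ ↔ _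
      rw [Submodule.comap_map_mkQ, sup_eq_right.mpr hle]
    rw [h1]
    refine ⟨D.exists_lift_of_mem, fun ⟨ρ, hρ, hm⟩ => ?_⟩
    obtain ⟨c', hc', hm'⟩ := D.exists_mem_of_lift hρ
    rwa [dual_mat_injective (c := c) (c' := c') fun x => by rw [← hm, hm']]
  · exact inferInstance
  · have h1 := LinearMap.finrank_range_add_finrank_ker (K := ResidueField O)
      (V := tangentCocycles ρbar) (V₂ := Z1 ρbar ⧸ B) (B.mkQ.domRestrict (tangentCocycles ρbar))
    rw [LinearMap.range_domRestrict, LinearMap.ker_domRestrict, Submodule.ker_mkQ, hrank] at h1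
    have h2 : Module.finrank (ResidueField O) (B.submoduleOf (tangentCocycles ρbar)) =
        Module.finrank (ResidueField O) (B1 ρbar) := by
      rw [(Submodule.submoduleOfEquivOfLe hle).finrank_eq, hB,
        (Submodule.submoduleOfEquivOfLe (B1_le_Z1 ρbar hk D.ρbar_cont)).finrank_eq]
    have h3 := finrank_B1_add_finrank_H0 ρbar
    rw [finrank_lie hk, finrank_lieDerived_residueField D.adm b] at h3
    have h4 : ∀ W : Submodule (ResidueField O) (H1 ρbar), W = (tangentCocycles ρbar).map B.mkQ →
        Module.finrank (ResidueField O) W +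
          Module.finrank (ResidueField O) (B.submoduleOf (tangentCocycles ρbar)) = d := by
      rintro W rfl
      exact h1
    have h5 := h4 _ rfl
    omega

end Tangent

/-! ## Construction of the lifts of the values on the generators -/

section Construction

variable {t : Family} {n p : ℕ}

theorem pow_eq_zero_of_isNilpotent {k : Type*} [Field k] {X : Matrix (Fin n) (Fin n) k}
    (hX : IsNilpotent X) : X ^ n = 0 := by
  have h1 := (isNilpotent_charpoly_sub_pow_of_isNilpotent hX).eq_zero
  rw [sub_eq_zero, Fintype.card_fin] at h1
  have h2 := aeval_self_charpoly X
  rwa [h1, map_pow, Polynomial.aeval_X] at h2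

/-- In characteristic `p` the `p ^ m`-th power of `X - 1` is `X ^ p ^ m - 1 = 0`, and a nilpotent
matrix of size `n` has vanishing `n`-th power. -/
theorem sub_one_pow_eq_zero {k : Type*} [Field k] [Fact p.Prime] [CharP k p] (hn : 1 ≤ n)
    {X : Matrix (Fin n) (Fin n) k} {m : ℕ} (hX : X ^ p ^ m = 1) : (X - 1) ^ n = 0 := by
  have : NeZero n := ⟨by omega⟩
  refine pow_eq_zero_of_isNilpotent ⟨p ^ m, ?_⟩
  rw [sub_pow_char_pow_of_commute p m (Commute.one_right X), hX, one_pow, sub_self]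

variable {O : Type u} [CommRing O] [IsDomain O] [IsLocalRing O] [IsAdicComplete (maximalIdeal O) O]
  [Fact p.Prime] [CharP (ResidueField O) p] {q : ℕ} {hq : p.Coprime q}

theorem exists_tameDatum (h : Admissible t n p O)
    {ρbar : Tame p q hq →* G t n (ResidueField O)} (hρbar : IsLocallyConstant ρbar)
    {σ : n.Partition} {N : Matrix (Fin n) (Fin n) O} (hN : N ∈ lie t n O)
    (hlift : N.map (residue O) = truncLog (mat (ρbar (tau hq))))
    {K L : Type*} [Field K] [Field L] {φ : O →+* K} (hφ : Function.Injective φ)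
    {ψ : ResidueField O →+* L} (hk : InOrbit σ ((truncLog (mat (ρbar (tau hq)))).map ψ))
    (hK : InOrbit σ (N.map φ)) {ν : Tame p q hq →* S t n O}
    (hνcont : ∀ i : ℕ, IsLocallyConstant fun x =>
      Smap t n (Ideal.Quotient.mk (maximalIdeal O ^ i)) (ν x))
    (hνlift : ∀ x, Smap t n (residue O) (ν x) = QuotientGroup.mk (ρbar x))
    (hντ : ν (tau hq) = 1) : Nonempty (TameDatum ρbar N ν) := by
  have hadm : Admissible t n p (ResidueField O) := h.map (residue O)
  have hNn : N ^ n = 0 := pow_eq_zero_of_map φ hφ hK.pow_eq_zero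
  have hNd := mem_lieDerived_of_pow_eq_zero h hN hNn
  rw [← hlift] at hk
  -- The operator with factor `1` gives the splitting of the centralizer; the one with factor `q`,
  -- below, serves to lift the Frobenius.
  obtain ⟨T₁, hT₁⟩ := exists_pseudoInverse_twistedAd φ hφ ψ hK hk isUnit_one
  obtain ⟨s⟩ := exists_adSplitting h hNd hT₁
  obtain ⟨T, hT⟩ := exists_pseudoInverse_twistedAd φ hφ ψ hK hk (h.isUnit_natCast hq.symm)
  obtain ⟨u, hu, hum⟩ := exists_mat_eq_truncExp h hNd hNn
  have hNk : N.map (residue O) ^ n = 0 := by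
    have := map_pow (residue O).mapMatrix N n
    rw [hNn, map_zero] at this
    exact this.symm
  obtain ⟨m, hm⟩ := exists_pow_tau_eq_one hρbar
  -- `ρ̄(τ)` has `p`-power order in characteristic `p`, so it is unipotent and the exponential of
  -- its logarithm.
  have hexp : truncExp (N.map (residue O)) = mat (ρbar (tau hq)) := by
    rw [hlift, truncExp_truncLog hadm.isUnit_factorial h.one_le]
    refine sub_one_pow_eq_zero (p := p) h.one_le (m := m) ?_
    exact congrArg (fun g : G t n (ResidueField O) => mat g) hm
  have hures : Gmap t n (residue O) u = ρbar (tau hq) := by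
    refine mat_injective ?_
    rw [← hexp, ← truncExp_map _ h.isUnit_factorial, ← hum]
    rfl
  -- The relation between `ρ̄(φ)` and `ρ̄(τ)`, made linear by injectivity of the exponential.
  have hr : mat (ρbar (phi hq)) * N.map (residue O) =
      residue O q • (N.map (residue O) * mat (ρbar (phi hq))) := by
    have h1 := congrArg ρbar (phi_tau hq)
    rw [map_mul, map_mul, map_inv, map_pow] at h1
    have h2 : mat (ρbar (phi hq)) * mat (ρbar (tau hq)) * mat (ρbar (phi hq))⁻¹ =
        mat (ρbar (tau hq)) ^ q := congrArg (fun g : G t n (ResidueField O) => mat g) h1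
    rw [← hexp, truncExp_pow hadm.isUnit_factorial h.one_le hNk,
      ← truncExp_conj (mat_inv_mul _)] at h2
    have h3 := truncExp_injOn hadm.isUnit_factorial h.one_le
      (by rw [conj_pow' (mat_inv_mul _), hNk, Matrix.mul_zero, Matrix.zero_mul])
      (by rw [_root_.smul_pow, hNk, smul_zero]) h2
    rw [conj_eq_iff, Matrix.smul_mul] at h3
    rw [h3, map_natCast]
  -- Any representative of `ν(φ)` will do: it only prescribes the determinant or multiplier of the
  -- lift of Frobenius.
  obtain ⟨h₀, hh₀⟩ := QuotientGroup.mk_surjective (ν (phi hq))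
  have hh : (Gmap t n (residue O) h₀)⁻¹ * ρbar (phi hq) ∈ G' t n (ResidueField O) := by
    refine QuotientGroup.eq.mp ?_
    rw [← hνlift, ← hh₀]
    rfl
  obtain ⟨Φ, hΦ, hΦr, hΦh⟩ := exists_frobenius_lift h hNd hT hr h₀ hh
  exact ⟨{ adm := h
           split := s
           u := u
           Φ := Φ
           N_pow := hNn
           mat_u := hum
           u_mem := hu
           Φ_mul := hΦ
           u_res := hures
           Φ_res := hΦr
           ν_tau := hντ
           ν_phi := hh₀.symm.trans (QuotientGroup.eq.mpr hΦh)
           ν_cont := hνcont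
           ν_res := hνlift
           ρbar_cont := hρbar }⟩

end Construction

end MinRam

end

theorem mainTheorem6
    -- `O` is a complete discrete valuation ring with finite residue field of characteristic `p`
    {O : Type u} [CommRing O] [IsDomain O] [IsDiscreteValuationRing O]
    [IsAdicComplete (maximalIdeal O) O] [Finite (ResidueField O)]
    (p : ℕ) [Fact p.Prime] [CharP (ResidueField O) p]
    -- (A1) and (A2)
    (t : Family) (n : ℕ) (hn : 1 ≤ n) (hsp : t = Family.GSp → Even n)
    (hvg : VeryGood t n p) (hpn : n < p)
    -- (A3)
    (q : ℕ) (hq : p.Coprime q)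
    (hsq : ∃ a : Oˣ, (a : O) ^ 2 = q) (hsq₁ : ∃ a : Oˣ, (a : O) ^ 2 = -1)
    (hsq₂ : ∃ a : Oˣ, (a : O) ^ 2 = 2)
    -- the residual representation
    (ρbar : Tame p q hq →* G t n (ResidueField O)) (hρbar : IsLocallyConstant ρbar)
    -- (A4): the pure nilpotent `Nσ` lifting `N̄ = log ρ̄(τ)`, of the same type `σ` as `N̄`
    (σ : n.Partition) (Nσ : Matrix (Fin n) (Fin n) O) (hNσ : Nσ ∈ lie t n O)
    (hlift : Nσ.map (residue O) = truncLog (mat (ρbar (tau hq))))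
    (hk : InOrbit σ ((truncLog (mat (ρbar (tau hq)))).map
      (algebraMap (ResidueField O) (AlgebraicClosure (ResidueField O)))))
    (hK : InOrbit σ (Nσ.map (algebraMap O (AlgebraicClosure (FractionRing O)))))
    (hsmooth : CentralizerSmooth t Nσ)
    -- the fixed character `ν`: a continuous lift of `μ ∘ ρ̄` which is trivial on `τ`
    (ν : Tame p q hq →* S t n O)
    (hνcont : ∀ i : ℕ, IsLocallyConstant fun x =>
      Smap t n (Ideal.Quotient.mk (maximalIdeal O ^ i)) (ν x))
    (hνlift : ∀ x, Smap t n (residue O) (ν x) = QuotientGroup.mk (ρbar x))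
    (hντ : ν (tau hq) = 1) :
    IsLiftingCondition ρbar (minRamLifts ρbar Nσ ν) ∧
    IsLiftable (minRamLifts ρbar Nσ ν) ∧
    (∃ R : CoeffAlg O, ProRepresents R (minRamLifts ρbar Nσ ν) ∧
      ∃ d : ℕ, d + 1 = dimG t n (ResidueField O) ∧
        Nonempty (R.carrier ≃ₐ[O] MvPowerSeries (Fin d) O)) ∧
    ∃ W : Submodule (ResidueField O) (H1 ρbar),
      IsTangentSpace ρbar (minRamLifts ρbar Nσ ν) W ∧
        Module.Finite (ResidueField O) W ∧
        Module.finrank (ResidueField O) W + 1 = Module.finrank (ResidueField O) (H0 ρbar) := by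
  have hadm : Admissible t n p O :=
    { prime := Fact.out
      mem := by rw [← residue_eq_zero_iff, map_natCast, CharP.cast_eq_zero]
      one_le := hn
      lt := hpn
      even := hsp
      ne_two := fun ht => by
        cases t
        · exact absurd rfl ht
        · exact hvg
        · exact hvg }
  have hinj : Function.Injective (algebraMap O (AlgebraicClosure (FractionRing O))) := by
    rw [IsScalarTower.algebraMap_eq O (FractionRing O) (AlgebraicClosure (FractionRing O)),
      RingHom.coe_comp]
    exact (RingHom.injective _).comp (IsFractionRing.injective O (FractionRing O))
  obtain ⟨D⟩ := exists_tameDatum hadm hρbar hNσ hlift hinj hk hK hνcont hνlift hντ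
  -- A submodule of a finite free module over a discrete valuation ring is free. Its rank is the
  -- number of power series variables, and is also the dimension of the Lie algebra of `G'` over the
  -- residue field.
  let b := Module.finBasis O (lieDerived t n O)
  refine ⟨D.isLiftingCondition b, (D.hasCoordinates b).isLiftable,
    ⟨powerSeriesCoeffAlg O _, (D.hasCoordinates b).proRepresents, _, ?_, ⟨AlgEquiv.refl⟩⟩,
    D.exists_tangentSpace b⟩
  rw [dimG, finrank_lie (hadm.map (residue O)), finrank_lieDerived_residueField hadm b]
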